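/- Let $\mathcal B$ be a separable complex Banach space, $p\ge 1$, $A_1,\dots,A_p$ bounded linear operators on $\mathcal B$, and $(\varepsilon_t)_{t\in\mathbb Z}$ an iid sequence of $\mathcal B$-valued random variables with $E\varepsilon_t=0$, $E\|\varepsilon_t\|^2<\infty$ and positive definite covariance (that is, $E|f(\varepsilon_t)|^2=0$ implies $f=0$, for $f\in\mathcal B'$). A *solution* is a sequence $(X_t)_{t\ge -p+1}$ of centered, square integrable $\mathcal B$-valued random variables with $X_t-\sum_{j=1}^pA_jX_{t-j}=\varepsilon_t$ a.s. for $t\ge1$. It is *I(2)* if $\Delta^2X_t=\sum_{k\ge0}C_k\varepsilon_{t-k}$ (convergence in $L^2$) for all $t\ge1$, with bounded operators $C_k$ such that $\sum_k k\|C_k\|^2<\infty$ and $\sum_kC_k$ converges to a nonzero operator (if $p=1$, this involves an additional centered square integrable value $X_{-1}$, which may be chosen freely). On $\mathcal B^p$ with norm $\sum_j\|x_j\|$ let $\mathcal A_1(x_1,\dots,x_p)=(\sum_jA_jx_j,x_1,\dots,x_{p-1})$, $T=I-\mathcal A_1$, $\Pi_p(x_1,\dots,x_p)=x_1$ and $\Pi_p^*x=(x,0,\dots,0)$.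 Below, $U\oplus V$ always denotes an internal direct sum of closed subspaces. Assume: (a) for some $\eta>0$, $z=1$ is the only $z$ with $|z|<1+\eta$ for which $I-z\mathcal A_1$ is not invertible; (b) $\mathcal B^p=\operatorname{ran}T\oplus R_C$ for some subspace $R_C$; (c) $\mathcal B^p=\ker T\oplus K_C'$ for some subspace $K_C'$. Let $P_{\operatorname{ran}}$ be the projection onto $\operatorname{ran}T$ along $R_C$, let $T^g=(T|_{K_C'})^{-1}P_{\operatorname{ran}}$, $\mathcal K=\operatorname{ran}T\cap\ker T$ and $\mathcal W=(I-P_{\operatorname{ran}})\ker T$. Let $\mathcal N_j=-\frac1{2\pi i}\oint_{|z-1|=r}(z-1)^{-j-1}(I-z\mathcal A_1)^{-1}dz$ (counterclockwise, $0<r<\eta$), so that $(I-z\mathcal A_1)^{-1}=-\sum_j\mathcal N_j(z-1)^j$ near $z=1$, and let $\mathcal P=\mathcal N_{-1}\mathcal A_1$. The *I(2) condition* is: $\mathcal K\ne\{0\}$ and $\mathcal B^p=(\operatorname{ran}T+\ker T)\oplus T^g\mathcal K$. **1.** Suppose the I(2) condition holds. (i) There are subspaces $\mathcal K_C,\mathcal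 W_C$ with $\ker T=\mathcal K\oplus\mathcal K_C$ and $R_C=\mathcal W\oplus\mathcal W_C$. For all such $\mathcal K_C,\mathcal W_C$, let $P_{\mathcal W_C}$ be the projection onto $\mathcal W_C$ along $\operatorname{ran}T\oplus\mathcal W$, let $P_{\mathcal W}$ be the projection of $R_C$ onto $\mathcal W$ along $\mathcal W_C$, and let $Q=(I-P_{\operatorname{ran}})|_{\ker T}$. The maps $P_{\mathcal W_C}T^g|_{\mathcal K}:\mathcal K\to\mathcal W_C$ and $Q|_{\mathcal K_C}:\mathcal K_C\to\mathcal W$ are linear bijections, and with $Q^g=(Q|_{\mathcal K_C})^{-1}P_{\mathcal W}$, $\Gamma^L=T^g\mathcal N_{-2}$, $\Gamma^R=\mathcal N_{-2}T^g$, $$\mathcal N_{-2}=(P_{\mathcal W_C}T^g|_{\mathcal K})^{-1}P_{\mathcal W_C},\qquad \mathcal P=\Gamma^R+(I-\Gamma^R)\bigl(\Gamma^L+Q^g(I-P_{\operatorname{ran}})(I-\Gamma^L)\bigr).$$ (ii) There are bounded linear maps $L_0,L_1:\mathcal B^p\to\mathcal B$ and a strictly stationary sequence $(\nu_t)_{t\ge0}$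 of centered square integrable random variables, $$\nu_t=\sum_{j\ge0}h_j\varepsilon_{t-j}\ \text{ (in } L^2),\qquad h_j=\Pi_p\mathcal A_1^j(I-\mathcal P)\Pi_p^*,$$ such that every solution that is I(2) satisfies, a.s. for every $t\ge0$, $$X_t=\tau_0+\tau_1t-\Pi_p\mathcal N_{-2}\Pi_p^*\sum_{s=1}^t\xi_s+\Pi_p(\mathcal N_{-2}+\mathcal P)\Pi_p^*\xi_t+\nu_t,\qquad \xi_t=\sum_{s=1}^t\varepsilon_s,$$ with $\tau_i=L_i(X_0,X_{-1},\dots,X_{-p+1})$. Moreover there is $a\in[0,1)$ such that for every solution, I(2) or not, there is a square integrable random variable $R$ such that for every $t\ge0$ the two sides of this identity differ in norm by at most $a^tR$ a.s. (iii) I(2) solutions exist. **2.** If the I(2) condition fails, no solution is I(2). -/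

import Mathlib

open MeasureTheory ProbabilityTheory Filter Topology

noncomputable section

/-! ### Internal direct sums and generalized inverses -/

section Operators

variable {E : Type*} [NormedAddCommGroup E] [NormedSpace ℂ E]

/-- `S = U ⊕ V` as an internal direct sum: `U` and `V` are closed, meet only in `0`, and
their sum is `S`. -/
structure IsInternalDirectSum (S U V : Submodule ℂ E) : Prop where
  isClosed_left : IsClosed (U : Set E)
  isClosed_right : IsClosed (V : Set E)
  disjoint : Disjoint U V
  sup_eq : U ⊔ V = S

theorem IsInternalDirectSum.isCompl {U V : Submodule ℂ E} (h : IsInternalDirectSum ⊤ U V) :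
    IsCompl U V :=
  ⟨h.disjoint, codisjoint_iff.mpr h.sup_eq⟩

/-- If `E = R ⊕ C` and `C = W ⊕ V`, then `E = W ⊕ (R ⊕ V)`. -/
theorem IsInternalDirectSum.isCompl_sup_left {R C W V : Submodule ℂ E}
    (h : IsInternalDirectSum ⊤ R C) (h' : IsInternalDirectSum C W V) : IsCompl W (R ⊔ V) := by
  have hW : W ≤ C := h'.sup_eq ▸ le_sup_left
  have hV : V ≤ C := h'.sup_eq ▸ le_sup_right
  constructor
  · rw [Submodule.disjoint_def]
    intro x hx hx'
    obtain ⟨r, hr, v, hv, rfl⟩ := Submodule.mem_sup.mp hx'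
    have hrC : r ∈ C := by
      have := C.sub_mem (hW hx) (hV hv)
      simpa using this
    have hr0 : r = 0 := (Submodule.disjoint_def.mp h.disjoint) r hr hrC
    subst hr0
    rw [zero_add] at hx ⊢
    exact (Submodule.disjoint_def.mp h'.disjoint) v hx hv
  · rw [codisjoint_iff, sup_left_comm, h'.sup_eq, h.sup_eq]

theorem IsInternalDirectSum.symm {S U V : Submodule ℂ E} (h : IsInternalDirectSum S U V) :
    IsInternalDirectSum S V U :=
  ⟨h.isClosed_right, h.isClosed_left, h.disjoint.symm, sup_comm U V ▸ h.sup_eq⟩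

variable (T : E →ₗ[ℂ] E) {rC kC : Submodule ℂ E}

/-- The projection onto `ran T` along the complementary subspace `rC`. -/
def rangeProj (hr : IsInternalDirectSum ⊤ (LinearMap.range T) rC) : E →ₗ[ℂ] E :=
  (LinearMap.range T).projection rC hr.isCompl

/-- The generalized inverse `x ↦ (T|_{kC})⁻¹ P_{ran T} x`, for complementary subspaces `rC` of
`ran T` and `kC` of `ker T`. -/
def genInverse (hr : IsInternalDirectSum ⊤ (LinearMap.range T) rC)
    (hk : IsInternalDirectSum ⊤ (LinearMap.ker T) kC) : E →ₗ[ℂ] E :=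
  kC.subtype ∘ₗ (T.kerComplementEquivRange hk.symm.isCompl).symm.toLinearMap ∘ₗ
    (LinearMap.range T).projectionOnto rC hr.isCompl

/-- `𝒦 = ran T ∩ ker T`. -/
def kSpace : Submodule ℂ E := LinearMap.range T ⊓ LinearMap.ker T

/-- `𝒲 = (I - P_{ran T}) ker T`. -/
def wSpace (hr : IsInternalDirectSum ⊤ (LinearMap.range T) rC) : Submodule ℂ E :=
  (LinearMap.ker T).map (LinearMap.id - rangeProj T hr)

/-- The I(2) condition: `𝒦 ≠ {0}` and `E = (ran T + ker T) ⊕ T^g 𝒦`. -/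
def I2Condition (hr : IsInternalDirectSum ⊤ (LinearMap.range T) rC)
    (hk : IsInternalDirectSum ⊤ (LinearMap.ker T) kC) : Prop :=
  kSpace T ≠ ⊥ ∧
    IsInternalDirectSum ⊤ (LinearMap.range T ⊔ LinearMap.ker T)
      ((kSpace T).map (genInverse T hr hk))

/-- The spectrum of the linear pencil `z ↦ I - z a`. -/
def pencilSpectrum (a : E →L[ℂ] E) : Set ℂ := {z | ¬ IsUnit (1 - z • a)}

/-- The coefficients `N_j` of the Laurent expansion `(I - z a)⁻¹ = - ∑ N_j (z - 1)^j` around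
`z = 1`, as contour integrals over the counterclockwise circle of radius `r` around `1`. -/
def laurentN (a : E →L[ℂ] E) (r : ℝ) (j : ℤ) : E →L[ℂ] E :=
  -((2 * (Real.pi : ℂ) * Complex.I)⁻¹ •
    ∮ z in C(1, r), (z - 1) ^ (-(j + 1)) • Ring.inverse (1 - z • a))

/-- The Riesz projection `N_{-1} a` of the pencil `I - z a` at `z = 1`. -/
def rieszP (a : E →L[ℂ] E) (r : ℝ) : E →L[ℂ] E := laurentN a r (-1) * a

end Operators

/-! ### The companion form -/

section Companion

variable {B : Type*} [NormedAddCommGroup B] [NormedSpace ℂ B] (p : ℕ) [NeZero p]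

/-- The product space `B^p` with the norm `∑ ‖x_j‖`. -/
abbrev ProdSpace (B : Type*) (p : ℕ) : Type _ := PiLp 1 (fun _ : Fin p => B)

/-- The companion operator of `A_1, …, A_p`, where `A j` stands for `A_{j+1}`:
`(x_1, …, x_p) ↦ (A_1 x_1 + ⋯ + A_p x_p, x_1, …, x_{p-1})`. -/
def companion (A : Fin p → B →L[ℂ] B) : ProdSpace B p →L[ℂ] ProdSpace B p :=
  (PiLp.continuousLinearEquiv 1 ℂ (fun _ : Fin p => B)).symm.toContinuousLinearMap ∘L
    ContinuousLinearMap.pi fun i : Fin p =>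
      if i.val = 0 then ∑ j : Fin p, A j ∘L PiLp.proj 1 (fun _ : Fin p => B) j
      else PiLp.proj 1 (fun _ : Fin p => B) ⟨i.val - 1, (Nat.sub_le _ _).trans_lt i.isLt⟩

/-- `Π_p (x_1, …, x_p) = x_1`. -/
def coordProj : ProdSpace B p →L[ℂ] B := PiLp.proj 1 (fun _ : Fin p => B) 0

/-- `Π_p^* x = (x, 0, …, 0)`. -/
def coordEmb : B →L[ℂ] ProdSpace B p :=
  (PiLp.continuousLinearEquiv 1 ℂ (fun _ : Fin p => B)).symm.toContinuousLinearMap ∘L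
    ContinuousLinearMap.single ℂ (fun _ : Fin p => B) 0

end Companion

/-! ### Processes -/

section Processes

variable {Ω : Type*} [MeasurableSpace Ω] {B : Type*} [NormedAddCommGroup B] [NormedSpace ℂ B]
  [MeasurableSpace B]

/-- `X` is a `B`-valued random variable with `E X = 0` and `E ‖X‖² < ∞`. -/
structure IsCenteredL2 (μ : Measure Ω) (X : Ω → B) : Prop where
  measurable : Measurable X
  memLp : MemLp X 2 μ
  mean_zero : ∫ ω, X ω ∂μ = 0

/-- The covariance operator `f ↦ E[conj(f(X)) X]`; thus `f (C_X f) = E |f(X)|²`. -/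
def covOp (μ : Measure Ω) (X : Ω → B) (f : B →L[ℂ] ℂ) : B :=
  ∫ ω, (starRingEnd ℂ) (f (X ω)) • X ω ∂μ

/-- An iid sequence of centered square integrable random variables with positive definite
covariance operator. -/
structure IsInnovation (μ : Measure Ω) (ε : ℤ → Ω → B) : Prop where
  centered : ∀ t, IsCenteredL2 μ (ε t)
  indep : iIndepFun ε μ
  identDistrib : ∀ s t, IdentDistrib (ε s) (ε t) μ μ
  posDef : ∀ t, ∀ f : B →L[ℂ] ℂ, f (covOp μ (ε t) f) = 0 → f = 0

/-- `Y = ∑_{k ≥ 0} A_k ε_{t-k}`, the series converging in `L²`. -/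
def IsLinearSum (μ : Measure Ω) (ε : ℤ → Ω → B) (A : ℕ → B →L[ℂ] B) (t : ℤ) (Y : Ω → B) : Prop :=
  Tendsto (fun n : ℕ => eLpNorm (fun ω => Y ω - ∑ k ∈ Finset.range n, A k (ε (t - k) ω)) 2 μ)
    atTop (𝓝 0)

/-- Strict stationarity of `(Y_t, t ≥ 0)`: the law of the whole sequence is shift invariant. -/
def IsStationaryProc (μ : Measure Ω) (Y : ℕ → Ω → B) : Prop :=
  ∀ s : ℕ, IdentDistrib (fun ω (t : ℕ) => Y t ω) (fun ω (t : ℕ) => Y (t + s) ω) μ μ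

/-- `(X_t, t ≥ -p+1)` is a sequence of centered square integrable random variables satisfying
`X_t - A_1 X_{t-1} - ⋯ - A_p X_{t-p} = ε_t` almost surely for every `t ≥ 1`. Values `X_t` with
`t < -p+1` are irrelevant. -/
structure IsARSolution (μ : Measure Ω) {p : ℕ} (A : Fin p → B →L[ℂ] B) (ε X : ℤ → Ω → B) :
    Prop where
  centered : ∀ t : ℤ, -(p : ℤ) + 1 ≤ t → IsCenteredL2 μ (X t)
  law : ∀ t : ℤ, 1 ≤ t →
    ∀ᵐ ω ∂μ, X t ω - ∑ j : Fin p, A j (X (t - ((j.val : ℤ) + 1)) ω) = ε t ω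

/-- `X` is I(2) with innovations `ε`: the second differences satisfy
`Δ² X_t = ∑_{k ≥ 0} C_k ε_{t-k}` for `t ≥ 1`, where `∑ k ‖C_k‖² < ∞` and the series `∑ C_k`
converges to a nonzero operator. -/
structure IsI2 (μ : Measure Ω) (ε X : ℤ → Ω → B) : Prop where
  centered : ∀ t : ℤ, -1 ≤ t → IsCenteredL2 μ (X t)
  exists_coeff : ∃ C : ℕ → B →L[ℂ] B,
    Summable (fun k : ℕ => (k : ℝ) * ‖C k‖ ^ 2) ∧
    (∃ S : B →L[ℂ] B, S ≠ 0 ∧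
      Tendsto (fun n : ℕ => ∑ k ∈ Finset.range n, C k) atTop (𝓝 S)) ∧
    ∀ t : ℤ, 1 ≤ t →
      IsLinearSum μ ε C t (fun ω => X t ω - (2 : ℂ) • X (t - 1) ω + X (t - 2) ω)

/-- The random walk `ξ_t = ∑_{s=1}^t ε_s`. -/
def randomWalk (ε : ℤ → Ω → B) (t : ℕ) (ω : Ω) : B := ∑ s ∈ Finset.Icc 1 t, ε (s : ℤ) ω

/-- The vector `(X_0, X_{-1}, …, X_{-p+1})` of initial values. -/
def initialVec (p : ℕ) (X : ℤ → Ω → B) (ω : Ω) : ProdSpace B p :=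
  WithLp.toLp 1 fun i : Fin p => X (-(i.val : ℤ)) ω

/-- `τ₀ + τ₁ t - M ∑_{s=1}^t ξ_s + M' ξ_t + ν_t`. -/
def i2Representation (τ₀ τ₁ : Ω → B) (M M' : B →L[ℂ] B) (ε : ℤ → Ω → B) (ν : ℕ → Ω → B)
    (t : ℕ) (ω : Ω) : B :=
  τ₀ ω + (t : ℂ) • τ₁ ω - M (∑ s ∈ Finset.Icc 1 t, randomWalk ε s ω) + M' (randomWalk ε t ω)
    + ν t ω

end Processes

end

/-! Write `t = 1 - a` with `a` the companion operator. The I(2) condition is equivalent to a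
statement about `t` alone (`I2Condition_iff`), which yields ker t³ = ker t² and ran t³ = ran t²,
hence the whole space is ker t² ⊕ ran t² with both summands closed. The projection `Q` onto ker t²
along ran t² commutes with `t`, and `t` is invertible on ran t² (`IsNilProj.exists_of_I2Condition`).
On ran Q the pencil z t - (z - 1) is inverted by a terminating Neumann series, and on the complement
the inverse is holomorphic near 1. Hence N₋₂ = t Q and the Riesz projection is Q
(`IsNilProj.laurentN_eq`, `IsNilProj.rieszP_eq`). The closed forms follow because t Q inverts T^g on
𝒦 and vanishes on ran t + ker t (`IsNilProj.closed_forms`).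

The hypothesis on the spectrum makes aⁿ(1 - Q) decay geometrically (`IsNilProj.exists_decay`). A
solution, stacked into lag vectors, obeys X_t = a X_{t-1} + Π* ε_t. Its Q-part has a fixed by N = (1
- a)Q and a Q = Q - N, which produces the linear trend and the once and twice summed innovations.
Its (1 - Q)-part is a stationary series plus the transient aⁿ(1 - Q)(X₀ - V₀)
(`IsNilProj.recursion_solution`).

Positive definiteness of the covariance makes the coefficients of a linear process unique
(`IsLinearSum.coeff_eq_zero`), so the second differences of an I(2) solution have the coefficients
of (1 - z)²A(z)⁻¹. For such a solution the first coordinate of the transient has zero second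
differences and tends to zero, so it vanishes. Existence comes from summing the Q-part from a finite
starting time (`rootProcess`), since (1 - a)²Q = 0 removes that part from second differences.

Conversely, the partial sums of these coefficients are, up to sign, corners of aⁿ(1 - a). The shift
structure of the companion operator upgrades their convergence to that of the full operators
(`exists_tendsto_of_corner`). A nonzero norm limit then forces the I(2) condition by a Neumann
series argument (`I2Condition_of_tendsto`). -/

noncomputable section

/-! ### Generalized inverses and the I(2) condition in terms of `T`. -/

section GeneralizedInverse

variable {E : Type*} [NormedAddCommGroup E] [NormedSpace ℂ E]
variable {T : E →ₗ[ℂ] E} {rC kC : Submodule ℂ E}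
variable (hr : IsInternalDirectSum ⊤ (LinearMap.range T) rC)
  (hk : IsInternalDirectSum ⊤ (LinearMap.ker T) kC)

theorem rangeProj_mem (x : E) : rangeProj T hr x ∈ LinearMap.range T :=
  Submodule.projection_apply_mem _ x

theorem rangeProj_of_mem {x : E} (hx : x ∈ LinearMap.range T) : rangeProj T hr x = x :=
  Submodule.projection_apply_of_mem_left _ hx

theorem sub_rangeProj_mem (x : E) : x - rangeProj T hr x ∈ rC :=
  Submodule.sub_projection_mem _ x

theorem rangeProj_eq_zero_iff {x : E} : rangeProj T hr x = 0 ↔ x ∈ rC :=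
  Submodule.projection_apply_eq_zero_iff _

theorem eq_rangeProj_iff {x y : E} :
    y = rangeProj T hr x ↔ y ∈ LinearMap.range T ∧ x - y ∈ rC := by
  constructor
  · rintro rfl
    exact ⟨rangeProj_mem hr x, sub_rangeProj_mem hr x⟩
  · rintro ⟨h1, h2⟩
    rw [← rangeProj_eq_zero_iff hr, map_sub, rangeProj_of_mem hr h1, sub_eq_zero] at h2
    exact h2.symm

theorem genInverse_mem (x : E) : genInverse T hr hk x ∈ kC :=
  Submodule.coe_mem _

theorem apply_genInverse (x : E) : T (genInverse T hr hk x) = rangeProj T hr x := by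
  have h := (T.kerComplementEquivRange hk.symm.isCompl).apply_symm_apply
    ((LinearMap.range T).projectionOnto rC hr.isCompl x)
  exact congrArg Subtype.val h

theorem apply_genInverse_of_mem {x : E} (hx : x ∈ LinearMap.range T) :
    T (genInverse T hr hk x) = x := by
  rw [apply_genInverse, rangeProj_of_mem hr hx]

theorem eq_genInverse_iff {x y : E} :
    y = genInverse T hr hk x ↔ y ∈ kC ∧ T y = rangeProj T hr x := by
  constructor
  · rintro rfl
    exact ⟨genInverse_mem hr hk x, apply_genInverse hr hk x⟩
  · rintro ⟨h1, h2⟩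
    rw [← sub_eq_zero]
    refine Submodule.disjoint_def.mp hk.disjoint _ ?_ (kC.sub_mem h1 (genInverse_mem hr hk x))
    rw [LinearMap.mem_ker, map_sub, h2, apply_genInverse, sub_self]

/-- Closed graph theorem: the two conditions of `eq_rangeProj_iff` are closed because both summands
are. -/
theorem continuous_rangeProj [CompleteSpace E] : Continuous (rangeProj T hr) := by
  apply LinearMap.continuous_of_isClosed_graph
  have : ((rangeProj T hr).graph : Set (E × E)) =
      {q | q.2 ∈ (LinearMap.range T : Set E)} ∩ {q | q.1 - q.2 ∈ (rC : Set E)} := by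
    ext q
    exact eq_rangeProj_iff hr
  rw [this]
  exact (hr.isClosed_left.preimage continuous_snd).inter
    (hr.isClosed_right.preimage (continuous_fst.sub continuous_snd))

theorem continuous_genInverse [CompleteSpace E] (hT : Continuous T) :
    Continuous (genInverse T hr hk) := by
  apply LinearMap.continuous_of_isClosed_graph
  have : ((genInverse T hr hk).graph : Set (E × E)) =
      {q | q.2 ∈ (kC : Set E)} ∩ {q | T q.2 = rangeProj T hr q.1} := by
    ext q
    exact eq_genInverse_iff hr hk
  rw [this]
  exact (hk.isClosed_right.preimage continuous_snd).inter
    (isClosed_eq (hT.comp continuous_snd) ((continuous_rangeProj hr).comp continuous_fst))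

/-- This turns membership in ran T + ker T into T x ∈ T(ran T), the form in which the I(2) condition
is used throughout. -/
theorem mem_range_sup_ker_iff {x : E} :
    x ∈ LinearMap.range T ⊔ LinearMap.ker T ↔ ∃ u ∈ LinearMap.range T, T u = T x := by
  rw [Submodule.mem_sup]
  constructor
  · rintro ⟨u, hu, c, hc, rfl⟩
    exact ⟨u, hu, by rw [map_add, LinearMap.mem_ker.mp hc, add_zero]⟩
  · rintro ⟨u, hu, h⟩
    exact ⟨u, hu, x - u, by rw [LinearMap.mem_ker, map_sub, h, sub_self], by abel⟩

theorem mem_map_genInverse_kSpace_iff {x : E} :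
    x ∈ (kSpace T).map (genInverse T hr hk) ↔ x ∈ kC ∧ T x ∈ kSpace T := by
  constructor
  · rintro ⟨y, hy, rfl⟩
    refine ⟨genInverse_mem hr hk y, ?_⟩
    rw [apply_genInverse_of_mem hr hk hy.1]
    exact hy
  · rintro ⟨h1, h2⟩
    refine ⟨T x, h2, ((eq_genInverse_iff hr hk).mpr ⟨h1, ?_⟩).symm⟩
    rw [rangeProj_of_mem hr h2.1]

/-- The I(2) condition in terms of `T` alone: `ran T = 𝒦 ⊕ T (ran T)`, `ran T + ker T` closed. -/
theorem I2Condition_iff [CompleteSpace E] (hT : Continuous T) :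
    I2Condition T hr hk ↔ kSpace T ≠ ⊥ ∧
      IsClosed ((LinearMap.range T ⊔ LinearMap.ker T : Submodule ℂ E) : Set E) ∧
      (∀ u ∈ LinearMap.range T, T (T u) = 0 → T u = 0) ∧
      (∀ y ∈ LinearMap.range T, ∃ u ∈ LinearMap.range T, T (y - T u) = 0) := by
  constructor
  · rintro ⟨h0, h⟩
    refine ⟨h0, h.isClosed_left, fun u hu hTu => ?_, fun y hy => ?_⟩
    · have hK : T u ∈ kSpace T := ⟨⟨u, rfl⟩, hTu⟩
      have h1 : genInverse T hr hk (T u) = 0 := by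
        refine Submodule.disjoint_def.mp h.disjoint _ ?_ ⟨T u, hK, rfl⟩
        exact mem_range_sup_ker_iff.mpr ⟨u, hu, (apply_genInverse_of_mem hr hk hK.1).symm⟩
      rw [← apply_genInverse_of_mem hr hk hK.1, h1, map_zero]
    · obtain ⟨x, rfl⟩ := hy
      have hx : x ∈ (⊤ : Submodule ℂ E) := trivial
      rw [← h.sup_eq, Submodule.mem_sup] at hx
      obtain ⟨v, hv, w, hw, rfl⟩ := hx
      obtain ⟨u, hu, huv⟩ := mem_range_sup_ker_iff.mp hv
      refine ⟨u, hu, ?_⟩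
      rw [map_add, ← huv, add_sub_cancel_left]
      exact ((mem_map_genInverse_kSpace_iff hr hk).mp hw).2.2
  · rintro ⟨h0, hcl, h1, h2⟩
    refine ⟨h0, hcl, ?_, ?_, ?_⟩
    · have : (((kSpace T).map (genInverse T hr hk) : Submodule ℂ E) : Set E) =
          (kC : Set E) ∩ (T ⁻¹' (LinearMap.range T : Set E) ∩ {x | T (T x) = 0}) := by
        ext x
        exact mem_map_genInverse_kSpace_iff hr hk
      rw [this]
      exact hk.isClosed_right.inter ((hr.isClosed_left.preimage hT).inter
        (isClosed_eq (hT.comp hT) continuous_const))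
    · rw [Submodule.disjoint_def]
      intro x hx hx'
      rw [mem_map_genInverse_kSpace_iff] at hx'
      obtain ⟨u, hu, hux⟩ := mem_range_sup_ker_iff.mp hx
      have hTx : T x = 0 := by
        rw [← hux]
        exact h1 u hu (by rw [hux]; exact hx'.2.2)
      exact Submodule.disjoint_def.mp hk.disjoint x hTx hx'.1
    · rw [eq_top_iff]
      intro x _
      obtain ⟨u, hu, h⟩ := h2 (T x) ⟨x, rfl⟩
      -- With T x = T u + k and k ∈ 𝒦, the component of x in T^g 𝒦 is T^g k; what remains has the
      -- same image as u ∈ ran T.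
      have hK : T x - T u ∈ kSpace T := ⟨⟨x - u, map_sub _ _ _⟩, h⟩
      rw [Submodule.mem_sup]
      refine ⟨x - genInverse T hr hk (T x - T u), ?_, genInverse T hr hk (T x - T u),
        ⟨_, hK, rfl⟩, sub_add_cancel _ _⟩
      refine mem_range_sup_ker_iff.mpr ⟨u, hu, ?_⟩
      rw [map_sub, apply_genInverse_of_mem hr hk hK.1, sub_sub_cancel]

end GeneralizedInverse

/-! ### The spectral splitting at a pole of order two. -/

section SecondOrderPole

variable {E : Type*} [NormedAddCommGroup E] [NormedSpace ℂ E]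

/-- `Q` is a bounded projection commuting with `t`, `t` is invertible on `ker Q`, and `t ^ 2 = 0`
on `ran Q`. -/
structure IsNilProj (t Q : E →L[ℂ] E) : Prop where
  idem : Q * Q = Q
  comm : t * Q = Q * t
  sq : t * t * Q = 0
  isUnit : IsUnit (Q + t * (1 - Q))

/-- The unit u = Q + t(1 - Q) satisfies u²(1 - Q) = (1 - Q)t², so t²x = 0 forces (1 - Q)x = 0.
Together with `sq` this identifies ran Q with ker t². -/
theorem IsNilProj.apply_of_sq_eq_zero {t Q : E →L[ℂ] E} (h : IsNilProj t Q) {x : E}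
    (hx : t (t x) = 0) : Q x = x := by
  have e1 : (Q + t * (1 - Q)) * (Q + t * (1 - Q)) * (1 - Q) = (1 - Q) * (t * t) := by
    have c := h.comm
    have i := h.idem
    have a1 : Q * (1 - Q) = 0 := by rw [mul_sub, mul_one, i, sub_self]
    have a2 : (1 - Q) * (1 - Q) = 1 - Q := by rw [sub_mul, one_mul, a1, sub_zero]
    have a3 : t * (1 - Q) = (1 - Q) * t := by rw [mul_sub, sub_mul, c, mul_one, one_mul]
    have a4 : (Q + t * (1 - Q)) * (1 - Q) = t * (1 - Q) := by
      rw [add_mul, a1, zero_add, mul_assoc, a2]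
    calc (Q + t * (1 - Q)) * (Q + t * (1 - Q)) * (1 - Q)
        = (Q + t * (1 - Q)) * (t * (1 - Q)) := by rw [mul_assoc, a4]
      _ = (Q + t * (1 - Q)) * ((1 - Q) * t) := congrArg _ a3
      _ = (1 - Q) * (t * t) := by rw [← mul_assoc, a4, a3, mul_assoc]
  obtain ⟨v, hv⟩ := h.isUnit
  have h3 : ((1 - Q) * (t * t)) x = 0 := by
    change (1 - Q) (t (t x)) = 0
    rw [hx, map_zero]
  have h2 : (1 - Q) x = 0 := by
    have : 1 - Q = (↑v⁻¹ : E →L[ℂ] E) * ↑v⁻¹ * ((1 - Q) * (t * t)) := by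
      rw [← e1, ← hv]
      simp only [mul_assoc, Units.inv_mul_cancel_left]
    rw [this]
    change ((↑v⁻¹ : E →L[ℂ] E) * ↑v⁻¹) (((1 - Q) * (t * t)) x) = 0
    rw [h3, map_zero]
  exact (sub_eq_zero.mp h2).symm

/-- The I(2) condition gives ascent and descent at most two, so the space splits as ker t² ⊕ ran t²;
`Q` is the projection onto the first summand. Closedness of ran t + ker t is what makes ran t²
closed and `Q` bounded. -/
theorem IsNilProj.exists_of_I2Condition [CompleteSpace E] {t : E →L[ℂ] E} {rC kC : Submodule ℂ E}
    (hr : IsInternalDirectSum ⊤ (LinearMap.range t.toLinearMap) rC)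
    (hk : IsInternalDirectSum ⊤ (LinearMap.ker t.toLinearMap) kC)
    (h : I2Condition t.toLinearMap hr hk) : ∃ Q, IsNilProj t Q := by
  obtain ⟨-, hcl, h1, h2⟩ := (I2Condition_iff hr hk t.continuous).mp h
  set Y : Submodule ℂ E := (LinearMap.range t.toLinearMap).map t.toLinearMap with hY
  set Z : Submodule ℂ E := LinearMap.ker (t * t).toLinearMap with hZ
  have memZ : ∀ x, x ∈ Z ↔ t (t x) = 0 := fun x => Iff.rfl
  have memY : ∀ x, x ∈ Y ↔ ∃ u, t (t u) = x := fun x =>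
    ⟨by rintro ⟨_, ⟨u, rfl⟩, rfl⟩; exact ⟨u, rfl⟩,
     by rintro ⟨u, rfl⟩; exact ⟨t u, ⟨u, rfl⟩, rfl⟩⟩
  have h1' : ∀ x, t (t (t x)) = 0 → t (t x) = 0 := fun x => h1 (t x) ⟨x, rfl⟩
  have h2' : ∀ x, ∃ w, t (t x) = t (t (t w)) := by
    intro x
    obtain ⟨_, ⟨w, rfl⟩, hw⟩ := h2 (t x) ⟨x, rfl⟩
    exact ⟨w, sub_eq_zero.mp ((map_sub t _ _).symm.trans hw)⟩
  -- An element y of ran t lies in t(ran t) exactly when T^g y lies in ran t + ker t, so Y is ran t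
  -- intersected with the preimage of a closed set under a continuous map.
  have hYcl : IsClosed (Y : Set E) := by
    have hc := continuous_genInverse hr hk t.continuous
    have : (Y : Set E) = (LinearMap.range t.toLinearMap : Set E) ∩
        (genInverse t.toLinearMap hr hk) ⁻¹'
          ((LinearMap.range t.toLinearMap ⊔ LinearMap.ker t.toLinearMap : Submodule ℂ E)) := by
      ext y
      simp only [Set.mem_inter_iff, SetLike.mem_coe, Set.mem_preimage, mem_range_sup_ker_iff, hY,
        Submodule.mem_map]
      constructor
      · rintro ⟨u, hu, rfl⟩
        exact ⟨⟨u, rfl⟩, u, hu, (apply_genInverse_of_mem hr hk ⟨u, rfl⟩).symm⟩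
      · rintro ⟨hy, u, hu, e⟩
        exact ⟨u, hu, e.trans (apply_genInverse_of_mem hr hk hy)⟩
    rw [this]
    exact hr.isClosed_left.inter (hcl.preimage hc)
  have hcompl : IsCompl Z Y := by
    constructor
    · rw [Submodule.disjoint_def]
      rintro x hx hx'
      obtain ⟨u, rfl⟩ := (memY x).mp hx'
      exact h1' _ (h1' _ hx)
    · rw [codisjoint_iff, eq_top_iff]
      intro x _
      -- Two applications of ran t² = ran t³ give t²x = t⁴w', so x - t²w' is killed by t².
      obtain ⟨w, hw⟩ := h2' x
      obtain ⟨w', hw'⟩ := h2' w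
      rw [Submodule.mem_sup]
      refine ⟨x - t (t w'), ?_, t (t w'), (memY _).mpr ⟨w', rfl⟩, by abel⟩
      rw [memZ, map_sub, map_sub, hw, hw', sub_self]
  have hZcl : IsClosed (Z : Set E) := (t * t).isClosed_ker
  have htop := Submodule.IsCompl.isTopCompl_of_isClosed hcompl hZcl hYcl
  let Q : E →L[ℂ] E := Z.subtypeL ∘L Z.projectionOntoL Y htop
  have hQZ : ∀ x ∈ Z, Q x = x := fun x hx => Submodule.projection_apply_of_mem_left hcompl hx
  have hQY : ∀ x ∈ Y, Q x = 0 := fun x hx =>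
    (Submodule.projection_apply_eq_zero_iff hcompl).mpr hx
  have hQm : ∀ x, Q x ∈ Z := fun x => Submodule.projection_apply_mem hcompl x
  have hQs : ∀ x, x - Q x ∈ Y := fun x => Submodule.sub_projection_mem hcompl x
  have hcomm : t * Q = Q * t := by
    ext x
    change t (Q x) = Q (t x)
    have e1 : t x = t (Q x) + t (x - Q x) := by rw [← map_add, add_sub_cancel]
    have e2 : t (Q x) ∈ Z := by rw [memZ, (memZ _).mp (hQm x), map_zero]
    have e3 : t (x - Q x) ∈ Y := by
      obtain ⟨u, hu⟩ := (memY _).mp (hQs x)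
      exact (memY _).mpr ⟨t u, by rw [hu]⟩
    rw [e1, map_add, hQZ _ e2, hQY _ e3, add_zero]
  refine ⟨Q, ?_, hcomm, ?_, ?_⟩
  · ext x
    exact hQZ _ (hQm x)
  · ext x
    exact hQm x
  · rw [ContinuousLinearMap.isUnit_iff_bijective]
    have hc : ∀ x, t (Q x) = Q (t x) := fun x => congrArg (fun f : E →L[ℂ] E => f x) hcomm
    constructor
    · rw [injective_iff_map_eq_zero]
      intro x hx
      change Q x + t (x - Q x) = 0 at hx
      have hty : t (x - Q x) ∈ Y := by
        obtain ⟨u, hu⟩ := (memY _).mp (hQs x)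
        exact (memY _).mpr ⟨t u, by rw [hu]⟩
      have hQx : Q x = 0 := by
        have := congrArg Q hx
        rwa [map_add, hQZ _ (hQm x), hQY _ hty, add_zero, map_zero] at this
      have hY' := hQs x
      rw [hQx, sub_zero] at hY' hx
      rw [zero_add] at hx
      exact Submodule.disjoint_def.mp hcompl.disjoint x
        ((memZ x).mpr (by rw [hx, map_zero])) hY'
    · intro y
      -- The part y - Q y is in ran t² = ran t³, hence is t applied to an element of ran t², on
      -- which Q vanishes.
      obtain ⟨u, hu⟩ := (memY _).mp (hQs y)
      obtain ⟨w, hw⟩ := h2' u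
      have hY' : t (t w) ∈ Y := (memY _).mpr ⟨w, rfl⟩
      refine ⟨Q y + t (t w), ?_⟩
      change Q (Q y + t (t w)) + t (Q y + t (t w) - Q (Q y + t (t w))) = y
      rw [map_add, hQZ _ (hQm y), hQY _ hY', add_zero, add_sub_cancel_left, ← hw, hu,
        add_sub_cancel]

end SecondOrderPole

/-! ### Laurent coefficients of the pencil and decay off the pole. -/

section Pencil

/-- Replacing u by the identity on the range of a commuting idempotent keeps invertibility; the
inverse is q + u⁻¹(1 - q). -/
theorem isUnit_add_mul_one_sub {R : Type*} [Ring R] {u q : R} (hu : IsUnit u) (hq : q * q = q)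
    (hc : u * q = q * u) : IsUnit (q + u * (1 - q)) := by
  obtain ⟨u, rfl⟩ := hu
  have hc' : (↑u⁻¹ : R) * q = q * ↑u⁻¹ := (Commute.units_inv_left (show Commute ↑u q from hc)).eq
  have a1 : q * (1 - q) = 0 := by rw [mul_sub, mul_one, hq, sub_self]
  have a2 : (1 - q) * (1 - q) = 1 - q := by rw [sub_mul, one_mul, a1, sub_zero]
  have a3 : (1 - q) * q = 0 := by rw [sub_mul, one_mul, hq, sub_self]
  have key : ∀ v w : R, v * w = 1 → w * q = q * w →
      (q + v * (1 - q)) * (q + w * (1 - q)) = 1 := by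
    intro v w hvw hw
    have hw' : w * (1 - q) = (1 - q) * w := by rw [mul_sub, sub_mul, hw, mul_one, one_mul]
    calc (q + v * (1 - q)) * (q + w * (1 - q))
        = q * q + v * ((1 - q) * q) + (q * (w * (1 - q)) + v * ((1 - q) * (w * (1 - q)))) := by
          noncomm_ring
      _ = q + v * 0 + (q * ((1 - q) * w) + v * (((1 - q) * (1 - q)) * w)) := by
          rw [hq, a3, hw', mul_assoc (1 - q) (1 - q) w]
      _ = q + (v * w) * (1 - q) := by
          rw [a2, ← mul_assoc q, a1, ← hw', mul_assoc]; simp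
      _ = 1 := by rw [hvw, one_mul, add_sub_cancel]
  exact ⟨⟨_, q + ↑u⁻¹ * (1 - q), key _ _ u.mul_inv hc', key _ _ u.inv_mul hc⟩, rfl⟩

variable {E : Type*} [NormedAddCommGroup E] [NormedSpace ℂ E] {a Q : E →L[ℂ] E}

theorem IsNilProj.comm' {t Q : E →L[ℂ] E} (h : IsNilProj t Q) : (1 - t) * Q = Q * (1 - t) := by
  rw [sub_mul, mul_sub, h.comm, one_mul, mul_one]

theorem IsNilProj.comm_apply {t Q : E →L[ℂ] E} (h : IsNilProj t Q) (x : E) :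
    t (Q x) = Q (t x) := congrArg (fun f : E →L[ℂ] E => f x) h.comm

theorem IsNilProj.idem_apply {t Q : E →L[ℂ] E} (h : IsNilProj t Q) (x : E) :
    Q (Q x) = Q x := congrArg (fun f : E →L[ℂ] E => f x) h.idem

theorem IsNilProj.sq_apply {t Q : E →L[ℂ] E} (h : IsNilProj t Q) (x : E) :
    t (t (Q x)) = 0 := congrArg (fun f : E →L[ℂ] E => f x) h.sq

/-- On the disc, the pencil of the part of `a` complementary to `Q` is invertible. -/
theorem IsNilProj.isUnit_pencil (h : IsNilProj (1 - a) Q) {s : Set ℂ}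
    (hunit : pencilSpectrum a ∩ s = {1}) {z : ℂ} (hz : z ∈ s) :
    IsUnit (1 - z • (a * (1 - Q))) := by
  have hc := h.comm'
  rw [sub_sub_cancel] at hc
  by_cases h1 : z = 1
  · subst h1
    convert h.isUnit using 1
    rw [one_smul]
    noncomm_ring
  · have hu : IsUnit (1 - z • a) := by
      by_contra hn
      exact h1 (by simpa using hunit.subset ⟨hn, hz⟩)
    convert isUnit_add_mul_one_sub hu h.idem ?_ using 1
    · rw [sub_mul, one_mul, smul_mul_assoc]
      abel
    · rw [sub_mul, mul_sub, smul_mul_assoc, mul_smul_comm, hc, one_mul, mul_one]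

/-- The Laurent expansion of the inverse of the pencil at a pole of order at most two. -/
theorem IsNilProj.inverse_pencil (h : IsNilProj (1 - a) Q) {z : ℂ} (h1 : z ≠ 1)
    (hu : IsUnit (1 - z • a)) (hu' : IsUnit (1 - z • (a * (1 - Q)))) :
    Ring.inverse (1 - z • a) = (z - 1) ^ (-1 : ℤ) • (-((2 - a) * Q)) +
      (z - 1) ^ (-2 : ℤ) • (-((1 - a) * Q)) + Ring.inverse (1 - z • (a * (1 - Q))) * (1 - Q) := by
  have hc := h.comm'
  rw [sub_sub_cancel] at hc
  obtain ⟨v, hv⟩ := hu'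
  have hsq := h.sq
  have hne : z - 1 ≠ 0 := sub_ne_zero.mpr h1
  refine (hu.mul_right_inj).mp ?_
  rw [Ring.mul_inverse_cancel _ hu, mul_add, ← hv, Ring.inverse_unit]
  have hQ1 : (1 - z • a) * ((↑v⁻¹ : E →L[ℂ] E) * (1 - Q)) = 1 - Q := by
    have e1 : (1 - Q) * (v : E →L[ℂ] E) = v * (1 - Q) := by
      have : Q * (v : E →L[ℂ] E) = v * Q := by
        rw [hv, mul_sub, sub_mul, mul_smul_comm, smul_mul_assoc, ← mul_assoc, mul_assoc a, mul_one,
          one_mul, ← hc, mul_assoc, mul_sub, sub_mul, mul_one, one_mul]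
      rw [mul_sub, sub_mul, this, mul_one, one_mul]
    have e2 : (↑v⁻¹ : E →L[ℂ] E) * (1 - Q) = (1 - Q) * ↑v⁻¹ := by
      rw [Units.inv_mul_eq_iff_eq_mul, ← mul_assoc, ← e1, mul_assoc, Units.mul_inv, mul_one]
    have e3 : (1 - z • a) * (1 - Q) = v * (1 - Q) := by
      rw [hv, sub_mul, sub_mul, smul_mul_assoc, smul_mul_assoc, mul_assoc a]
      congr 3
      rw [mul_sub, mul_one, sub_mul, one_mul, h.idem, sub_self, sub_zero]
    rw [e2, ← mul_assoc, e3, mul_assoc, ← e2, Units.mul_inv_cancel_left]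
  have hQ2 : (1 - z • a) * ((z - 1) ^ (-1 : ℤ) • (-((2 - a) * Q)) +
      (z - 1) ^ (-2 : ℤ) • (-((1 - a) * Q))) = Q := by
    set t := 1 - a with ht
    -- The pencil is z t - (z - 1). Since t²Q = 0, its inverse on ran Q is a Neumann series with
    -- only two terms.
    have e1 : 1 - z • a = z • t - (z - 1) • 1 := by
      rw [ht, smul_sub, sub_smul, one_smul]; abel
    have e2 : (2 : E →L[ℂ] E) - a = 1 + t := by
      rw [ht, ← one_add_one_eq_two]; abel
    have e3 : t * ((1 + t) * Q) = t * Q := by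
      rw [add_mul, one_mul, mul_add, ← mul_assoc, hsq, add_zero]
    have e4 : t * (t * Q) = 0 := by rw [← mul_assoc, hsq]
    rw [e1, e2, sub_mul, mul_add]
    simp only [smul_mul_assoc, mul_smul_comm, mul_neg, e3, e4, one_mul, neg_zero, smul_zero,
      add_zero, smul_add, smul_neg, smul_smul, zpow_neg, zpow_one]
    rw [mul_inv_cancel₀ hne, one_smul, add_mul, one_mul]
    have e5 : (z - 1) * ((z - 1) ^ (2 : ℤ))⁻¹ = (z - 1)⁻¹ := by
      rw [zpow_two, mul_inv, mul_inv_cancel_left₀ hne]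
    have e6 : (z - 1)⁻¹ * z = 1 + (z - 1)⁻¹ := by field_simp; ring
    rw [e5, e6, add_smul, one_smul]
    abel
  rw [hQ1, hQ2]
  abel

/-- On ker Q the powers of a may be replaced by those of a(1 - Q), whose spectral radius is below
one. -/
theorem IsNilProj.pow_mul_compl (h : IsNilProj (1 - a) Q) (n : ℕ) :
    a ^ n * (1 - Q) = (a * (1 - Q)) ^ n * (1 - Q) := by
  have hc := h.comm'
  rw [sub_sub_cancel] at hc
  have a2 : (1 - Q) * (1 - Q) = 1 - Q := by
    rw [mul_sub, mul_one, sub_mul, one_mul, h.idem, sub_self, sub_zero]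
  have hc' : (1 - Q) * a = a * (1 - Q) := by rw [mul_sub, sub_mul, hc, mul_one, one_mul]
  induction n with
  | zero => simp
  | succ n ih =>
    calc a ^ (n + 1) * (1 - Q) = a * (a ^ n * (1 - Q)) := by rw [pow_succ', mul_assoc]
      _ = a * (a ^ n * (1 - Q)) * (1 - Q) := by rw [mul_assoc, mul_assoc, a2]
      _ = (a * (1 - Q)) ^ (n + 1) * (1 - Q) := by
        have : Commute (1 - Q) (a ^ n) := (show Commute (1 - Q) a from hc').pow_right n
        rw [← this.eq, ← mul_assoc a, mul_assoc, ih, ← mul_assoc, ← pow_succ']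

variable [CompleteSpace E]

theorem circleIntegral_zpow_smul {F : Type*} [NormedAddCommGroup F] [NormedSpace ℂ F]
    [CompleteSpace F] {c : ℂ} {r : ℝ} (hr : r ≠ 0) (n : ℤ) (x : F) :
    (∮ z in C(c, r), (z - c) ^ n • x) =
      if n = -1 then (2 * (Real.pi : ℂ) * Complex.I) • x else 0 := by
  rw [circleIntegral.integral_smul_const]
  split_ifs with h
  · subst h
    simp_rw [zpow_neg_one]
    rw [circleIntegral.integral_sub_center_inv c hr]
  · rw [circleIntegral.integral_sub_zpow_of_ne h, zero_smul]

/-- Laurent coefficients of a function with a pole of order at most two. -/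
theorem circleIntegral_of_double_pole {F : Type*} [NormedAddCommGroup F] [NormedSpace ℂ F]
    [CompleteSpace F] {r : ℝ} (hr : 0 < r) {f g : ℂ → F} {x y : F}
    (hf : ∀ z ∈ Metric.sphere (1 : ℂ) r,
      f z = (z - 1) ^ (-1 : ℤ) • x + (z - 1) ^ (-2 : ℤ) • y + g z)
    (hg : DifferentiableOn ℂ g (Metric.closedBall 1 r)) :
    (∮ z in C(1, r), (z - 1) ^ (0 : ℤ) • f z) = (2 * (Real.pi : ℂ) * Complex.I) • x ∧
    (∮ z in C(1, r), (z - 1) ^ (1 : ℤ) • f z) = (2 * (Real.pi : ℂ) * Complex.I) • y := by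
  have hne : ∀ z ∈ Metric.sphere (1 : ℂ) r, z - 1 ≠ 0 := by
    intro z hz h0
    rw [mem_sphere_iff_norm, h0, norm_zero] at hz
    exact hr.ne hz
  have hzi : ∀ (n : ℤ) (w : F), CircleIntegrable (fun z => (z - 1) ^ n • w) 1 r := by
    intro n w
    apply ContinuousOn.circleIntegrable hr.le
    apply ContinuousOn.smul _ continuousOn_const
    exact (continuousOn_id.sub continuousOn_const).zpow₀ n fun z hz => Or.inl (hne z hz)
  have key : ∀ n : ℕ, (∮ z in C(1, r), (z - 1) ^ (n : ℤ) • f z) =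
      (∮ z in C(1, r), (z - 1) ^ ((n : ℤ) - 1) • x) +
        ∮ z in C(1, r), (z - 1) ^ ((n : ℤ) - 2) • y := by
    intro n
    have hd : DifferentiableOn ℂ (fun z => (z - 1) ^ n • g z) (Metric.closedBall 1 r) :=
      DifferentiableOn.smul (by fun_prop) hg
    have h0 : (∮ z in C(1, r), (z - 1) ^ n • g z) = 0 := by
      apply DiffContOnCl.circleIntegral_eq_zero hr.le
      refine ⟨hd.mono Metric.ball_subset_closedBall, ?_⟩
      rw [closure_ball _ hr.ne']
      exact hd.continuousOn
    have hgi : CircleIntegrable (fun z => (z - 1) ^ n • g z) 1 r :=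
      (hd.continuousOn.mono Metric.sphere_subset_closedBall).circleIntegrable hr.le
    have e := circleIntegral.integral_add
      ((hzi ((n : ℤ) - 1) x).add (hzi ((n : ℤ) - 2) y)) hgi
    simp only [Pi.add_apply] at e
    rw [h0, add_zero, circleIntegral.integral_add (hzi _ _) (hzi _ _)] at e
    rw [← e]
    refine circleIntegral.integral_congr hr.le fun z hz => ?_
    have := hne z hz
    rw [hf z hz, smul_add, smul_add, smul_smul, smul_smul, ← zpow_add₀ this, ← zpow_add₀ this,
      zpow_natCast]
    rfl
  have k0 := key 0
  have k1 := key 1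
  rw [circleIntegral_zpow_smul hr.ne', circleIntegral_zpow_smul hr.ne'] at k0 k1
  norm_num at k0 k1 ⊢
  exact ⟨k0, k1⟩

/-- The complementary part of the inverse is holomorphic on the whole closed disc, the point 1
included, so by Cauchy only the two principal terms of `inverse_pencil` contribute. Their minus
signs cancel the one in `laurentN`. -/
theorem IsNilProj.laurentN_eq (h : IsNilProj (1 - a) Q) {η r : ℝ}
    (hunit : pencilSpectrum a ∩ Metric.ball 0 (1 + η) = {1}) (hr0 : 0 < r) (hrη : r < η) :
    laurentN a r (-1) = (2 - a) * Q ∧ laurentN a r (-2) = (1 - a) * Q := by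
  have hsub : Metric.closedBall (1 : ℂ) r ⊆ Metric.ball 0 (1 + η) := by
    intro z hz
    rw [mem_closedBall_iff_norm] at hz
    rw [mem_ball_zero_iff]
    calc ‖z‖ = ‖(z - 1) + 1‖ := by rw [sub_add_cancel]
      _ ≤ ‖z - 1‖ + ‖(1 : ℂ)‖ := norm_add_le _ _
      _ < 1 + η := by rw [norm_one]; linarith
  have hd : DifferentiableOn ℂ
      (fun z : ℂ => Ring.inverse (1 - z • (a * (1 - Q))) * (1 - Q)) (Metric.closedBall 1 r) := by
    apply DifferentiableOn.mul_const
    apply DifferentiableOn.inverse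
    · exact ((differentiable_id.smul_const _).const_sub 1).differentiableOn
    · exact fun z hz => h.isUnit_pencil hunit (hsub hz)
  have hI : 2 * (Real.pi : ℂ) * Complex.I ≠ 0 := Complex.two_pi_I_ne_zero
  obtain ⟨k0, k1⟩ := circleIntegral_of_double_pole hr0 (f := fun z => Ring.inverse (1 - z • a))
    (x := -((2 - a) * Q)) (y := -((1 - a) * Q)) (fun z hz => by
      have hz1 : z ≠ 1 := by
        rintro rfl
        rw [mem_sphere_iff_norm, sub_self, norm_zero] at hz
        exact hr0.ne hz
      have hzb := hsub (Metric.sphere_subset_closedBall hz)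
      refine h.inverse_pencil hz1 ?_ (h.isUnit_pencil hunit hzb)
      by_contra hn
      exact hz1 (by simpa using hunit.subset ⟨hn, hzb⟩)) hd
  constructor
  · rw [laurentN]
    norm_num only
    rw [k0, inv_smul_smul₀ hI, neg_neg]
  · rw [laurentN]
    norm_num only
    rw [k1, inv_smul_smul₀ hI, neg_neg]

/-- With t = 1 - a the product is (1 + t)(1 - t)Q = Q - t²Q = Q. -/
theorem IsNilProj.rieszP_eq (h : IsNilProj (1 - a) Q) {η r : ℝ}
    (hunit : pencilSpectrum a ∩ Metric.ball 0 (1 + η) = {1}) (hr0 : 0 < r) (hrη : r < η) :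
    rieszP a r = Q := by
  rw [rieszP, (h.laurentN_eq hunit hr0 hrη).1]
  have hc := h.comm'
  have hsq := h.sq
  set t := 1 - a with ht
  have ha : a = 1 - t := by rw [ht]; abel
  have h2 : (2 : E →L[ℂ] E) = 1 + 1 := one_add_one_eq_two.symm
  rw [mul_assoc, ha, ← hc, h2]
  calc (1 + 1 - (1 - t)) * ((1 - t) * Q) = Q - t * t * Q := by noncomm_ring
    _ = Q := by rw [hsq, sub_zero]

/-- Geometric decay of `a ^ n` on `ker Q`. -/
theorem IsNilProj.exists_decay (h : IsNilProj (1 - a) Q) {η : ℝ} (hη : 0 < η)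
    (hunit : pencilSpectrum a ∩ Metric.ball 0 (1 + η) = {1}) :
    ∃ c ρ : ℝ, 0 ≤ c ∧ 0 ≤ ρ ∧ ρ < 1 ∧ ∀ n : ℕ, ‖a ^ n * (1 - Q)‖ ≤ c * ρ ^ n := by
  set b := a * (1 - Q) with hb
  -- If |z| > 1/(1 + η), then z⁻¹ lies in the disc on which the pencil of b is invertible, and z - b
  -- is z times that pencil at z⁻¹.
  have hspec : ∀ z ∈ spectrum ℂ b, ‖z‖ ≤ (1 + η)⁻¹ := by
    intro z hz
    by_contra! hlt
    have hpos : 0 < (1 + η)⁻¹ := by positivity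
    have hz0 : z ≠ 0 := by
      rintro rfl
      rw [norm_zero] at hlt
      linarith
    have hmem : z⁻¹ ∈ Metric.ball (0 : ℂ) (1 + η) := by
      rw [mem_ball_zero_iff, norm_inv]
      exact inv_lt_of_inv_lt₀ (by positivity) hlt
    have hu := h.isUnit_pencil hunit hmem
    refine hz ?_
    have : algebraMap ℂ (E →L[ℂ] E) z - b = (Units.mk0 z hz0) • (1 - z⁻¹ • b) := by
      rw [Units.smul_def, Units.val_mk0, smul_sub, smul_inv_smul₀ hz0,
        Algebra.algebraMap_eq_smul_one]
    rw [spectrum.mem_resolventSet_iff, this]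
    exact hu.smul _
  have hrad : spectralRadius ℂ b ≤ ENNReal.ofReal (1 + η)⁻¹ := by
    refine iSup₂_le fun z hz => ?_
    rw [← enorm_eq_nnnorm, ← ofReal_norm]
    exact ENNReal.ofReal_le_ofReal (hspec z hz)
  -- Gelfand's formula bounds ‖bⁿ‖ by ρⁿ eventually for any ρ above the spectral radius.
  obtain ⟨ρ, hρ1, hρ2⟩ := exists_between
    (show (1 + η)⁻¹ < 1 from inv_lt_one_of_one_lt₀ (by linarith))
  have hρ0 : 0 < ρ := lt_trans (by positivity) hρ1
  have hlt : spectralRadius ℂ b < ENNReal.ofReal ρ :=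
    hrad.trans_lt ((ENNReal.ofReal_lt_ofReal_iff hρ0).mpr hρ1)
  have hev := (spectrum.pow_norm_pow_one_div_tendsto_nhds_spectralRadius b).eventually_lt_const hlt
  obtain ⟨m, hm⟩ := (hev.and (eventually_ge_atTop 1)).exists_forall_of_atTop
  have hbound : ∀ n ≥ m, ‖b ^ n‖ ≤ ρ ^ n := by
    intro n hn
    obtain ⟨h1, h2⟩ := hm n hn
    rw [ENNReal.ofReal_lt_ofReal_iff hρ0] at h1
    have hn0 : (n : ℝ) ≠ 0 := by positivity
    have := Real.rpow_le_rpow (by positivity) h1.le (Nat.cast_nonneg n)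
    rwa [← Real.rpow_mul (norm_nonneg _), one_div_mul_cancel hn0, Real.rpow_one,
      Real.rpow_natCast] at this
  -- The sum absorbs the finitely many powers before Gelfand's bound takes effect; the summand 1
  -- covers the later ones.
  set c := 1 + ∑ k ∈ Finset.range m, ‖b ^ k‖ / ρ ^ k with hc
  have hc0 : 1 ≤ c := le_add_of_nonneg_right (Finset.sum_nonneg fun k _ => by positivity)
  refine ⟨c * ‖1 - Q‖, ρ, by positivity, hρ0.le, hρ2, fun n => ?_⟩
  have hbn : ‖b ^ n‖ ≤ c * ρ ^ n := by
    rcases le_or_gt m n with hn | hn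
    · exact (hbound n hn).trans (le_mul_of_one_le_left (by positivity) hc0)
    · have : ‖b ^ n‖ / ρ ^ n ≤ c := by
        have := Finset.single_le_sum (f := fun k => ‖b ^ k‖ / ρ ^ k) (fun k _ => by positivity)
          (Finset.mem_range.mpr hn)
        rw [hc]
        linarith
      rwa [div_le_iff₀ (by positivity)] at this
  calc ‖a ^ n * (1 - Q)‖ = ‖b ^ n * (1 - Q)‖ := by rw [h.pow_mul_compl]
    _ ≤ ‖b ^ n‖ * ‖1 - Q‖ := norm_mul_le _ _
    _ ≤ c * ρ ^ n * ‖1 - Q‖ := by gcongr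
    _ = c * ‖1 - Q‖ * ρ ^ n := by ring

end Pencil

/-! ### Closed forms of the Laurent coefficients. -/

section ClosedForms

variable {E : Type*} [NormedAddCommGroup E] [NormedSpace ℂ E] {t Q : E →L[ℂ] E}
  {rC kC : Submodule ℂ E}
  (hr : IsInternalDirectSum ⊤ (LinearMap.range t.toLinearMap) rC)
  (hk : IsInternalDirectSum ⊤ (LinearMap.ker t.toLinearMap) kC)

/-- Commuting t past Q gives Q(t T^g x) = Q x = x, because x ∈ ker t. Thus t Q undoes T^g on 𝒦. -/
theorem IsNilProj.mul_genInverse (h : IsNilProj t Q) {x : E} (hx : x ∈ kSpace t.toLinearMap) :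
    (t * Q) (genInverse t.toLinearMap hr hk x) = x := by
  change t (Q _) = x
  rw [h.comm_apply]
  have : t (genInverse t.toLinearMap hr hk x) = x := apply_genInverse_of_mem hr hk hx.1
  rw [this]
  refine h.apply_of_sq_eq_zero ?_
  rw [show t x = 0 from hx.2, map_zero]

theorem IsNilProj.mul_mem_kSpace (h : IsNilProj t Q) (x : E) :
    (t * Q) x ∈ kSpace t.toLinearMap :=
  ⟨⟨Q x, rfl⟩, h.sq_apply x⟩

theorem IsNilProj.mul_eq_zero (h : IsNilProj t Q) {x : E}
    (hx : x ∈ LinearMap.range t.toLinearMap ⊔ LinearMap.ker t.toLinearMap) : (t * Q) x = 0 := by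
  obtain ⟨_, ⟨w, rfl⟩, hu⟩ := mem_range_sup_ker_iff.mp hx
  replace hu : t (t w) = t x := hu
  change t (Q x) = 0
  rw [h.comm_apply, ← hu, ← h.comm_apply, ← h.comm_apply, h.sq_apply]

/-- By the two preceding facts, T^g t Q is the projection onto T^g 𝒦 along ran t + ker t. -/
theorem IsNilProj.sub_genInverse_mem (h : IsNilProj t Q) (hI : I2Condition t.toLinearMap hr hk)
    (x : E) : x - genInverse t.toLinearMap hr hk ((t * Q) x) ∈
      LinearMap.range t.toLinearMap ⊔ LinearMap.ker t.toLinearMap := by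
  have hx : x ∈ (⊤ : Submodule ℂ E) := trivial
  rw [← hI.2.sup_eq, Submodule.mem_sup] at hx
  obtain ⟨v, hv, _, ⟨y, hy, rfl⟩, rfl⟩ := hx
  rw [map_add, h.mul_eq_zero hv, zero_add, h.mul_genInverse hr hk hy, add_sub_cancel_right]
  exact hv

theorem range_sup_ker_le_sup_wSpace :
    LinearMap.range t.toLinearMap ⊔ LinearMap.ker t.toLinearMap ≤
      LinearMap.range t.toLinearMap ⊔ wSpace t.toLinearMap hr := by
  refine sup_le le_sup_left fun x hx => ?_
  rw [Submodule.mem_sup]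
  exact ⟨_, rangeProj_mem hr x, x - rangeProj _ hr x, ⟨x, hx, rfl⟩, add_sub_cancel _ _⟩

theorem wSpace_le_range_sup_ker : wSpace t.toLinearMap hr ≤
    LinearMap.range t.toLinearMap ⊔ LinearMap.ker t.toLinearMap := by
  rintro _ ⟨x, hx, rfl⟩
  exact Submodule.sub_mem _ (Submodule.mem_sup_right hx)
    (Submodule.mem_sup_left (rangeProj_mem hr x))

/-- Both complements are explicit. On ker t the map Q P_ran is a retraction onto 𝒦, and its kernel
serves as 𝒦_C. On `rC` the map (1 - P_ran) T^g t Q is idempotent with kernel 𝒲, and its fixed points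
serve as 𝒲_C. -/
theorem IsNilProj.exists_complements [CompleteSpace E] (h : IsNilProj t Q)
    (hI : I2Condition t.toLinearMap hr hk) :
    ∃ KC WC : Submodule ℂ E,
      IsInternalDirectSum (LinearMap.ker t.toLinearMap) (kSpace t.toLinearMap) KC ∧
      IsInternalDirectSum rC (wSpace t.toLinearMap hr) WC := by
  have hPc := continuous_rangeProj hr
  have hGc := continuous_genInverse hr hk t.continuous
  set R := rangeProj t.toLinearMap hr with hR
  set G := genInverse t.toLinearMap hr hk with hG
  have hRr : ∀ x, R x ∈ LinearMap.range t.toLinearMap := rangeProj_mem hr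
  have hQR : ∀ x, Q (R x) ∈ kSpace t.toLinearMap := by
    intro x
    obtain ⟨w, hw⟩ := hRr x
    rw [← hw]
    change Q (t w) ∈ _
    rw [← h.comm_apply]
    exact h.mul_mem_kSpace w
  refine ⟨LinearMap.ker t.toLinearMap ⊓ LinearMap.ker (Q.toLinearMap ∘ₗ R),
    LinearMap.ker (LinearMap.id - (LinearMap.id - R) ∘ₗ G ∘ₗ (t * Q).toLinearMap), ?_, ?_⟩
  · refine ⟨hr.isClosed_left.inter hk.isClosed_left,
      hk.isClosed_left.inter (isClosed_eq (Q.continuous.comp hPc) continuous_const), ?_, ?_⟩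
    · rw [Submodule.disjoint_def]
      rintro x hx ⟨-, hx'⟩
      replace hx' : Q (R x) = 0 := hx'
      rw [hR, rangeProj_of_mem hr hx.1, h.apply_of_sq_eq_zero] at hx'
      · exact hx'
      · rw [show t x = 0 from hx.2, map_zero]
    · refine le_antisymm (sup_le inf_le_right inf_le_left) fun x hx => ?_
      rw [Submodule.mem_sup]
      refine ⟨_, hQR x, x - Q (R x), ⟨Submodule.sub_mem _ hx (hQR x).2, ?_⟩, add_sub_cancel _ _⟩
      change Q (R (x - Q (R x))) = 0
      rw [map_sub, hR, rangeProj_of_mem hr (hQR x).1, ← hR, map_sub, h.idem_apply, sub_self]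
  · have hW : ∀ x, x ∈ wSpace t.toLinearMap hr ↔ x ∈ rC ∧ (t * Q) x = 0 := by
      intro x
      constructor
      · intro hx
        refine ⟨?_, h.mul_eq_zero (wSpace_le_range_sup_ker hr hx)⟩
        obtain ⟨c, -, rfl⟩ := hx
        exact sub_rangeProj_mem hr c
      · rintro ⟨hx1, hx2⟩
        have hx := h.sub_genInverse_mem hr hk hI x
        rw [hx2, map_zero, sub_zero, Submodule.mem_sup] at hx
        obtain ⟨u, hu, c, hc, rfl⟩ := hx
        refine ⟨c, hc, ?_⟩
        have e := (rangeProj_eq_zero_iff hr).mpr hx1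
        rw [map_add, rangeProj_of_mem hr hu] at e
        change c - R c = u + c
        rw [eq_neg_of_add_eq_zero_right e, sub_neg_eq_add, add_comm]
    have hψ : ∀ x, (t * Q) (G ((t * Q) x) - R (G ((t * Q) x))) = (t * Q) x := by
      intro x
      rw [map_sub, h.mul_genInverse hr hk (h.mul_mem_kSpace x),
        h.mul_eq_zero (Submodule.mem_sup_left (hRr _)), sub_zero]
    have memWC : ∀ x, x ∈ LinearMap.ker
        (LinearMap.id - (LinearMap.id - R) ∘ₗ G ∘ₗ (t * Q).toLinearMap) ↔
        x = G ((t * Q) x) - R (G ((t * Q) x)) := fun x => sub_eq_zero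
    refine ⟨?_, ?_, ?_, ?_⟩
    · have : (wSpace t.toLinearMap hr : Set E) = (rC : Set E) ∩ {x | (t * Q) x = 0} := by
        ext x
        exact hW x
      rw [this]
      exact hr.isClosed_right.inter (isClosed_eq (t * Q).continuous continuous_const)
    · have : Continuous fun x => G ((t * Q) x) := hGc.comp (t * Q).continuous
      convert isClosed_eq continuous_id (this.sub (hPc.comp this)) using 1
      ext x
      exact memWC x
    · rw [Submodule.disjoint_def]
      intro x hx hx'
      rw [(memWC x).mp hx', ((hW x).mp hx).2]
      simp
    · apply le_antisymm
      · refine sup_le (fun x hx => ((hW x).mp hx).1) fun x hx => ?_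
        rw [(memWC x).mp hx]
        exact sub_rangeProj_mem hr _
      · intro x hx
        rw [Submodule.mem_sup]
        refine ⟨x - (G ((t * Q) x) - R (G ((t * Q) x))), ?_, _, ?_, sub_add_cancel _ _⟩
        · rw [hW]
          refine ⟨rC.sub_mem hx (sub_rangeProj_mem hr _), ?_⟩
          rw [map_sub, hψ, sub_self]
        · rw [memWC, hψ]

/-- The closed forms of the Laurent coefficients at a second order pole. -/
theorem IsNilProj.closed_forms (h : IsNilProj t Q) (hI : I2Condition t.toLinearMap hr hk)
    (KC WC : Submodule ℂ E)
    (hK : IsInternalDirectSum (LinearMap.ker t.toLinearMap) (kSpace t.toLinearMap) KC)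
    (hW : IsInternalDirectSum rC (wSpace t.toLinearMap hr) WC) :
    ∃ (e : kSpace t.toLinearMap ≃ₗ[ℂ] WC) (q : KC ≃ₗ[ℂ] wSpace t.toLinearMap hr),
      (∀ x : kSpace t.toLinearMap, e x =
        WC.projectionOnto _ (hr.isCompl_sup_left hW.symm) (genInverse t.toLinearMap hr hk x)) ∧
      (∀ x : KC, (q x : E) = x - rangeProj t.toLinearMap hr x) ∧
      (∀ x, (t * Q) x = e.symm (WC.projectionOnto _ (hr.isCompl_sup_left hW.symm) x)) ∧
      (∀ ΓL ΓR Qg : E →ₗ[ℂ] E,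
        ΓL = genInverse t.toLinearMap hr hk ∘ₗ (t * Q).toLinearMap →
        ΓR = (t * Q).toLinearMap ∘ₗ genInverse t.toLinearMap hr hk →
        Qg = KC.subtype ∘ₗ q.symm.toLinearMap ∘ₗ
          (wSpace t.toLinearMap hr).projectionOnto _ (hr.isCompl_sup_left hW) →
        Q.toLinearMap = ΓR + (LinearMap.id - ΓR) ∘ₗ
          (ΓL + Qg ∘ₗ (LinearMap.id - rangeProj t.toLinearMap hr) ∘ₗ (LinearMap.id - ΓL))) := by
  set R := rangeProj t.toLinearMap hr with hR
  set G := genInverse t.toLinearMap hr hk with hG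
  set pW := WC.projectionOnto _ (hr.isCompl_sup_left hW.symm) with hpW
  have hpW1 : ∀ x, pW x = 0 ↔ x ∈ LinearMap.range t.toLinearMap ⊔ wSpace t.toLinearMap hr :=
    fun x => Submodule.projectionOnto_apply_eq_zero_iff _
  have hpW2 : ∀ y : WC, pW y = y := fun y => Submodule.projectionOnto_apply_left _ y
  clear_value pW
  have hpW0 : ∀ x ∈ LinearMap.range t.toLinearMap ⊔ LinearMap.ker t.toLinearMap, pW x = 0 :=
    fun x hx => (hpW1 x).mpr (range_sup_ker_le_sup_wSpace hr hx)
  -- Modulo ran t + ker t, which P_{𝒲_C} kills, x agrees with T^g t Q x. This identity gives both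
  -- surjectivity of `e` and the formula for N₋₂.
  have hpN : ∀ x, pW (G ((t * Q) x)) = pW x := fun x => by
    have := hpW0 _ (h.sub_genInverse_mem hr hk hI x)
    rw [map_sub, sub_eq_zero] at this
    exact this.symm
  have he : Function.Bijective (pW ∘ₗ G ∘ₗ (kSpace t.toLinearMap).subtype) := by
    constructor
    · rw [injective_iff_map_eq_zero]
      intro x hx
      have h1 := (hpW1 (G x)).mp hx
      have h2 := h.mul_eq_zero (sup_le le_sup_left (wSpace_le_range_sup_ker hr) h1)
      have h3 : (t * Q) (G x) = x := h.mul_genInverse hr hk x.2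
      exact Subtype.ext (h3.symm.trans h2)
    · intro y
      refine ⟨⟨(t * Q) y, h.mul_mem_kSpace _⟩, ?_⟩
      change pW (G ((t * Q) y)) = y
      rw [hpN, hpW2]
  have hKC : ∀ x ∈ KC, t x = 0 := fun x hx =>
    (hK.sup_eq ▸ (le_sup_right : KC ≤ _)) hx
  have hq : Function.Bijective (((LinearMap.id - R) ∘ₗ KC.subtype).codRestrict
      (wSpace t.toLinearMap hr) fun x => ⟨x, hKC x x.2, rfl⟩) := by
    constructor
    · rw [injective_iff_map_eq_zero]
      intro x hx
      have hx' : (x : E) - R x = 0 := congrArg Subtype.val hx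
      refine Subtype.ext (Submodule.disjoint_def.mp hK.disjoint _ ⟨?_, hKC x x.2⟩ x.2)
      rw [sub_eq_zero.mp hx']
      exact rangeProj_mem hr _
    · rintro ⟨_, c, hc, rfl⟩
      rw [SetLike.mem_coe, ← hK.sup_eq, Submodule.mem_sup] at hc
      obtain ⟨k, hk', c, hcK, rfl⟩ := hc
      refine ⟨⟨c, hcK⟩, Subtype.ext ?_⟩
      change c - R c = (k + c) - R (k + c)
      rw [map_add, hR, rangeProj_of_mem hr hk'.1]
      abel
  obtain ⟨e, he⟩ : ∃ e : kSpace t.toLinearMap ≃ₗ[ℂ] WC,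
      ∀ x : kSpace t.toLinearMap, e x = pW (G x) :=
    ⟨LinearEquiv.ofBijective _ he, fun _ => rfl⟩
  obtain ⟨q, hq⟩ : ∃ q : KC ≃ₗ[ℂ] wSpace t.toLinearMap hr, ∀ x : KC, (q x : E) = x - R x :=
    ⟨LinearEquiv.ofBijective _ hq, fun _ => rfl⟩
  refine ⟨e, q, he, hq, fun x => ?_, ?_⟩
  · have : (⟨(t * Q) x, h.mul_mem_kSpace x⟩ : kSpace t.toLinearMap) = e.symm (pW x) := by
      rw [LinearEquiv.eq_symm_apply, he]
      exact hpN x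
    exact congrArg Subtype.val this
  · rintro ΓL ΓR Qg rfl rfl rfl
    set pV := (wSpace t.toLinearMap hr).projectionOnto _ (hr.isCompl_sup_left hW) with hpV
    have hQR : ∀ x, (t * Q) (G x) = Q (R x) := by
      intro x
      change t (Q (G x)) = _
      rw [h.comm_apply]
      exact congrArg Q (apply_genInverse hr hk x)
    ext x
    -- Decompose x = (y + k) + (g + c) with y + k ∈ ran t, g = T^g t Q x and c ∈ 𝒦_C. Then Q fixes g
    -- + c, P_ran fixes y + k, and Q^g recovers c from x - g. Since Γ^R = Q P_ran, the formula reads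
    -- Q x = Q P_ran x + (1 - Q P_ran)(g + c).
    obtain ⟨y, hy, c, hc, hyc⟩ := Submodule.mem_sup.mp (h.sub_genInverse_mem hr hk hI x)
    rw [← hK.sup_eq, Submodule.mem_sup] at hc
    obtain ⟨k, hk', c, hc, rfl⟩ := hc
    have hRyk : R (y + k) = y + k := rangeProj_of_mem hr (Submodule.add_mem _ hy hk'.1)
    set g := G ((t * Q) x) with hg
    have hqc : q.symm (pV ((x - g) - R (x - g))) = ⟨c, hc⟩ := by
      rw [LinearEquiv.symm_apply_eq, ← hyc, ← add_assoc, map_add, hRyk, add_sub_add_left_eq_sub,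
        ← hq ⟨c, hc⟩]
      exact Submodule.projectionOnto_apply_left _ (q ⟨c, hc⟩)
    have hx : x = (y + k) + (g + c) := by
      rw [eq_add_of_sub_eq hyc.symm]
      abel
    simp only [LinearMap.add_apply, LinearMap.comp_apply, LinearMap.sub_apply, LinearMap.id_apply,
      ContinuousLinearMap.coe_coe, LinearEquiv.coe_coe, Submodule.subtype_apply]
    rw [← hg, hqc, hQR, hQR]
    have e1 : R x - R (g + c) = y + k := by
      rw [← map_sub, sub_eq_of_eq_add hx, hRyk]
    have e2 : Q (g + c) = g + c := by
      apply h.apply_of_sq_eq_zero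
      rw [map_add, hKC c hc, add_zero, show t g = (t * Q) x from
        apply_genInverse_of_mem hr hk (h.mul_mem_kSpace x).1]
      exact (h.mul_mem_kSpace x).2
    have e3 : Q x = Q (R x) - Q (R (g + c)) + (g + c) := by
      rw [← map_sub, e1, ← e2, ← map_add, ← hx]
    rw [e3]
    abel

end ClosedForms

/-! ### Convergence of aⁿ(1 - a) forces the I(2) condition. -/

section Converse

variable {E : Type*} [NormedAddCommGroup E] [NormedSpace ℂ E] [CompleteSpace E] {a M : E →L[ℂ] E}
  {rC kC : Submodule ℂ E}
  (hr : IsInternalDirectSum ⊤ (LinearMap.range (1 - a).toLinearMap) rC)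
  (hk : IsInternalDirectSum ⊤ (LinearMap.ker (1 - a).toLinearMap) kC)

/-- If `aⁿ (1 - a)` converges in norm to a nonzero limit, then the I(2) condition holds. -/
theorem I2Condition_of_tendsto (hM : Tendsto (fun n => a ^ n * (1 - a)) atTop (𝓝 M))
    (hM0 : M ≠ 0) : I2Condition (1 - a).toLinearMap hr hk := by
  set t := 1 - a with ht
  set G : E →L[ℂ] E := ⟨genInverse t.toLinearMap hr hk, continuous_genInverse hr hk t.continuous⟩
  set R : E →L[ℂ] E := ⟨rangeProj t.toLinearMap hr, continuous_rangeProj hr⟩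
  have hRr : ∀ u, R (t u) = t u := fun u => rangeProj_of_mem hr ⟨u, rfl⟩
  have hMx : ∀ x, Tendsto (fun n => (a ^ n) (t x)) atTop (𝓝 (M x)) := fun x =>
    ((ContinuousLinearMap.apply ℂ E x).continuous.tendsto M).comp hM
  have hat : ∀ n x, (a ^ n) (t x) = t ((a ^ n) x) := fun n x =>
    congrArg (fun f : E →L[ℂ] E => f x)
      (((Commute.one_right a).sub_right (Commute.refl a)).pow_left n).eq
  have htM0 : ∀ x, M (t x) = 0 := by
    intro x
    have h1 := (hMx x).sub ((hMx x).comp (tendsto_add_atTop_nat 1))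
    rw [sub_self] at h1
    refine tendsto_nhds_unique (hMx (t x)) (h1.congr fun n => ?_)
    simp only [Function.comp_apply]
    rw [pow_succ]
    change (a ^ n) (t x) - (a ^ n) (a (t x)) = (a ^ n) (t (t x))
    rw [← map_sub]
    rfl
  have htM : ∀ x, t (M x) = 0 := by
    intro x
    refine tendsto_nhds_unique ((t.continuous.tendsto _).comp (hMx x)) ?_
    have := hMx (t x)
    rw [htM0] at this
    exact this.congr fun n => hat n (t x)
  have hMr : ∀ x, M x ∈ LinearMap.range t.toLinearMap := fun x =>
    hr.isClosed_left.mem_of_tendsto (hMx x) (Eventually.of_forall fun n => ⟨_, (hat n x).symm⟩)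
  have hMker : ∀ x, t x = 0 → M x = 0 := by
    intro x hx
    refine tendsto_nhds_unique (hMx x) ?_
    simp only [hx, map_zero]
    exact tendsto_const_nhds
  -- Since t T^g = P_ran, convergence passes from aⁿ t to aⁿ P_ran. It holds in operator norm, as
  -- the Neumann series below requires.
  have hL : Tendsto (fun n => a ^ n * R) atTop (𝓝 (M * G)) := by
    refine (hM.mul_const G).congr fun n => ?_
    rw [mul_assoc]
    congr 1
    ext x
    exact apply_genInverse hr hk x
  have hGt : ∀ x, M (G (t x)) = M x := by
    intro x
    rw [← sub_eq_zero, ← map_sub]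
    apply hMker
    rw [map_sub]
    exact sub_eq_zero.mpr (apply_genInverse_of_mem hr hk ⟨x, rfl⟩)
  -- Both P_ran and a fix the elements of 𝒦, so the limit of aⁿ P_ran fixes them too.
  have hGK : ∀ x ∈ LinearMap.range t.toLinearMap, t x = 0 → M (G x) = x := by
    intro x hx hx0
    have h1 := ((ContinuousLinearMap.apply ℂ E x).continuous.tendsto _).comp hL
    refine tendsto_nhds_unique h1 (tendsto_const_nhds.congr fun n => ?_)
    change x = (a ^ n) (R x)
    have h2 : R x = x := rangeProj_of_mem hr hx
    have h3 : a x = x := (sub_eq_zero.mp hx0).symm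
    rw [h2]
    induction n with
    | zero => rfl
    | succ n ih =>
      rw [pow_succ]
      change x = (a ^ n) (a x)
      rw [h3]
      exact ih
  -- For large n the operator 1 - (aⁿP_ran - M T^g) is invertible, which solves y = v - aⁿv + M T^g
  -- v with v = t w in ran t. The geometric sum turns v - aⁿv into t²u, and M T^g v is in ker t.
  have hdec : ∀ y ∈ LinearMap.range t.toLinearMap, ∃ u, t (y - t (t u)) = 0 := by
    intro y hy
    obtain ⟨n, hn⟩ := ((Metric.tendsto_nhds.mp hL) 1 one_pos).exists
    rw [dist_eq_norm] at hn
    set v := Ring.inverse (1 - (a ^ n * R - M * G)) y with hv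
    have hu := isUnit_one_sub_of_norm_lt_one hn
    have e1 : v - ((a ^ n) (R v) - M (G v)) = y := by
      have := congrArg (fun f : E →L[ℂ] E => f y) (Ring.mul_inverse_cancel _ hu)
      exact this
    have hvr : v ∈ LinearMap.range t.toLinearMap := by
      have : v = y + (a ^ n) (R v) - M (G v) := by rw [← e1]; abel
      rw [this]
      refine Submodule.sub_mem _ (Submodule.add_mem _ hy ?_) (hMr _)
      obtain ⟨w, hw⟩ : R v ∈ LinearMap.range t.toLinearMap := rangeProj_mem hr v
      exact ⟨(a ^ n) w, by rw [← hw]; exact (hat n w).symm⟩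
    obtain ⟨w, hw⟩ := hvr
    replace hw : t w = v := hw
    rw [← hw, hRr] at e1
    refine ⟨(∑ i ∈ Finset.range n, a ^ i) w, ?_⟩
    have e2 : t (t ((∑ i ∈ Finset.range n, a ^ i) w)) = t w - (a ^ n) (t w) := by
      have : t * (∑ i ∈ Finset.range n, a ^ i) = 1 - a ^ n := mul_neg_geom_sum a n
      rw [show t ((∑ i ∈ Finset.range n, a ^ i) w) = w - (a ^ n) w from
        congrArg (fun f : E →L[ℂ] E => f w) this, map_sub, hat]
    rw [e2, ← e1, show t w - ((a ^ n) (t w) - M (G (t w))) - (t w - (a ^ n) (t w)) = M (G (t w))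
      by abel, htM]
  refine (I2Condition_iff hr hk t.continuous).mpr ⟨?_, ?_, ?_, ?_⟩
  · intro hbot
    refine hM0 (ContinuousLinearMap.ext fun x => ?_)
    have : M x ∈ kSpace t.toLinearMap := ⟨hMr x, htM x⟩
    rw [hbot] at this
    exact this
  · have : ((LinearMap.range t.toLinearMap ⊔ LinearMap.ker t.toLinearMap : Submodule ℂ E) : Set E) =
        {x | M x = 0} := by
      ext x
      rw [SetLike.mem_coe, mem_range_sup_ker_iff, Set.mem_ofPred_eq]
      constructor
      · rintro ⟨_, ⟨w, rfl⟩, hu⟩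
        rw [← hGt, ← show t (t w) = t x from hu, hGt]
        exact htM0 w
      · intro hx
        obtain ⟨u, hu⟩ := hdec (t x) ⟨x, rfl⟩
        refine ⟨t u, ⟨u, rfl⟩, (sub_eq_zero.mp ?_).symm⟩
        change t x - t (t u) = 0
        have hm : M (G (t x - t (t u))) = 0 := by
          rw [map_sub, map_sub, hGt, hGt, htM0, hx, sub_zero]
        rw [← hm, hGK _ ⟨x - t u, map_sub t _ _⟩ hu]
    rw [this]
    exact isClosed_eq M.continuous continuous_const
  · rintro _ ⟨w, rfl⟩ hw
    change t (t w) = 0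
    rw [← hGK (t (t w)) ⟨t w, rfl⟩ hw, hGt, htM0]
  · intro y hy
    obtain ⟨u, hu⟩ := hdec y hy
    exact ⟨t u, ⟨u, rfl⟩, hu⟩

end Converse

/-! ### Shift structure of the companion operator and the filter coefficients. -/

section CompanionAlgebra

variable {B : Type*} [NormedAddCommGroup B] [NormedSpace ℂ B] {p : ℕ}

/-- The embedding of `B` as the `j`-th factor of `B^p`. -/
def coordSingle (j : Fin p) : B →L[ℂ] ProdSpace B p :=
  (PiLp.continuousLinearEquiv 1 ℂ (fun _ : Fin p => B)).symm.toContinuousLinearMap ∘L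
    ContinuousLinearMap.single ℂ (fun _ : Fin p => B) j

theorem coordSingle_apply (j i : Fin p) (x : B) :
    coordSingle j x i = (Pi.single j x : Fin p → B) i := rfl

theorem sum_coordSingle (x : ProdSpace B p) : ∑ i, coordSingle i (x i) = x := by
  ext i
  simp only [WithLp.ofLp_sum, Finset.sum_apply, coordSingle_apply]
  exact (Finset.sum_pi_single i x.ofLp _).trans (if_pos (Finset.mem_univ i))

theorem eq_sum_coordSingle_comp {F : Type*} [NormedAddCommGroup F] [NormedSpace ℂ F]
    (X : ProdSpace B p →L[ℂ] F) :
    X = ∑ j, (X ∘L coordSingle j) ∘L PiLp.proj 1 (fun _ : Fin p => B) j := by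
  ext x
  conv_lhs => rw [← sum_coordSingle x]
  simp

theorem eq_sum_coordSingle_comp_proj {F : Type*} [NormedAddCommGroup F] [NormedSpace ℂ F]
    (X : F →L[ℂ] ProdSpace B p) :
    X = ∑ j, coordSingle j ∘L (PiLp.proj 1 (fun _ : Fin p => B) j ∘L X) := by
  ext1 x
  conv_lhs => rw [← sum_coordSingle (X x)]
  simp

variable (A : Fin p → B →L[ℂ] B)

theorem companion_apply (x : ProdSpace B p) (i : Fin p) :
    companion p A x i = if i.val = 0 then ∑ j, A j (x j) else
      x ⟨i.val - 1, (Nat.sub_le _ _).trans_lt i.isLt⟩ := by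
  change (if i.val = 0 then ∑ j : Fin p, A j ∘L PiLp.proj 1 (fun _ : Fin p => B) j
      else PiLp.proj 1 (fun _ : Fin p => B) ⟨i.val - 1, (Nat.sub_le _ _).trans_lt i.isLt⟩ :
      ProdSpace B p →L[ℂ] B) x = _
  split_ifs <;> simp

/-- Backward induction along the blocks of the companion operator. -/
theorem companion_block_induction {P : Fin p → Prop}
    (h : ∀ j : Fin p, (∀ h : j.val + 1 < p, P ⟨j.val + 1, h⟩) → P j) (j : Fin p) : P j := by
  have key : ∀ (m : ℕ) (j : Fin p), p ≤ j.val + m → P j := by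
    intro m
    induction m with
    | zero => intro j hj; exact absurd j.isLt (by omega)
    | succ m ih => intro j hj; exact h j fun h' => ih _ (by simp only; omega)
  exact key p j (Nat.le_add_left _ _)

theorem companion_apply_succ (x : ProdSpace B p) (k : ℕ) (hk : k + 1 < p) :
    companion p A x ⟨k + 1, hk⟩ = x ⟨k, (Nat.lt_succ_self k).trans hk⟩ := by
  rw [companion_apply, if_neg (Nat.succ_ne_zero k)]
  rfl

variable [NeZero p]

theorem coordEmb_eq : (coordEmb p : B →L[ℂ] ProdSpace B p) = coordSingle 0 := rfl

theorem companion_apply_zero (x : ProdSpace B p) : companion p A x 0 = ∑ j, A j (x j) := by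
  rw [companion_apply, if_pos (Fin.val_zero p)]

theorem companion_coordSingle (j : Fin p) (x : B) :
    companion p A (coordSingle j x) =
      coordSingle 0 (A j x) + if h : j.val + 1 < p then coordSingle ⟨j.val + 1, h⟩ x else 0 := by
  ext ⟨i, hi⟩
  rcases i with _ | i
  · have e0 : (⟨0, hi⟩ : Fin p) = 0 := rfl
    rw [e0, companion_apply_zero, PiLp.add_apply, coordSingle_apply, Pi.single_eq_same,
      Finset.sum_eq_single j]
    · rw [coordSingle_apply, Pi.single_eq_same]
      split_ifs with h
      · rw [coordSingle_apply, Pi.single_eq_of_ne, add_zero]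
        intro h0
        exact absurd (congrArg Fin.val h0) (Nat.succ_ne_zero _).symm
      · simp
    · intro k _ hk
      rw [coordSingle_apply, Pi.single_eq_of_ne hk, map_zero]
    · simp
  · rw [companion_apply_succ, PiLp.add_apply, coordSingle_apply, coordSingle_apply,
      Pi.single_eq_of_ne (i := (0 : Fin p)), zero_add]
    · split_ifs with h
      · rw [coordSingle_apply]
        simp only [Pi.single_apply, Fin.ext_iff, Nat.add_right_cancel_iff]
      · rw [Pi.single_eq_of_ne]
        · rfl
        · intro h0
          have := congrArg Fin.val h0
          simp only at this
          omega
    · intro h0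
      exact absurd (congrArg Fin.val h0) (Nat.succ_ne_zero _)

theorem apply_eq_of_companion_apply_eq_self {v : ProdSpace B p} (hv : companion p A v = v)
    (i : Fin p) : v i = v 0 := by
  obtain ⟨k, hk⟩ := i
  induction k with
  | zero => rfl
  | succ k ih =>
    rw [← ih (by omega), ← companion_apply_succ A v k hk, hv]

/-- An operator fixed by left and right multiplication by the companion operator is determined by
its corner. -/
theorem eq_zero_of_corner_eq_zero {N : ProdSpace B p →L[ℂ] ProdSpace B p}
    (h1 : companion p A * N = N) (h2 : N * companion p A = N)
    (h0 : coordProj p ∘L N ∘L coordEmb p = 0) : N = 0 := by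
  have hz : ∀ x, N (coordSingle 0 x) = 0 := by
    intro x
    ext i
    have hfix : companion p A (N (coordSingle 0 x)) = N (coordSingle 0 x) :=
      congrArg (fun f : _ →L[ℂ] _ => f (coordSingle 0 x)) h1
    rw [apply_eq_of_companion_apply_eq_self A hfix i]
    exact congrArg (fun f : _ →L[ℂ] _ => f x) h0
  -- From N = N a, column j of N is column 0 times A_j plus column j + 1, so vanishing propagates
  -- backwards from the last block.
  have hs : ∀ j x, N (coordSingle j x) = 0 := by
    intro j
    refine companion_block_induction (P := fun j => ∀ x, N (coordSingle j x) = 0) ?_ j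
    intro j hj x
    rw [← h2]
    change N (companion p A (coordSingle j x)) = 0
    rw [companion_coordSingle, map_add, hz, zero_add]
    split_ifs with h
    · exact hj h x
    · exact map_zero N
  rw [eq_sum_coordSingle_comp N]
  refine Finset.sum_eq_zero fun j _ => ?_
  ext1 x
  exact hs j _

/-- Norm convergence of the corners of `aⁿ (1 - a)` implies that of `aⁿ (1 - a)`. -/
theorem exists_tendsto_of_corner {S : B →L[ℂ] B}
    (hS : Tendsto (fun n => coordProj p ∘L (companion p A ^ n * (1 - companion p A)) ∘L coordEmb p)
      atTop (𝓝 S)) :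
    ∃ M, Tendsto (fun n => companion p A ^ n * (1 - companion p A)) atTop (𝓝 M) ∧
      coordProj p ∘L M ∘L coordEmb p = S := by
  set a := companion p A with ha
  set X : ℕ → ProdSpace B p →L[ℂ] ProdSpace B p := fun n => a ^ n * (1 - a) with hX
  have hXr : ∀ n, X (n + 1) = X n * a := fun n => by
    simp only [hX]
    rw [pow_succ, mul_assoc, mul_assoc, mul_sub, sub_mul, mul_one, one_mul]
  have hXl : ∀ n, X (n + 1) = a * X n := fun n => by
    simp only [hX]
    rw [pow_succ', mul_assoc]
  have cont1 : ∀ {F G H : Type _} [NormedAddCommGroup F] [NormedSpace ℂ F] [NormedAddCommGroup G]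
      [NormedSpace ℂ G] [NormedAddCommGroup H] [NormedSpace ℂ H] (D : F →L[ℂ] G)
      {f : ℕ → G →L[ℂ] H} {L : G →L[ℂ] H}, Tendsto f atTop (𝓝 L) →
      Tendsto (fun n => f n ∘L D) atTop (𝓝 (L ∘L D)) := by
    intro F G H _ _ _ _ _ _ D f L hf
    exact ((ContinuousLinearMap.compL ℂ F G H).flip D).continuous.tendsto L |>.comp hf
  have cont2 : ∀ {F G H : Type _} [NormedAddCommGroup F] [NormedSpace ℂ F] [NormedAddCommGroup G]
      [NormedSpace ℂ G] [NormedAddCommGroup H] [NormedSpace ℂ H] (D : G →L[ℂ] H)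
      {f : ℕ → F →L[ℂ] G} {L : F →L[ℂ] G}, Tendsto f atTop (𝓝 L) →
      Tendsto (fun n => D ∘L f n) atTop (𝓝 (D ∘L L)) := by
    intro F G H _ _ _ _ _ _ D f L hf
    exact (ContinuousLinearMap.compL ℂ F G H D).continuous.tendsto L |>.comp hf
  -- X (n+1) = X n · a expresses column j at time n + 1 through columns 0 and j + 1 at time n, so
  -- convergence of the corner spreads from the last column back.
  have h1 : ∀ j : Fin p, ∃ L, Tendsto (fun n => (coordProj p ∘L X n) ∘L coordSingle j)
      atTop (𝓝 L) := by
    refine companion_block_induction fun j hj => ?_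
    have hA := cont1 (A j) hS
    suffices h : ∃ L, Tendsto (fun n => (coordProj p ∘L X (n + 1)) ∘L coordSingle j)
        atTop (𝓝 L) by
      obtain ⟨L, hL⟩ := h
      exact ⟨L, (tendsto_add_atTop_iff_nat 1).mp hL⟩
    by_cases h : j.val + 1 < p
    · obtain ⟨L, hL⟩ := hj h
      refine ⟨_, (hA.add hL).congr fun n => ?_⟩
      rw [hXr]
      ext1 x
      change coordProj p (X n (coordSingle 0 (A j x))) + coordProj p (X n (coordSingle _ x)) =
        coordProj p (X n (a (coordSingle j x)))
      rw [ha, companion_coordSingle, dif_pos h, map_add, map_add]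
    · refine ⟨_, hA.congr fun n => ?_⟩
      rw [hXr]
      ext1 x
      change coordProj p (X n (coordSingle 0 (A j x))) =
        coordProj p (X n (a (coordSingle j x)))
      rw [ha, companion_coordSingle, dif_neg h, add_zero]
  have h2 : ∃ L, Tendsto (fun n => coordProj p ∘L X n) atTop (𝓝 L) := by
    choose L hL using h1
    refine ⟨∑ j, L j ∘L PiLp.proj 1 (fun _ : Fin p => B) j, ?_⟩
    have := tendsto_finsetSum Finset.univ fun j _ =>
      cont1 (PiLp.proj 1 (fun _ : Fin p => B) j) (hL j)
    exact this.congr fun n => (eq_sum_coordSingle_comp (coordProj p ∘L X n)).symm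
  -- X (n+1) = a · X n makes row k + 1 at time n + 1 equal to row k at time n.
  have h3 : ∀ i : Fin p, ∃ L, Tendsto (fun n => PiLp.proj 1 (fun _ : Fin p => B) i ∘L X n)
      atTop (𝓝 L) := by
    rintro ⟨k, hk⟩
    induction k with
    | zero => exact h2
    | succ k ih =>
      obtain ⟨L, hL⟩ := ih (by omega)
      refine ⟨L, (tendsto_add_atTop_iff_nat 1).mp (hL.congr fun n => ?_)⟩
      rw [hXl]
      ext1 x
      exact (companion_apply_succ A (X n x) k hk).symm
  choose L hL using h3
  have h4 : Tendsto X atTop (𝓝 (∑ j, coordSingle j ∘L L j)) := by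
    have := tendsto_finsetSum Finset.univ fun j _ => cont2 (coordSingle j) (hL j)
    exact this.congr fun n => (eq_sum_coordSingle_comp_proj (X n)).symm
  exact ⟨_, h4, tendsto_nhds_unique (cont2 _ (cont1 _ h4)) hS⟩

/-- The vector `(x_t, x_{t-1}, …, x_{t-p+1})`. -/
def lagVec (p : ℕ) (x : ℤ → B) (t : ℤ) : ProdSpace B p :=
  WithLp.toLp 1 fun i : Fin p => x (t - (i.val : ℤ))

theorem lagVec_apply {B : Type*} {p : ℕ} (x : ℤ → B) (t : ℤ) (i : Fin p) :
    lagVec p x t i = x (t - (i.val : ℤ)) := rfl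

theorem coordProj_lagVec (x : ℤ → B) (t : ℤ) : coordProj p (lagVec p x t) = x t := by
  change x (t - ((0 : Fin p).val : ℤ)) = x t
  simp

theorem lagVec_eq {x : ℤ → B} {e : B} {t : ℤ}
    (h : x t - ∑ j : Fin p, A j (x (t - ((j.val : ℤ) + 1))) = e) :
    lagVec p x t = companion p A (lagVec p x (t - 1)) + coordEmb p e := by
  ext ⟨i, hi⟩
  rw [PiLp.add_apply, coordEmb_eq, coordSingle_apply]
  rcases i with _ | i
  · have e0 : (⟨0, hi⟩ : Fin p) = 0 := rfl
    rw [e0, companion_apply_zero, Pi.single_eq_same, ← h]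
    simp only [lagVec_apply, Fin.val_zero, Nat.cast_zero, sub_zero, sub_sub, add_comm (1 : ℤ)]
    abel
  · rw [companion_apply_succ, Pi.single_eq_of_ne, add_zero, lagVec_apply, lagVec_apply]
    · congr 1
      push_cast
      ring
    · intro h0
      exact absurd (congrArg Fin.val h0) (Nat.succ_ne_zero _)

/-- The coordinates of a solution of the companion recursion are lagged first coordinates, which
solve the autoregressive equation. -/
theorem apply_eq_of_companion_recursion {V : ℤ → ProdSpace B p} {e : ℤ → B} {s : ℤ}
    (h : ∀ t, s < t → V t = companion p A (V (t - 1)) + coordEmb p (e t)) (t : ℤ) (i : Fin p)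
    (ht : s + i.val ≤ t) : V t i = V (t - (i.val : ℤ)) 0 := by
  obtain ⟨k, hk⟩ := i
  simp only at ht ⊢
  induction k generalizing t with
  | zero => rw [Nat.cast_zero, sub_zero]; rfl
  | succ k ih =>
    push_cast at ht ⊢
    rw [h t (by omega), PiLp.add_apply, companion_apply_succ, coordEmb_eq, coordSingle_apply,
      Pi.single_eq_of_ne, add_zero, ih _ (by omega) (by omega), sub_sub, add_comm (1 : ℤ)]
    intro h0
    exact absurd (congrArg Fin.val h0) (Nat.succ_ne_zero _)

/-- The recursion at t produces ∑ A_j V(t-1)_j. Once t ≥ s + p, even the last coordinate of V(t-1)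
is a genuine lag of the first. -/
theorem law_of_companion_recursion {V : ℤ → ProdSpace B p} {e : ℤ → B} {s : ℤ}
    (h : ∀ t, s < t → V t = companion p A (V (t - 1)) + coordEmb p (e t)) (t : ℤ)
    (ht : s + p ≤ t) :
    coordProj p (V t) - ∑ j : Fin p, A j (coordProj p (V (t - ((j.val : ℤ) + 1)))) = e t := by
  have hp : 0 < p := Nat.pos_of_ne_zero (NeZero.ne p)
  change V t 0 - ∑ j : Fin p, A j (V (t - ((j.val : ℤ) + 1)) 0) = e t
  rw [h t (by omega), PiLp.add_apply, companion_apply_zero, coordEmb_eq, coordSingle_apply,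
    Pi.single_eq_same, add_sub_right_comm, ← Finset.sum_sub_distrib, Finset.sum_eq_zero, zero_add]
  intro j _
  have := j.isLt
  rw [apply_eq_of_companion_recursion A h (t - 1) j (by omega), sub_sub, add_comm (1 : ℤ), sub_self]

/-- The coefficients of `(1 - z)²`. -/
def diffCoeff (k : ℤ) : ℂ := if k = 0 then 1 else if k = 1 then -2 else if k = 2 then 1 else 0

/-- A sequence extended by zero to negative indices. -/
def zeroExtend {F : Type*} [Zero F] (C : ℕ → F) (k : ℤ) : F := if 0 ≤ k then C k.toNat else 0

theorem zeroExtend_natCast {F : Type*} [Zero F] (C : ℕ → F) (k : ℕ) : zeroExtend C k = C k := by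
  simp [zeroExtend]

theorem zeroExtend_of_neg {F : Type*} [Zero F] (C : ℕ → F) {k : ℤ} (h : k < 0) :
    zeroExtend C k = 0 := if_neg (not_le.mpr h)

theorem mul_sub_two_add_one {R : Type*} [Ring R] (a : R) : a * (a - 2) + 1 = (1 - a) * (1 - a) := by
  rw [← one_add_one_eq_two]
  noncomm_ring

theorem neg_mul_add_mul_sq {R : Type*} [Ring R] (x a : R) :
    -(x * (1 - a)) + x * ((1 - a) * (1 - a)) = -(x * a * (1 - a)) := by
  noncomm_ring

/-- The coefficients of `(1 - z)² A(z)⁻¹`. -/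
def diffImpulse (A : Fin p → B →L[ℂ] B) : ℕ → B →L[ℂ] B
  | 0 => 1
  | 1 => coordProj p ∘L (companion p A - 2) ∘L coordEmb p
  | n + 2 => coordProj p ∘L
      (companion p A ^ n * ((1 - companion p A) * (1 - companion p A))) ∘L coordEmb p

/-- The sum telescopes because aⁿ(1 - a)² = aⁿ(1 - a) - aⁿ⁺¹(1 - a), and the first two coefficients
add up to the corner of -(1 - a). -/
theorem sum_range_diffImpulse (n : ℕ) : ∑ k ∈ Finset.range (n + 2), diffImpulse A k =
    -(coordProj p ∘L (companion p A ^ n * (1 - companion p A)) ∘L coordEmb p) := by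
  have cadd : ∀ X Y : ProdSpace B p →L[ℂ] ProdSpace B p, coordProj p ∘L X ∘L coordEmb p +
      coordProj p ∘L Y ∘L coordEmb p = coordProj p ∘L (X + Y) ∘L coordEmb p := fun X Y =>
    ContinuousLinearMap.ext fun y => (map_add (coordProj p) _ _).symm
  have cneg : ∀ X : ProdSpace B p →L[ℂ] ProdSpace B p, -(coordProj p ∘L X ∘L coordEmb p) =
      coordProj p ∘L (-X) ∘L coordEmb p := fun X =>
    ContinuousLinearMap.ext fun y => (map_neg (coordProj p) _).symm
  induction n with
  | zero =>
    have : (1 : B →L[ℂ] B) = coordProj p ∘L (1 : ProdSpace B p →L[ℂ] ProdSpace B p) ∘L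
        coordEmb p := by
      ext y
      change y = (Pi.single (0 : Fin p) y : Fin p → B) 0
      simp
    rw [Finset.sum_range_succ, Finset.sum_range_one, diffImpulse, diffImpulse, this, cadd,
      cneg, pow_zero, one_mul, ← one_add_one_eq_two]
    congr 2
    abel
  | succ n ih =>
    rw [Finset.sum_range_succ, ih, diffImpulse, cneg, cadd, cneg, pow_succ, neg_mul_add_mul_sq]

/-- The solution of `A(z) C(z) = (1 - z)²` for formal power series. -/
theorem coeff_of_filter_eq {C : ℕ → B →L[ℂ] B}
    (h : ∀ k : ℕ, C k - ∑ j : Fin p, A j ∘L zeroExtend C ((k : ℤ) - ((j.val : ℤ) + 1)) =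
      diffCoeff k • 1) :
    C = diffImpulse A := by
  set a := companion p A with ha
  set x : B → ℤ → B := fun y k => zeroExtend C k y with hx
  -- For fixed y the sequence C_k y is a deterministic autoregression started from zero and driven
  -- by the coefficients of (1 - z)² applied to y.
  have hlag : ∀ (y : B) (k : ℕ), lagVec p (x y) k =
      a (lagVec p (x y) ((k : ℤ) - 1)) + coordEmb p (diffCoeff k • y) := by
    intro y k
    refine lagVec_eq A ?_
    have := congrArg (fun f : B →L[ℂ] B => f y) (h k)
    simp only [hx, zeroExtend_natCast]
    simpa using this
  have hx0 : ∀ y, lagVec p (x y) (-1) = 0 := by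
    intro y
    ext i
    rw [lagVec_apply]
    simp only [hx]
    rw [zeroExtend_of_neg _ (by omega)]
    rfl
  have l0 : ∀ y, lagVec p (x y) 0 = coordEmb p y := by
    intro y
    have := hlag y 0
    rw [Nat.cast_zero, zero_sub, hx0, map_zero, zero_add] at this
    rw [this]
    simp [diffCoeff]
  have l1 : ∀ y, lagVec p (x y) 1 = (a - 2) (coordEmb p y) := by
    intro y
    have := hlag y 1
    rw [Nat.cast_one, sub_self, l0] at this
    rw [this, ← one_add_one_eq_two, sub_apply, add_apply]
    simp only [diffCoeff, one_ne_zero, if_true, if_false, one_apply_eq_self]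
    rw [neg_smul, two_smul, map_neg, map_add, sub_eq_add_neg]
  have l2 : ∀ y (n : ℕ), lagVec p (x y) ((n + 2 : ℕ) : ℤ) =
      (a ^ n * ((1 - a) * (1 - a))) (coordEmb p y) := by
    intro y n
    induction n with
    | zero =>
      rw [hlag]
      push_cast
      rw [l1]
      simp only [diffCoeff]
      norm_num only [if_true, if_false]
      rw [one_smul]
      have : a * (a - 2) + 1 = a ^ 0 * ((1 - a) * (1 - a)) := by
        rw [pow_zero, one_mul]
        exact mul_sub_two_add_one a
      exact congrArg (fun f : _ →L[ℂ] _ => f (coordEmb p y)) this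
    | succ n ih =>
      rw [hlag, show ((n + 1 + 2 : ℕ) : ℤ) - 1 = ((n + 2 : ℕ) : ℤ) by push_cast; ring, ih]
      have hd : diffCoeff ((n + 1 + 2 : ℕ) : ℤ) = 0 := by
        simp only [diffCoeff]
        rw [if_neg (by omega), if_neg (by omega), if_neg (by omega)]
      rw [hd, zero_smul, map_zero, add_zero, pow_succ', mul_assoc]
      rfl
  have hC : ∀ (k : ℕ) y, C k y = coordProj p (lagVec p (x y) k) := by
    intro k y
    rw [coordProj_lagVec]
    simp only [hx, zeroExtend_natCast]
  have c0 : C 0 = 1 := by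
    ext y
    have := hC 0 y
    rw [Nat.cast_zero, coordProj_lagVec] at this
    rw [this, ← coordProj_lagVec (p := p) (x y) 0, l0]
    change (Pi.single (0 : Fin p) y : Fin p → B) 0 = y
    simp
  have c1 : C 1 = coordProj p ∘L (a - 2) ∘L coordEmb p := by
    ext y
    rw [hC, Nat.cast_one, l1]
    rfl
  have c2 : ∀ n, C (n + 2) = coordProj p ∘L (a ^ n * ((1 - a) * (1 - a))) ∘L coordEmb p := by
    intro n
    ext y
    rw [hC, l2]
    rfl
  funext k
  match k with
  | 0 => exact c0
  | 1 => exact c1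
  | n + 2 => exact c2 n

end CompanionAlgebra

/-! ### L²-convergent linear sums and uniqueness of their coefficients. -/

section LinearSums

variable {Ω : Type*} [MeasurableSpace Ω] {μ : Measure Ω}
  {B : Type*} [NormedAddCommGroup B] [NormedSpace ℂ B] {ε : ℤ → Ω → B}

/-- Cauchy–Schwarz, used to pass L² limits through inner products. -/
theorem enorm_integral_mul_le {f g : Ω → ℂ} (hf : MemLp f 2 μ) (hg : MemLp g 2 μ) :
    ‖∫ ω, f ω * g ω ∂μ‖ₑ ≤ eLpNorm f 2 μ * eLpNorm g 2 μ := by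
  refine (enorm_integral_le_lintegral_enorm _).trans ?_
  rw [← eLpNorm_one_eq_lintegral_enorm]
  refine (eLpNorm_le_eLpNorm_mul_eLpNorm_of_nnnorm (p := 2) (q := 2) (r := 1) hf.1 hg.1
    (· * ·) 1 (Eventually.of_forall fun ω => ?_)).trans_eq ?_
  · simp
  · simp

theorem IsLinearSum.congr_ae {C : ℕ → B →L[ℂ] B} {t : ℤ} {Y Y' : Ω → B}
    (h : IsLinearSum μ ε C t Y) (hY : Y =ᵐ[μ] Y') : IsLinearSum μ ε C t Y' := by
  refine Tendsto.congr (fun n => eLpNorm_congr_ae ?_) h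
  filter_upwards [hY] with ω hω
  rw [hω]

theorem IsLinearSum.comp {C : ℕ → B →L[ℂ] B} {t : ℤ} {Y : Ω → B} (h : IsLinearSum μ ε C t Y)
    (L : B →L[ℂ] B) : IsLinearSum μ ε (fun k => L ∘L C k) t (fun ω => L (Y ω)) := by
  have h' := ENNReal.Tendsto.const_mul (a := ENNReal.ofReal ‖L‖) h (Or.inr ENNReal.ofReal_ne_top)
  rw [mul_zero] at h'
  refine tendsto_of_tendsto_of_tendsto_of_le_of_le tendsto_const_nhds h'
    (fun _ => zero_le) fun n => ?_
  refine eLpNorm_le_mul_eLpNorm_of_ae_le_mul (Eventually.of_forall fun ω => ?_) 2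
  simp only [ContinuousLinearMap.comp_apply]
  rw [← map_sum, ← map_sub]
  exact L.le_opNorm _

theorem IsLinearSum.zero (t : ℤ) : IsLinearSum μ ε (fun _ => 0) t (fun _ => (0 : B)) := by
  have : ∀ n : ℕ, eLpNorm (fun ω => (0 : B) -
      ∑ k ∈ Finset.range n, (0 : B →L[ℂ] B) (ε (t - k) ω)) 2 μ = 0 := fun n => by simp
  exact tendsto_const_nhds.congr fun n => (this n).symm

theorem IsLinearSum.shift {C : ℕ → B →L[ℂ] B} {t : ℤ} {Y : Ω → B} (m : ℕ)
    (h : IsLinearSum μ ε C (t - m) Y) :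
    IsLinearSum μ ε (fun k => zeroExtend C ((k : ℤ) - m)) t Y := by
  refine (tendsto_add_atTop_iff_nat m).mp (Tendsto.congr (fun n => ?_) h)
  congr 1
  ext ω
  rw [add_comm n m, Finset.sum_range_add]
  have h0 : ∑ k ∈ Finset.range m, (zeroExtend C ((k : ℤ) - m)) (ε (t - k) ω) = 0 := by
    refine Finset.sum_eq_zero fun k hk => ?_
    rw [Finset.mem_range] at hk
    rw [zeroExtend_of_neg _ (by omega)]
    rfl
  rw [h0, zero_add]
  congr 1
  refine Finset.sum_congr rfl fun k _ => ?_
  simp only [Nat.cast_add, add_sub_cancel_left, zeroExtend_natCast, sub_sub]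

theorem IsLinearSum.single (t : ℤ) (c : ℂ) (m : ℕ) :
    IsLinearSum μ ε (fun k => if k = m then c • 1 else 0) t (fun ω => c • ε (t - m) ω) := by
  refine tendsto_const_nhds.congr' ?_
  filter_upwards [eventually_gt_atTop m] with n hn
  have : (fun ω => c • ε (t - m) ω - ∑ k ∈ Finset.range n,
      (if k = m then c • 1 else (0 : B →L[ℂ] B)) (ε (t - k) ω)) = 0 := by
    ext ω
    rw [Finset.sum_eq_single m]
    · simp
    · intro k _ hk
      rw [if_neg hk]
      rfl
    · intro h
      exact absurd (Finset.mem_range.mpr hn) h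
  rw [this, eLpNorm_zero]

variable [MeasurableSpace B]

theorem IsInnovation.memLp_comp (hε : IsInnovation μ ε) {F : Type*} [NormedAddCommGroup F]
    [NormedSpace ℂ F] (L : B →L[ℂ] F) (t : ℤ) : MemLp (fun ω => L (ε t ω)) 2 μ :=
  L.comp_memLp' (hε.centered t).memLp

theorem IsInnovation.memLp_sum (hε : IsInnovation μ ε) {F : Type*} [NormedAddCommGroup F]
    [NormedSpace ℂ F] (C : ℕ → B →L[ℂ] F) (t : ℤ) (n : ℕ) :
    MemLp (fun ω => ∑ k ∈ Finset.range n, C k (ε (t - k) ω)) 2 μ :=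
  memLp_finsetSum _ fun k _ => hε.memLp_comp (C k) _

theorem IsLinearSum.sub (hε : IsInnovation μ ε) {C D : ℕ → B →L[ℂ] B} {t : ℤ} {Y Z : Ω → B}
    (hY : AEStronglyMeasurable Y μ) (hZ : AEStronglyMeasurable Z μ)
    (h1 : IsLinearSum μ ε C t Y) (h2 : IsLinearSum μ ε D t Z) :
    IsLinearSum μ ε (fun k => C k - D k) t (fun ω => Y ω - Z ω) := by
  have h := h1.add h2
  rw [add_zero] at h
  refine tendsto_of_tendsto_of_tendsto_of_le_of_le tendsto_const_nhds h
    (fun _ => zero_le) fun n => ?_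
  refine le_trans (le_of_eq (eLpNorm_congr_ae (Eventually.of_forall fun ω => ?_)))
    (eLpNorm_sub_le (hY.sub (hε.memLp_sum C t n).1) (hZ.sub (hε.memLp_sum D t n).1) one_le_two)
  simp only [Pi.sub_apply, sub_apply, Finset.sum_sub_distrib]
  abel

theorem IsLinearSum.sum (hε : IsInnovation μ ε) {ι : Type*} {C : ι → ℕ → B →L[ℂ] B} {t : ℤ}
    {Y : ι → Ω → B} (hY : ∀ i, AEStronglyMeasurable (Y i) μ)
    (h : ∀ i, IsLinearSum μ ε (C i) t (Y i)) (s : Finset ι) :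
    IsLinearSum μ ε (fun k => ∑ i ∈ s, C i k) t (fun ω => ∑ i ∈ s, Y i ω) := by
  classical
  induction s using Finset.induction_on with
  | empty => simpa using IsLinearSum.zero t
  | insert i s hi ih =>
    have hneg := IsLinearSum.sub hε aestronglyMeasurable_const
      (Finset.aestronglyMeasurable_fun_sum s fun i _ => hY i) (IsLinearSum.zero t) ih
    have := IsLinearSum.sub hε (hY i) (aestronglyMeasurable_const.sub
      (Finset.aestronglyMeasurable_fun_sum s fun i _ => hY i)) (h i) hneg
    simpa [Finset.sum_insert hi] using this

theorem IsLinearSum.ae_eq (hε : IsInnovation μ ε) {C : ℕ → B →L[ℂ] B} {t : ℤ} {Y Z : Ω → B}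
    (hY : AEStronglyMeasurable Y μ) (hZ : AEStronglyMeasurable Z μ)
    (h1 : IsLinearSum μ ε C t Y) (h2 : IsLinearSum μ ε C t Z) : Y =ᵐ[μ] Z := by
  have h := IsLinearSum.sub hε hY hZ h1 h2
  have h0 : eLpNorm (fun ω => Y ω - Z ω) 2 μ = 0 := by
    refine tendsto_nhds_unique (tendsto_const_nhds.congr fun n => ?_) h
    simp
  replace h0 := (eLpNorm_eq_zero_iff (hY.sub hZ) two_ne_zero).mp h0
  filter_upwards [h0] with ω hω
  exact sub_eq_zero.mp hω

variable [IsProbabilityMeasure μ] [BorelSpace B] [CompleteSpace B]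

/-- The coefficients of a one-sided linear process are determined by the process. -/
theorem IsLinearSum.coeff_eq_zero (hε : IsInnovation μ ε) {D : ℕ → B →L[ℂ] B} {t : ℤ}
    (h : IsLinearSum μ ε D t (fun _ => 0)) (k : ℕ) : D k = 0 := by
  ext1 x
  refine SeparatingDual.eq_zero_of_forall_dual_eq_zero (R := ℂ) fun f => ?_
  set g : ℕ → Ω → ℂ := fun j ω => f (D j (ε (t - j) ω)) with hg
  have hgL : ∀ j, MemLp (g j) 2 μ := fun j => hε.memLp_comp (f ∘L D j) _
  have hcL : MemLp (fun ω => (starRingEnd ℂ) (g k ω)) 2 μ := (hgL k).star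
  have hint : ∀ j, Integrable (fun ω => (starRingEnd ℂ) (g k ω) * g j ω) μ := fun j =>
    hcL.integrable_mul (hgL j)
  -- Distinct innovations are independent and centered, so pairing the series with its k-th term
  -- isolates that term.
  have hzero : ∀ j, j ≠ k → ∫ ω, (starRingEnd ℂ) (g k ω) * g j ω ∂μ = 0 := by
    intro j hj
    have hind : IndepFun (fun ω => (starRingEnd ℂ) (g k ω)) (g j) μ := by
      have h0 := hε.indep.indepFun (show (t - k : ℤ) ≠ t - j by omega)
      exact h0.comp (φ := fun y => (starRingEnd ℂ) (f (D k y))) (ψ := fun y => f (D j y))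
        ((RCLike.continuous_conj.comp (f ∘L D k).continuous).measurable)
        (f ∘L D j).continuous.measurable
    rw [hind.integral_fun_mul_eq_mul_integral hcL.1 (hgL j).1]
    have : ∫ ω, g j ω ∂μ = 0 := by
      have := (f ∘L D j).integral_comp_comm ((hε.centered (t - j)).memLp.integrable one_le_two)
      rw [(hε.centered (t - j)).mean_zero, map_zero] at this
      exact this
    rw [this, mul_zero]
  have hsum : ∀ n > k, ∫ ω, (starRingEnd ℂ) (g k ω) * ∑ j ∈ Finset.range n, g j ω ∂μ =
      ∫ ω, (starRingEnd ℂ) (g k ω) * g k ω ∂μ := by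
    intro n hn
    simp_rw [Finset.mul_sum]
    rw [integral_finsetSum _ fun j _ => hint j, Finset.sum_eq_single k (fun j _ hj => hzero j hj)]
    intro h
    exact absurd (Finset.mem_range.mpr hn) h
  have hG : Tendsto (fun n => eLpNorm (fun ω => ∑ j ∈ Finset.range n, g j ω) 2 μ) atTop (𝓝 0) := by
    have h' := ENNReal.Tendsto.const_mul (a := ENNReal.ofReal ‖f‖) h (Or.inr ENNReal.ofReal_ne_top)
    rw [mul_zero] at h'
    refine tendsto_of_tendsto_of_tendsto_of_le_of_le tendsto_const_nhds h'
      (fun _ => zero_le) fun n => ?_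
    refine eLpNorm_le_mul_eLpNorm_of_ae_le_mul (Eventually.of_forall fun ω => ?_) 2
    simp only [hg]
    rw [← map_sum, zero_sub, norm_neg]
    exact f.le_opNorm _
  have hlim : Tendsto (fun n => ∫ ω, (starRingEnd ℂ) (g k ω) * ∑ j ∈ Finset.range n, g j ω ∂μ)
      atTop (𝓝 0) := by
    rw [tendsto_zero_iff_enorm_tendsto_zero]
    have h' := ENNReal.Tendsto.const_mul (a := eLpNorm (fun ω => (starRingEnd ℂ) (g k ω)) 2 μ) hG
      (Or.inr hcL.2.ne)
    rw [mul_zero] at h'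
    refine tendsto_of_tendsto_of_tendsto_of_le_of_le tendsto_const_nhds h'
      (fun _ => zero_le) fun n => ?_
    exact enorm_integral_mul_le hcL (memLp_finsetSum (Finset.range n) fun j _ => hgL j)
  have hk0 : ∫ ω, (starRingEnd ℂ) (g k ω) * g k ω ∂μ = 0 :=
    tendsto_nhds_unique (tendsto_const_nhds.congr'
      ((eventually_gt_atTop k).mono fun n hn => (hsum n hn).symm)) hlim
  -- The isolated term is the variance of f ∘ D_k at ε_{t-k}; positive definiteness then gives f ∘
  -- D_k = 0.
  have hcov : (f ∘L D k) (covOp μ (ε (t - k)) (f ∘L D k)) = 0 := by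
    rw [← hk0, covOp, ← ContinuousLinearMap.integral_comp_comm]
    · refine integral_congr_ae (Eventually.of_forall fun ω => ?_)
      simp only [map_smul, smul_eq_mul]
      rfl
    · exact (MemLp.smul (p := 2) (q := 2) (r := 1)
        (hε.centered (t - k)).memLp hcL).integrable le_rfl
  have := hε.posDef (t - k) _ hcov
  exact congrArg (fun F : B →L[ℂ] ℂ => F x) this

end LinearSums

/-! ### Linear processes as measurable functionals of the innovation path. -/

section LinearSeries

variable {B : Type*} [NormedAddCommGroup B] [NormedSpace ℂ B]

open Classical in
/-- The series `∑ h_k x_{-k}` where it converges absolutely, and `0` elsewhere. -/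
def linSeries (h : ℕ → B →L[ℂ] B) (x : ℤ → B) : B :=
  if ∑' k : ℕ, ‖h k‖ₑ * ‖x (-k)‖ₑ ≠ ⊤ then ∑' k : ℕ, h k (x (-k)) else 0

theorem summable_mul_norm_of_tsum_ne_top {B : Type*} [NormedAddCommGroup B]
    {u : ℕ → ℝ} (hu : ∀ k, 0 ≤ u k) {y : ℕ → B}
    (h : ∑' k, ENNReal.ofReal (u k) * ‖y k‖ₑ ≠ ⊤) : Summable fun k => u k * ‖y k‖ := by
  have := ENNReal.summable_toReal h
  refine this.congr fun k => ?_
  rw [ENNReal.toReal_mul, ENNReal.toReal_ofReal (hu k), toReal_enorm]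

theorem summable_apply_of_summable_mul_norm {F : Type*} [NormedAddCommGroup F] [NormedSpace ℂ F]
    [CompleteSpace F] {h : ℕ → B →L[ℂ] F} {u : ℕ → ℝ} (hu : ∀ k, ‖h k‖ ≤ u k) {y : ℕ → B}
    (hs : Summable fun k => u k * ‖y k‖) : Summable fun k => h k (y k) :=
  hs.of_norm_bounded fun k => (h k).le_of_opNorm_le (hu k) _

theorem measurable_linSeries [CompleteSpace B] [SecondCountableTopology B] [MeasurableSpace B]
    [BorelSpace B] (h : ℕ → B →L[ℂ] B) : Measurable (linSeries h) := by
  have hG : MeasurableSet {x : ℤ → B | ∑' k : ℕ, ‖h k‖ₑ * ‖x (-k)‖ₑ ≠ ⊤} := by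
    have : Measurable fun x : ℤ → B => ∑' k : ℕ, ‖h k‖ₑ * ‖x (-k)‖ₑ :=
      Measurable.tsum fun k => (measurable_pi_apply (-(k : ℤ))).enorm.const_mul _
    exact (this (measurableSet_singleton ⊤)).compl
  -- Cutting the partial sums off outside the convergence set makes them converge at every path, not
  -- only almost everywhere.
  refine measurable_of_tendsto_metrizable (f := fun n => Set.indicator
    {x : ℤ → B | ∑' k : ℕ, ‖h k‖ₑ * ‖x (-k)‖ₑ ≠ ⊤}
    (fun x => ∑ k ∈ Finset.range n, h k (x (-k)))) (fun n => ?_) ?_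
  · exact (Finset.measurable_fun_sum _ fun k _ =>
      (h k).continuous.measurable.comp (measurable_pi_apply (-(k : ℤ)))).indicator hG
  · rw [tendsto_pi_nhds]
    intro x
    by_cases hx : ∑' k : ℕ, ‖h k‖ₑ * ‖x (-k)‖ₑ ≠ ⊤
    · have hs : Summable fun k : ℕ => h k (x (-k)) := by
        refine summable_apply_of_summable_mul_norm (fun k => le_rfl)
          (summable_mul_norm_of_tsum_ne_top (fun k => norm_nonneg (h k)) ?_)
        simpa only [ofReal_norm] using hx
      rw [linSeries, if_pos hx]
      refine hs.hasSum.tendsto_sum_nat.congr fun n => ?_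
      rw [Set.indicator_of_mem]
      exact hx
    · rw [linSeries, if_neg hx]
      refine tendsto_const_nhds.congr fun n => ?_
      rw [Set.indicator_of_notMem]
      exact hx

variable {Ω : Type*} [MeasurableSpace Ω] {μ : Measure Ω}
  [MeasurableSpace B] {ε : ℤ → Ω → B}

theorem IsInnovation.eLpNorm_eq (hε : IsInnovation μ ε) [BorelSpace B] (q : ENNReal) (t : ℤ) :
    eLpNorm (ε t) q μ = eLpNorm (ε 0) q μ :=
  (hε.identDistrib t 0).eLpNorm_eq q

/-- By Tonelli and identical distribution the expected value of the series is ∑ u_k · E‖ε₀‖, which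
is finite. -/
theorem IsInnovation.ae_tsum_ne_top [IsProbabilityMeasure μ] [BorelSpace B]
    (hε : IsInnovation μ ε) {u : ℕ → ℝ} (hs : Summable u) :
    ∀ᵐ ω ∂μ, ∀ t : ℤ, ∑' k : ℕ, ENNReal.ofReal (u k) * ‖ε (t - k) ω‖ₑ ≠ ⊤ := by
  rw [ae_all_iff]
  intro t
  have hm : ∀ s, AEMeasurable (fun ω => ‖ε s ω‖ₑ) μ := fun s => (hε.centered s).memLp.1.enorm
  have h : ∫⁻ ω, ∑' k : ℕ, ENNReal.ofReal (u k) * ‖ε (t - k) ω‖ₑ ∂μ ≠ ⊤ := by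
    rw [lintegral_tsum fun k => (hm _).const_mul _]
    have : ∀ k : ℕ, ∫⁻ ω, ENNReal.ofReal (u k) * ‖ε (t - k) ω‖ₑ ∂μ =
        ENNReal.ofReal (u k) * eLpNorm (ε 0) 1 μ := by
      intro k
      rw [lintegral_const_mul'' _ (hm _), ← eLpNorm_one_eq_lintegral_enorm, hε.eLpNorm_eq]
    simp_rw [this]
    rw [ENNReal.tsum_mul_right]
    exact ENNReal.mul_ne_top hs.tsum_ofReal_ne_top
      ((hε.centered 0).memLp.mono_exponent one_le_two).2.ne
  filter_upwards [ae_lt_top' (AEMeasurable.tsum fun k => (hm _).const_mul _) h] with ω hω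
  exact hω.ne

theorem IsInnovation.ae_summable [IsProbabilityMeasure μ] [BorelSpace B]
    (hε : IsInnovation μ ε) {u : ℕ → ℝ} (hu : ∀ k, 0 ≤ u k) (hs : Summable u) :
    ∀ᵐ ω ∂μ, ∀ t : ℤ, Summable fun k : ℕ => u k * ‖ε (t - k) ω‖ := by
  filter_upwards [hε.ae_tsum_ne_top hs] with ω hω t
  exact summable_mul_norm_of_tsum_ne_top hu (hω t)

/-- The linear process with coefficients `h` driven by `ε`. -/
def linProcess (h : ℕ → B →L[ℂ] B) (ε : ℤ → Ω → B) (t : ℤ) (ω : Ω) : B :=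
  linSeries h fun s => ε (t + s) ω

theorem measurable_linProcess [BorelSpace B] [CompleteSpace B]
    [SecondCountableTopology B] (hε : IsInnovation μ ε) (h : ℕ → B →L[ℂ] B) (t : ℤ) :
    Measurable (linProcess h ε t) :=
  (measurable_linSeries h).comp (measurable_pi_lambda _ fun s => (hε.centered (t + s)).measurable)

/-- The process applies one fixed measurable functional to the shifted path, and the law of an iid
path is shift invariant. -/
theorem isStationaryProc_linProcess [BorelSpace B] [CompleteSpace B]
    [SecondCountableTopology B] (hε : IsInnovation μ ε) (h : ℕ → B →L[ℂ] B) :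
    IsStationaryProc μ (fun t : ℕ => linProcess h ε t) := by
  intro s
  have h1 : IdentDistrib (fun ω (i : ℤ) => ε i ω) (fun ω (i : ℤ) => ε (s + i) ω) μ μ :=
    IdentDistrib.pi (fun i => hε.identDistrib i (s + i)) hε.indep
      (hε.indep.precomp (add_right_injective (s : ℤ)))
  have h2 : Measurable fun (x : ℤ → B) (t : ℕ) => linSeries h fun r => x (t + r) :=
    measurable_pi_lambda _ fun t => (measurable_linSeries h).comp
      (measurable_pi_lambda _ fun r => measurable_pi_apply _)
  have e : (fun ω (t : ℕ) => linProcess h ε ((t + s : ℕ) : ℤ) ω) =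
      (fun (x : ℤ → B) (t : ℕ) => linSeries h fun r => x (t + r)) ∘
        fun ω (i : ℤ) => ε (s + i) ω := by
    funext ω t
    simp only [linProcess, Function.comp_apply]
    congr 1
    funext r
    rw [Nat.cast_add, add_comm (t : ℤ), add_assoc]
  rw [e]
  exact h1.comp h2

variable [IsProbabilityMeasure μ] [BorelSpace B]

theorem ae_linProcess_eq (hε : IsInnovation μ ε) {h : ℕ → B →L[ℂ] B}
    (hs : Summable fun k => ‖h k‖) :
    ∀ᵐ ω ∂μ, ∀ t : ℤ, linProcess h ε t ω = ∑' k : ℕ, h k (ε (t - k) ω) := by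
  filter_upwards [hε.ae_tsum_ne_top hs] with ω hω t
  simp only [ofReal_norm] at hω
  have := hω t
  simp only [sub_eq_add_neg] at this ⊢
  rw [linProcess, linSeries, if_pos this]

variable [CompleteSpace B]

/-- L² norms of blocks of the series are bounded by tails of a convergent series; Fatou's lemma
carries the bound to the almost sure limit. -/
theorem isLinearSum_linProcess (hε : IsInnovation μ ε) {h : ℕ → B →L[ℂ] B}
    (hs : Summable fun k => ‖h k‖) (t : ℤ) : IsLinearSum μ ε h t (linProcess h ε t) := by
  set S : ℕ → Ω → B := fun n ω => ∑ k ∈ Finset.range n, h k (ε (t - k) ω) with hS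
  set b : ℕ → ENNReal := fun k => ENNReal.ofReal ‖h k‖ * eLpNorm (ε 0) 2 μ with hb
  have hterm : ∀ k, eLpNorm (fun ω => h k (ε (t - k) ω)) 2 μ ≤ b k := by
    intro k
    simp only [hb]
    rw [← hε.eLpNorm_eq 2 (t - k)]
    exact eLpNorm_le_mul_eLpNorm_of_ae_le_mul
      (Eventually.of_forall fun ω => (h k).le_opNorm _) 2
  have hbsum : ∑' k, b k ≠ ⊤ := by
    simp only [hb]
    rw [ENNReal.tsum_mul_right]
    exact ENNReal.mul_ne_top hs.tsum_ofReal_ne_top (hε.centered 0).memLp.2.ne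
  have hSm : ∀ n, AEStronglyMeasurable (S n) μ := fun n => (hε.memLp_sum h t n).1
  have hbound : ∀ n m, eLpNorm (fun ω => S (n + m) ω - S n ω) 2 μ ≤ ∑' k, b (k + n) := by
    intro n m
    have e : (fun ω => S (n + m) ω - S n ω) =
        ∑ k ∈ Finset.range m, fun ω => h (n + k) (ε (t - (n + k : ℕ)) ω) := by
      ext ω
      simp only [hS, Finset.sum_apply]
      rw [Finset.sum_range_add, add_sub_cancel_left]
    rw [e]
    refine (eLpNorm_sum_le (fun k _ => (hε.memLp_comp (h (n + k)) _).1) one_le_two).trans ?_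
    refine (Finset.sum_le_sum fun k _ => (hterm (n + k)).trans_eq ?_).trans
      (ENNReal.sum_le_tsum (f := fun k => b (k + n)) (Finset.range m))
    rw [add_comm]
  have hlim : ∀ᵐ ω ∂μ, Tendsto (fun n => S n ω) atTop (𝓝 (linProcess h ε t ω)) := by
    filter_upwards [ae_linProcess_eq hε hs, hε.ae_summable (fun k => norm_nonneg (h k)) hs]
      with ω h1 h2
    rw [h1 t]
    exact (summable_apply_of_summable_mul_norm (fun k => le_rfl) (h2 t)).hasSum.tendsto_sum_nat
  refine tendsto_of_tendsto_of_tendsto_of_le_of_le tendsto_const_nhds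
    (ENNReal.tendsto_sum_nat_add b hbsum) (fun _ => zero_le) fun n => ?_
  refine (Lp.eLpNorm_lim_le_liminf_eLpNorm (f := fun m ω => S (n + m) ω - S n ω)
    (fun m => (hSm _).sub (hSm _)) _ ?_).trans ?_
  · filter_upwards [hlim] with ω hω
    exact (hω.comp (tendsto_add_atTop_nat n |>.congr fun m => add_comm _ _)).sub_const _
  · exact liminf_le_of_le (by isBoundedDefault) fun c hc => by
      obtain ⟨m, hm⟩ := hc.exists
      exact hm.trans (hbound n m)

variable [SecondCountableTopology B]

/-- A random variable that is an `L²`-convergent linear sum of innovations is centered and square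
integrable. -/
theorem IsLinearSum.isCenteredL2 (hε : IsInnovation μ ε) {h : ℕ → B →L[ℂ] B} {t : ℤ} {Y : Ω → B}
    (hY : Measurable Y) (hl : IsLinearSum μ ε h t Y) : IsCenteredL2 μ Y := by
  have hYs : AEStronglyMeasurable Y μ := hY.aestronglyMeasurable
  have hS := fun n => hε.memLp_sum h t n
  refine ⟨hY, ?_, ?_⟩
  · obtain ⟨n, hn⟩ := (hl.eventually_lt_const ENNReal.zero_lt_top).exists
    have h1 : MemLp (fun ω => Y ω - ∑ k ∈ Finset.range n, h k (ε (t - k) ω)) 2 μ :=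
      ⟨hYs.sub (hS n).1, hn⟩
    have := h1.add (hS n)
    refine this.ae_eq (Eventually.of_forall fun ω => ?_)
    simp
  · refine tendsto_nhds_unique (tendsto_integral_of_L1 (l := atTop) Y hYs
      (F := fun n ω => ∑ k ∈ Finset.range n, h k (ε (t - k) ω))
      (Eventually.of_forall fun n => (hS n).integrable one_le_two) ?_) ?_
    · refine tendsto_of_tendsto_of_tendsto_of_le_of_le tendsto_const_nhds hl
        (fun _ => zero_le) fun n => ?_
      refine le_trans (le_of_eq ?_) (eLpNorm_le_eLpNorm_of_exponent_le (p := 1) one_le_two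
        (hYs.sub (hS n).1))
      rw [eLpNorm_one_eq_lintegral_enorm]
      exact lintegral_congr fun ω => enorm_sub_rev _ _
    · refine tendsto_const_nhds.congr fun n => ?_
      rw [integral_finsetSum _ fun k _ => (hε.memLp_comp (h k) _).integrable one_le_two]
      refine (Finset.sum_eq_zero fun k _ => ?_).symm
      rw [(h k).integral_comp_comm ((hε.centered _).memLp.integrable one_le_two),
        (hε.centered _).mean_zero, map_zero]

end LinearSeries

/-! ### Solving the companion recursion. -/

section Recursion

variable {B E : Type*} [NormedAddCommGroup B] [NormedSpace ℂ B] [NormedAddCommGroup E]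
  [NormedSpace ℂ E] {a Q : E →L[ℂ] E} (J : B →L[ℂ] E) {e : ℤ → B}

theorem IsNilProj.apply_mul (h : IsNilProj (1 - a) Q) (x : E) :
    a (((1 - a) * Q) x) = ((1 - a) * Q) x := by
  have := h.sq_apply x
  exact (sub_eq_zero.mp (show ((1 - a) * Q) x - a (((1 - a) * Q) x) = 0 from this)).symm

theorem apply_proj_eq (x : E) :
    a (Q x) = Q x - ((1 - a) * Q) x := by
  change a (Q x) = Q x - (Q x - a (Q x))
  rw [sub_sub_cancel]

/-- The stationary part of the companion recursion. -/
@[irreducible] def stationaryPart (a Q : E →L[ℂ] E) (J : B →L[ℂ] E) (e : ℤ → B) (t : ℤ) : E :=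
  ∑' k : ℕ, (a ^ k * (1 - Q)) (J (e (t - k)))

/-- The series defining the stationary part converges at all times. -/
def StationarySummable (a Q : E →L[ℂ] E) (J : B →L[ℂ] E) (e : ℤ → B) : Prop :=
  ∀ t : ℤ, Summable fun k : ℕ => (a ^ k * (1 - Q)) (J (e (t - k)))

theorem stationaryPart_recursion [CompleteSpace E] {t : ℤ}
    (hs : StationarySummable a Q J e) :
    stationaryPart a Q J e t =
      a (stationaryPart a Q J e (t - 1)) + (1 - Q) (J (e t)) := by
  rw [stationaryPart, (hs t).tsum_eq_zero_add, stationaryPart, a.map_tsum (hs (t - 1)), add_comm]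
  congr 1
  · refine tsum_congr fun k => ?_
    rw [pow_succ', mul_assoc, Nat.cast_succ, sub_sub, add_comm (1 : ℤ)]
    rfl
  · rw [pow_zero, one_mul, Nat.cast_zero, sub_zero]

theorem IsNilProj.proj_stationaryPart (h : IsNilProj (1 - a) Q) {t : ℤ}
    (hs : StationarySummable a Q J e) :
    Q (stationaryPart a Q J e t) = 0 := by
  rw [stationaryPart, Q.map_tsum (hs t)]
  refine (tsum_congr fun k => ?_).trans tsum_zero
  have hc := h.comm'
  rw [sub_sub_cancel] at hc
  have : Q * (a ^ k * (1 - Q)) = 0 := by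
    rw [← mul_assoc, ← ((show Commute a Q from hc).pow_left k).eq, mul_assoc, mul_sub, mul_one,
      h.idem, sub_self, mul_zero]
  exact congrArg (fun f : E →L[ℂ] E => f _) this

/-- The solution of the companion recursion, split into its nilpotent and its stationary part. -/
theorem IsNilProj.recursion_solution (h : IsNilProj (1 - a) Q) {X V : ℤ → E}
    (hX : ∀ t, 0 < t → X t = a (X (t - 1)) + J (e t))
    (hV : ∀ t, 0 < t → V t = a (V (t - 1)) + (1 - Q) (J (e t))) (hV0 : Q (V 0) = 0) (n : ℕ) :
    X n = Q (X 0) - (n : ℂ) • ((1 - a) * Q) (X 0) -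
      ((1 - a) * Q) (J (∑ s ∈ Finset.Icc 1 n, ∑ r ∈ Finset.Icc 1 s, e (r : ℤ))) +
      ((1 - a) * Q + Q) (J (∑ r ∈ Finset.Icc 1 n, e (r : ℤ))) + V n +
      (a ^ n * (1 - Q)) (X 0 - V 0) := by
  set N := (1 - a) * Q with hN
  -- These two rules drive the induction: each application of a to Q sheds one copy of N, which a
  -- then preserves, and this accumulates the linear trend and the double sum.
  have haN : ∀ x, a (N x) = N x := h.apply_mul
  have haQ : ∀ x, a (Q x) = Q x - N x := apply_proj_eq
  induction n with
  | zero =>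
    have : (1 - Q) (X 0 - V 0) = X 0 - V 0 - (Q (X 0) - Q (V 0)) := by
      rw [← map_sub]; rfl
    simp only [Nat.cast_zero, zero_smul, sub_zero, pow_zero, one_mul, this, hV0]
    simp only [Finset.Icc_eq_empty_of_lt zero_lt_one, Finset.sum_empty, map_zero]
    abel
  | succ n ih =>
    rw [hX _ (by positivity), hV _ (by positivity), Nat.cast_succ, add_sub_cancel_right, ih]
    have hI : ∀ f : ℕ → B, ∑ s ∈ Finset.Icc 1 (n + 1), f s =
        ∑ s ∈ Finset.Icc 1 n, f s + f (n + 1) := fun f => Finset.sum_Icc_succ_top (by omega) f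
    rw [hI fun s => ∑ r ∈ Finset.Icc 1 s, e (r : ℤ), hI fun r => e (r : ℤ)]
    set ξ := ∑ r ∈ Finset.Icc 1 n, e (r : ℤ)
    set Ξ := ∑ s ∈ Finset.Icc 1 n, ∑ r ∈ Finset.Icc 1 s, e (r : ℤ)
    generalize X 0 - V 0 = D
    have hp : a ((a ^ n * (1 - Q)) D) = (a ^ (n + 1) * (1 - Q)) D := by
      rw [pow_succ', mul_assoc]; rfl
    have h1 : (1 - Q) (J (e ((n : ℤ) + 1))) = J (e ((n : ℤ) + 1)) - Q (J (e ((n : ℤ) + 1))) := rfl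
    have h2 : ∀ x, (N + Q) x = N x + Q x := fun x => rfl
    simp only [map_add, map_sub, map_smul, haN, haQ, hp, h1, h2, Nat.cast_succ, add_smul, one_smul]
    abel

/-- The second difference of a solution of the companion recursion. -/
theorem second_difference {X : ℤ → E} {t : ℤ} (h1 : X t = a (X (t - 1)) + J (e t))
    (h2 : X (t - 1) = a (X (t - 2)) + J (e (t - 1))) :
    X t - (2 : ℂ) • X (t - 1) + X (t - 2) =
      J (e t) + (a - 2) (J (e (t - 1))) + ((1 - a) * (1 - a)) (X (t - 2)) := by
  have e1 : ∀ x, (a - 2) x = a x - (x + x) := fun x => by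
    rw [← one_add_one_eq_two]; rfl
  have e2 : ∀ x, ((1 - a) * (1 - a)) x = (x - a x) - a (x - a x) := fun x => rfl
  rw [h1, h2, e1, e2]
  simp only [map_add, map_sub, two_smul]
  abel

/-- A sequence with vanishing second differences that tends to zero vanishes. -/
theorem eq_zero_of_second_difference {u : ℕ → E}
    (h : ∀ n, u (n + 2) - (2 : ℂ) • u (n + 1) + u n = 0)
    (hu : Tendsto u atTop (𝓝 0)) (n : ℕ) : u n = 0 := by
  have hstep : ∀ n, u (n + 2) - u (n + 1) = u (n + 1) - u n := by
    intro n
    have := h n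
    rw [two_smul] at this
    rw [← sub_eq_zero, ← this]
    abel
  have hconst : ∀ n, u (n + 1) - u n = u 1 - u 0 := by
    intro n
    induction n with
    | zero => rfl
    | succ n ih => rw [← ih]; exact hstep n
  have hlim : Tendsto (fun n => u (n + 1) - u n) atTop (𝓝 0) := by
    simpa using (hu.comp (tendsto_add_atTop_nat 1)).sub hu
  simp only [hconst] at hlim
  have h0 : u 1 - u 0 = 0 := tendsto_nhds_unique tendsto_const_nhds hlim
  have hc : ∀ n, u n = u 0 := by
    intro n
    induction n with
    | zero => rfl
    | succ n ih => rw [← ih, ← sub_eq_zero, hconst, h0]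
  rw [hc n]
  refine tendsto_nhds_unique (tendsto_const_nhds.congr fun n => ?_) hu
  exact (hc n).symm

/-- Split aⁿ(1 - a) along Q: the part on ran Q is constant in n because a fixes (1 - a)Q, and the
other part decays. -/
theorem IsNilProj.tendsto_pow_mul (h : IsNilProj (1 - a) Q) {c ρ : ℝ} (hρ0 : 0 ≤ ρ) (hρ1 : ρ < 1)
    (hd : ∀ n : ℕ, ‖a ^ n * (1 - Q)‖ ≤ c * ρ ^ n) :
    Tendsto (fun n => a ^ n * (1 - a)) atTop (𝓝 ((1 - a) * Q)) := by
  have hz : Tendsto (fun n => a ^ n * (1 - Q)) atTop (𝓝 0) := by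
    refine squeeze_zero_norm hd ?_
    simpa using (tendsto_pow_atTop_nhds_zero_of_lt_one hρ0 hρ1).const_mul c
  have h1 := (hz.mul_const (1 - a)).const_add ((1 - a) * Q)
  rw [zero_mul, add_zero] at h1
  refine h1.congr fun n => ?_
  have e1 : a ^ n * ((1 - a) * Q) = (1 - a) * Q := by
    induction n with
    | zero => rw [pow_zero, one_mul]
    | succ n ih =>
      rw [pow_succ, mul_assoc, show a * ((1 - a) * Q) = (1 - a) * Q from
        ContinuousLinearMap.ext h.apply_mul, ih]
  have e2 : a ^ n * (1 - Q) * (1 - a) = a ^ n * (1 - a) - a ^ n * ((1 - a) * Q) := by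
    rw [h.comm, mul_assoc, ← mul_sub, sub_mul, one_mul]
  rw [e2, e1, add_sub_cancel]

/-- The sum `∑ aᵏ Q J e_{t-k}` over the indices with `s < t - k`. -/
@[irreducible] def nilpotentPart (a Q : E →L[ℂ] E) (J : B →L[ℂ] E) (e : ℤ → B) (s t : ℤ) : E :=
  ∑ k ∈ Finset.range (t - s).toNat, (a ^ k * Q) (J (e (t - k)))

theorem nilpotentPart_recursion {s t : ℤ} (hst : s < t) :
    nilpotentPart a Q J e s t = a (nilpotentPart a Q J e s (t - 1)) + Q (J (e t)) := by
  obtain ⟨n, hn⟩ : ∃ n : ℕ, t - s = n + 1 := ⟨(t - s - 1).toNat, by omega⟩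
  have h1 : (t - s).toNat = n + 1 := by omega
  have h2 : (t - 1 - s).toNat = n := by omega
  rw [nilpotentPart, nilpotentPart, h1, h2, Finset.sum_range_succ', map_sum]
  congr 1
  · refine Finset.sum_congr rfl fun k _ => ?_
    rw [pow_succ', mul_assoc, Nat.cast_succ, sub_sub, add_comm (1 : ℤ)]
    rfl
  · rw [pow_zero, one_mul, Nat.cast_zero, sub_zero]

end Recursion

/-! ### Bounds for second differences and filter coefficients. -/

theorem memLp_secondDifference {Ω : Type*} [MeasurableSpace Ω] {μ : Measure Ω} {B : Type*}
    [NormedAddCommGroup B] [NormedSpace ℂ B] {X₀ X₁ X₂ : Ω → B} (h₀ : MemLp X₀ 2 μ)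
    (h₁ : MemLp X₁ 2 μ) (h₂ : MemLp X₂ 2 μ) : MemLp (fun ω => X₀ ω - (2 : ℂ) • X₁ ω + X₂ ω) 2 μ :=
  (h₀.sub (h₁.const_smul (2 : ℂ))).add h₂

theorem norm_comp_comp_le {F G H K : Type*} [NormedAddCommGroup F] [NormedSpace ℂ F]
    [NormedAddCommGroup G] [NormedSpace ℂ G] [NormedAddCommGroup H] [NormedSpace ℂ H]
    [NormedAddCommGroup K] [NormedSpace ℂ K] (L : H →L[ℂ] K) (X : G →L[ℂ] H) (J : F →L[ℂ] G) :
    ‖L ∘L X ∘L J‖ ≤ ‖L‖ * ‖X‖ * ‖J‖ := by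
  rw [mul_assoc]
  exact (L.opNorm_comp_le _).trans
    (mul_le_mul_of_nonneg_left (X.opNorm_comp_le J) (norm_nonneg L))

/-- Since Q(1 - a)² = 0, a factor 1 - Q can be inserted and the decay estimate applies. -/
theorem IsNilProj.norm_pow_mul_sq_le {E : Type*} [NormedAddCommGroup E] [NormedSpace ℂ E]
    {a Q : E →L[ℂ] E} (h : IsNilProj (1 - a) Q) {c ρ : ℝ}
    (hd : ∀ n : ℕ, ‖a ^ n * (1 - Q)‖ ≤ c * ρ ^ n) (n : ℕ) :
    ‖a ^ n * ((1 - a) * (1 - a))‖ ≤ c * ρ ^ n * ‖(1 - a) * (1 - a)‖ := by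
  have e : a ^ n * ((1 - a) * (1 - a)) = a ^ n * (1 - Q) * ((1 - a) * (1 - a)) := by
    have h1 : Q * ((1 - a) * (1 - a)) = 0 := by
      rw [← mul_assoc, ← h.comm, mul_assoc, ← h.comm, ← mul_assoc, h.sq]
    calc a ^ n * ((1 - a) * (1 - a))
        = a ^ n * ((1 - a) * (1 - a) - Q * ((1 - a) * (1 - a))) := by rw [h1, sub_zero]
      _ = a ^ n * (1 - Q) * ((1 - a) * (1 - a)) := by
        rw [mul_assoc, sub_mul 1 Q ((1 - a) * (1 - a)), one_mul]
  rw [e]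
  exact (norm_mul_le _ _).trans (mul_le_mul_of_nonneg_right (hd n) (norm_nonneg _))

theorem IsNilProj.exists_diffImpulse_le {B : Type*} [NormedAddCommGroup B] [NormedSpace ℂ B]
    {p : ℕ} [NeZero p] {A : Fin p → B →L[ℂ] B} {Q : ProdSpace B p →L[ℂ] ProdSpace B p}
    (h : IsNilProj (1 - companion p A) Q) {c ρ : ℝ}
    (hd : ∀ n : ℕ, ‖companion p A ^ n * (1 - Q)‖ ≤ c * ρ ^ n) :
    ∃ K : ℝ, ∀ n, ‖diffImpulse A (n + 2)‖ ≤ K * ρ ^ n := by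
  refine ⟨‖(coordProj p : ProdSpace B p →L[ℂ] B)‖ *
    (c * ‖(1 - companion p A) * (1 - companion p A)‖) *
    ‖(coordEmb p : B →L[ℂ] ProdSpace B p)‖, fun n => ?_⟩
  refine (norm_comp_comp_le _ _ _).trans ?_
  rw [mul_right_comm _ _ (ρ ^ n)]
  refine mul_le_mul_of_nonneg_right ?_ (norm_nonneg _)
  rw [mul_assoc ‖_‖]
  refine mul_le_mul_of_nonneg_left ?_ (norm_nonneg _)
  rw [mul_right_comm]
  exact h.norm_pow_mul_sq_le hd n

theorem summable_norm_corner {B E : Type*} [NormedAddCommGroup B] [NormedSpace ℂ B]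
    [NormedAddCommGroup E] [NormedSpace ℂ E] {a Q : E →L[ℂ] E} {c ρ : ℝ} (hρ0 : 0 ≤ ρ)
    (hρ1 : ρ < 1) (hd : ∀ n : ℕ, ‖a ^ n * (1 - Q)‖ ≤ c * ρ ^ n) (J : B →L[ℂ] E) (L : E →L[ℂ] B) :
    Summable fun k => ‖L ∘L (a ^ k * (1 - Q)) ∘L J‖ := by
  refine Summable.of_nonneg_of_le (fun k => norm_nonneg _) (fun k => ?_)
    (((summable_geometric_of_lt_one hρ0 hρ1).mul_left c).mul_left ‖L‖ |>.mul_right ‖J‖)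
  exact (norm_comp_comp_le _ _ _).trans (mul_le_mul_of_nonneg_right
    (mul_le_mul_of_nonneg_left (hd k) (norm_nonneg _)) (norm_nonneg _))

/-! ### Coefficients of I(2) solutions and necessity of the I(2) condition. -/

section AutoregressiveProcesses

variable {Ω : Type*} [MeasurableSpace Ω] {μ : Measure Ω}
  {B : Type*} [NormedAddCommGroup B] [NormedSpace ℂ B] [MeasurableSpace B]
  {p : ℕ} {A : Fin p → B →L[ℂ] B} {ε X : ℤ → Ω → B}

theorem IsARSolution.ae_law (hX : IsARSolution μ A ε X) :
    ∀ᵐ ω ∂μ, ∀ t : ℤ, 1 ≤ t →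
      X t ω - ∑ j : Fin p, A j (X (t - ((j.val : ℤ) + 1)) ω) = ε t ω := by
  rw [ae_all_iff]
  intro t
  by_cases ht : 1 ≤ t
  · filter_upwards [hX.law t ht] with ω hω _
    exact hω
  · exact Eventually.of_forall fun ω h => absurd h ht

theorem IsLinearSum.secondDifference_innovation (hε : IsInnovation μ ε) (t : ℤ) :
    IsLinearSum μ ε (fun k => diffCoeff (k : ℤ) • 1) t
      (fun ω => ε t ω - (2 : ℂ) • ε (t - 1) ω + ε (t - 2) ω) := by
  have hm := fun s => (hε.centered s).memLp.1
  have h0 := IsLinearSum.single (μ := μ) (ε := ε) t 1 0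
  have h1 := IsLinearSum.single (μ := μ) (ε := ε) t 2 1
  have h2 := IsLinearSum.single (μ := μ) (ε := ε) t (-1) 2
  have h := IsLinearSum.sub hε (((hm _).const_smul (1 : ℂ)).sub ((hm _).const_smul (2 : ℂ)))
    ((hm _).const_smul (-1 : ℂ))
    (IsLinearSum.sub hε ((hm _).const_smul (1 : ℂ)) ((hm _).const_smul (2 : ℂ)) h0 h1) h2
  convert h using 1
  · funext k
    rcases k with _ | _ | _ | k
    · simp [diffCoeff]
    · simp [diffCoeff]
    · simp [diffCoeff]
    · rw [diffCoeff, if_neg (by omega), if_neg (by omega), if_neg (by omega), zero_smul,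
        if_neg (by omega), if_neg (by omega), if_neg (by omega)]
      simp
  · funext ω
    simp

variable [IsProbabilityMeasure μ] [BorelSpace B] [CompleteSpace B]

/-- The coefficients of the second differences of an autoregressive process satisfy the
autoregressive recursion. -/
theorem IsARSolution.coeff_recursion (hε : IsInnovation μ ε) (hX : IsARSolution μ A ε X)
    {C : ℕ → B →L[ℂ] B}
    (hC : ∀ t : ℤ, 1 ≤ t →
      IsLinearSum μ ε C t (fun ω => X t ω - (2 : ℂ) • X (t - 1) ω + X (t - 2) ω)) (k : ℕ) :
    C k - ∑ j : Fin p, A j ∘L zeroExtend C ((k : ℤ) - ((j.val : ℤ) + 1)) =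
      diffCoeff k • 1 := by
  -- A time late enough that `hC` applies at every lag down to t - p and the autoregressive law
  -- holds at t, t - 1 and t - 2.
  set t : ℤ := p + 3 with ht
  set Y : ℤ → Ω → B := fun s ω => X s ω - (2 : ℂ) • X (s - 1) ω + X (s - 2) ω with hY
  have hYm : ∀ s : ℤ, 1 ≤ s + p - 2 → AEStronglyMeasurable (Y s) μ := fun s hs =>
    (memLp_secondDifference (hX.centered s (by omega)).memLp
      (hX.centered (s - 1) (by omega)).memLp (hX.centered (s - 2) (by omega)).memLp).1
  have hYjm : ∀ j : Fin p, AEStronglyMeasurable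
      (fun ω => A j (Y (t - ((j.val : ℤ) + 1)) ω)) μ := fun j =>
    (A j).continuous.comp_aestronglyMeasurable (hYm _ (by have := j.isLt; omega))
  have h1 : ∀ j : Fin p, IsLinearSum μ ε
      (fun k => A j ∘L zeroExtend C ((k : ℤ) - ((j.val : ℤ) + 1))) t
      (fun ω => A j (Y (t - ((j.val : ℤ) + 1)) ω)) := by
    intro j
    have hj := j.isLt
    have h := IsLinearSum.shift (μ := μ) (ε := ε) (t := t) (j.val + 1)
      (by rw [Nat.cast_add, Nat.cast_one]; exact hC (t - ((j.val : ℤ) + 1)) (by omega))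
    rw [Nat.cast_add, Nat.cast_one] at h
    exact h.comp (A j)
  have h2 := IsLinearSum.sum hε hYjm h1 Finset.univ
  have hsm := Finset.aestronglyMeasurable_fun_sum Finset.univ fun j _ => hYjm j
  have h3 := IsLinearSum.sub hε (hYm t (by omega)) hsm (hC t (by omega)) h2
  have hεm : AEStronglyMeasurable (fun ω => ε t ω - (2 : ℂ) • ε (t - 1) ω + ε (t - 2) ω) μ :=
    (memLp_secondDifference (hε.centered _).memLp (hε.centered _).memLp (hε.centered _).memLp).1
  have h4 := IsLinearSum.sub hε ((hYm t (by omega)).sub hsm) hεm h3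
    (IsLinearSum.secondDifference_innovation hε t)
  have h5 : (fun ω => (Y t ω - ∑ j : Fin p, A j (Y (t - ((j.val : ℤ) + 1)) ω)) -
      (ε t ω - (2 : ℂ) • ε (t - 1) ω + ε (t - 2) ω)) =ᵐ[μ] fun _ => 0 := by
    filter_upwards [hX.ae_law] with ω hω
    rw [← hω t (by omega), ← hω (t - 1) (by omega), ← hω (t - 2) (by omega)]
    simp only [hY, map_add, map_sub, map_smul, Finset.sum_add_distrib, Finset.sum_sub_distrib,
      smul_sub, Finset.smul_sum, sub_right_comm t]
    abel
  exact sub_eq_zero.mp (IsLinearSum.coeff_eq_zero hε (h4.congr_ae h5) k)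

variable [NeZero p]

theorem IsARSolution.coeff_eq (hε : IsInnovation μ ε) (hX : IsARSolution μ A ε X)
    {C : ℕ → B →L[ℂ] B}
    (hC : ∀ t : ℤ, 1 ≤ t →
      IsLinearSum μ ε C t (fun ω => X t ω - (2 : ℂ) • X (t - 1) ω + X (t - 2) ω)) :
    C = diffImpulse A :=
  coeff_of_filter_eq A (hX.coeff_recursion hε hC)

/-- The existence of an I(2) solution implies the I(2) condition. -/
theorem I2Condition_of_isI2 (hε : IsInnovation μ ε) (hX : IsARSolution μ A ε X)
    (hI : IsI2 μ ε X) {rC kC : Submodule ℂ (ProdSpace B p)}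
    (hr : IsInternalDirectSum ⊤ (LinearMap.range (1 - companion p A).toLinearMap) rC)
    (hk : IsInternalDirectSum ⊤ (LinearMap.ker (1 - companion p A).toLinearMap) kC) :
    I2Condition (1 - companion p A).toLinearMap hr hk := by
  obtain ⟨C, -, ⟨S, hS0, hS⟩, hC⟩ := hI.exists_coeff
  rw [hX.coeff_eq hε hC] at hS
  have h1 := (hS.comp (tendsto_add_atTop_nat 2)).neg
  obtain ⟨M, hM, hMS⟩ := exists_tendsto_of_corner A (S := -S) (h1.congr fun n => by
    rw [Function.comp_apply, sum_range_diffImpulse, neg_neg])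
  refine I2Condition_of_tendsto hr hk hM ?_
  rintro rfl
  apply hS0
  rw [← neg_eq_zero, ← hMS]
  ext x
  simp

end AutoregressiveProcesses

theorem lagVec_zero {Ω B : Type*} {p : ℕ} (X : ℤ → Ω → B) (ω : Ω) :
    lagVec p (fun s => X s ω) 0 = initialVec p X ω := by
  ext i
  change X (0 - (i.val : ℤ)) ω = X (-(i.val : ℤ)) ω
  rw [zero_sub]

/-! ### The representation with its transient term. -/

section AutoregressiveProcesses

variable {Ω : Type*} [MeasurableSpace Ω] {μ : Measure Ω}
  {B : Type*} [NormedAddCommGroup B] [NormedSpace ℂ B] [MeasurableSpace B]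
  {p : ℕ} {A : Fin p → B →L[ℂ] B} {ε X : ℤ → Ω → B}
variable [IsProbabilityMeasure μ] [BorelSpace B]
section Representation

variable {E : Type*} [NormedAddCommGroup E] [NormedSpace ℂ E] [CompleteSpace E] {a Q : E →L[ℂ] E}
  {c ρ : ℝ}

theorem IsInnovation.ae_summable_stationaryPart (hε : IsInnovation μ ε) (hc : 0 ≤ c) (hρ0 : 0 ≤ ρ)
    (hρ1 : ρ < 1) (hd : ∀ n : ℕ, ‖a ^ n * (1 - Q)‖ ≤ c * ρ ^ n) (J : B →L[ℂ] E) :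
    ∀ᵐ ω ∂μ, StationarySummable a Q J fun s => ε s ω := by
  have hus : Summable fun k => c * ρ ^ k * ‖J‖ :=
    ((summable_geometric_of_lt_one hρ0 hρ1).mul_left c).mul_right _
  have hu0 : ∀ k, 0 ≤ c * ρ ^ k * ‖J‖ := fun k =>
    mul_nonneg (mul_nonneg hc (pow_nonneg hρ0 k)) (norm_nonneg J)
  have hu : ∀ k, ‖(a ^ k * (1 - Q)) ∘L J‖ ≤ c * ρ ^ k * ‖J‖ := fun k =>
    (ContinuousLinearMap.opNorm_comp_le _ _).trans
      (mul_le_mul_of_nonneg_right (hd k) (norm_nonneg _))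
  exact (hε.ae_summable hu0 hus).mono fun ω hω t => summable_apply_of_summable_mul_norm hu (hω t)

theorem ae_linProcess_corner (hε : IsInnovation μ ε) (hc : 0 ≤ c) (hρ0 : 0 ≤ ρ)
    (hρ1 : ρ < 1) (hd : ∀ n : ℕ, ‖a ^ n * (1 - Q)‖ ≤ c * ρ ^ n) (J : B →L[ℂ] E) (L : E →L[ℂ] B) :
    ∀ᵐ ω ∂μ, ∀ t : ℤ, linProcess (fun k => L ∘L (a ^ k * (1 - Q)) ∘L J) ε t ω =
        L (stationaryPart a Q J (fun s => ε s ω) t) := by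
  filter_upwards [ae_linProcess_eq hε (summable_norm_corner hρ0 hρ1 hd J L),
    hε.ae_summable_stationaryPart hc hρ0 hρ1 hd J] with ω h1 h2 t
  rw [h1 t, stationaryPart, L.map_tsum (h2 t)]
  rfl

/-- An autoregressive sequence as the sum of the I(2) representation and a transient term. -/
theorem IsNilProj.autoregression_representation {B : Type*} [NormedAddCommGroup B]
    [NormedSpace ℂ B] [CompleteSpace B] {p : ℕ} [NeZero p] {A : Fin p → B →L[ℂ] B}
    {Q : ProdSpace B p →L[ℂ] ProdSpace B p} (h : IsNilProj (1 - companion p A) Q) {x e : ℤ → B}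
    (hx : ∀ t : ℤ, 1 ≤ t → x t - ∑ j : Fin p, A j (x (t - ((j.val : ℤ) + 1))) = e t)
    (hs : StationarySummable (companion p A) Q (coordEmb p) e) (n : ℕ) :
    x n = coordProj p (Q (lagVec p x 0)) +
      (n : ℂ) • (-(coordProj p ∘L ((1 - companion p A) * Q))) (lagVec p x 0) -
      coordProj p (((1 - companion p A) * Q) (coordEmb p
        (∑ s ∈ Finset.Icc 1 n, ∑ r ∈ Finset.Icc 1 s, e (r : ℤ)))) +
      coordProj p (((1 - companion p A) * Q + Q) (coordEmb p (∑ r ∈ Finset.Icc 1 n, e (r : ℤ)))) +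
      coordProj p (stationaryPart (companion p A) Q (coordEmb p) e n) +
      coordProj p ((companion p A ^ n * (1 - Q)) (lagVec p x 0 -
        stationaryPart (companion p A) Q (coordEmb p) e 0)) := by
  have hrec := IsNilProj.recursion_solution (E := ProdSpace B p) (a := companion p A) (Q := Q)
    (coordEmb p) (e := e) (X := lagVec p x)
    (V := stationaryPart (companion p A) Q (coordEmb p) e) h
    (fun t ht => lagVec_eq A (hx t ht))
    (fun t _ => stationaryPart_recursion (E := ProdSpace B p) (a := companion p A) (Q := Q)
      (e := e) (coordEmb p) hs)
    (IsNilProj.proj_stationaryPart (E := ProdSpace B p) (a := companion p A) (Q := Q)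
      (e := e) (coordEmb p) h hs) n
  rw [← coordProj_lagVec (p := p) x n, hrec, map_add, map_add, map_add, map_sub, map_sub,
    map_smul, neg_apply, ContinuousLinearMap.comp_apply, smul_neg,
    ← sub_eq_add_neg]

variable [CompleteSpace B] [NeZero p]

/-- The autoregressive process as the sum of the I(2) representation and a transient term. -/
theorem IsARSolution.ae_eq_representation {Q : ProdSpace B p →L[ℂ] ProdSpace B p}
    (hX : IsARSolution μ A ε X) (hε : IsInnovation μ ε)
    (h : IsNilProj (1 - companion p A) Q) (hc : 0 ≤ c) (hρ0 : 0 ≤ ρ)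
    (hρ1 : ρ < 1) (hd : ∀ n : ℕ, ‖companion p A ^ n * (1 - Q)‖ ≤ c * ρ ^ n) :
    ∀ᵐ ω ∂μ, ∀ n : ℕ, X n ω =
      i2Representation (fun ω => (coordProj p ∘L Q) (initialVec p X ω))
        (fun ω => (-(coordProj p ∘L ((1 - companion p A) * Q))) (initialVec p X ω))
        (coordProj p ∘L ((1 - companion p A) * Q) ∘L coordEmb p)
        (coordProj p ∘L ((1 - companion p A) * Q + Q) ∘L coordEmb p) ε
        (fun t : ℕ => linProcess
          (fun k => coordProj p ∘L (companion p A ^ k * (1 - Q)) ∘L coordEmb p) ε t) n ω +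
      coordProj p ((companion p A ^ n * (1 - Q)) (initialVec p X ω -
        stationaryPart (companion p A) Q (coordEmb p) (fun s => ε s ω) 0)) := by
  filter_upwards [hX.ae_law, hε.ae_summable_stationaryPart hc hρ0 hρ1 hd (coordEmb p),
    ae_linProcess_corner hε hc hρ0 hρ1 hd (coordEmb p) (coordProj p)] with ω h1 h2 h3 n
  rw [h.autoregression_representation (x := fun s => X s ω) (e := fun s => ε s ω) h1 h2 n,
    lagVec_zero, i2Representation, h3 n]
  rfl

end Representation

end AutoregressiveProcesses

/-! ### Second differences and removal of the transient. -/

section SecondDifferences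

variable {B E : Type*} [NormedAddCommGroup B] [NormedSpace ℂ B] [NormedAddCommGroup E]
  [NormedSpace ℂ E] {a Q : E →L[ℂ] E} {J : B →L[ℂ] E} {e : ℤ → B}

theorem IsNilProj.sq_mul_pow_mul (h : IsNilProj (1 - a) Q) (k : ℕ) :
    (1 - a) * (1 - a) * (a ^ k * (1 - Q)) = a ^ k * ((1 - a) * (1 - a)) := by
  have hc : Commute ((1 - a) * (1 - a)) (a ^ k) := by
    have h1 : Commute (1 - a) a := (Commute.one_left a).sub_left (Commute.refl a)
    exact (h1.mul_left h1).pow_right k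
  rw [← mul_assoc, hc.eq, mul_assoc, mul_sub, mul_one, h.sq, sub_zero]

/-- From the third term on, `sq_mul_pow_mul` rewrites the coefficients as (1 - a)² aᵏ(1 - Q), so the
tail is (1 - a)² applied to the stationary part two steps earlier. -/
theorem IsNilProj.hasSum_secondDifference (h : IsNilProj (1 - a) Q)
    (hs : StationarySummable a Q J e) (L : E →L[ℂ] B) {φ : ℕ → B →L[ℂ] B}
    (hφ : ∀ n, φ (n + 2) = L ∘L (a ^ n * ((1 - a) * (1 - a))) ∘L J) (t : ℤ) :
    HasSum (fun k : ℕ => φ k (e (t - k)))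
      (φ 0 (e t) + φ 1 (e (t - 1)) +
        L (((1 - a) * (1 - a)) (stationaryPart a Q J e (t - 2)))) := by
  have h1 := (hs (t - 2)).hasSum.mapL (L ∘L ((1 - a) * (1 - a)))
  have h2 : HasSum (fun n : ℕ => φ (n + 2) (e (t - ((n + 2 : ℕ) : ℤ))))
      (L (((1 - a) * (1 - a)) (stationaryPart a Q J e (t - 2)))) := by
    rw [stationaryPart]
    refine h1.congr_fun fun n => ?_
    rw [hφ, ← h.sq_mul_pow_mul, Nat.cast_add, Nat.cast_two, sub_sub, add_comm (2 : ℤ)]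
    rfl
  have h3 := (hasSum_nat_add_iff (f := fun k : ℕ => φ k (e (t - k))) 2).mp h2
  rw [Finset.sum_range_succ, Finset.sum_range_one, Nat.cast_zero, sub_zero, Nat.cast_one,
    add_comm] at h3
  exact h3

/-- The transient term vanishes if the second differences do not depend on it. -/
theorem IsNilProj.transient_eq_zero (h : IsNilProj (1 - a) Q) (L : E →L[ℂ] B) {X V : ℤ → E}
    (hX : ∀ t, 0 < t → X t = a (X (t - 1)) + J (e t))
    (hV : ∀ t, 0 < t → V t = a (V (t - 1)) + (1 - Q) (J (e t)))
    (hΔ : ∀ n : ℕ, L (((1 - a) * (1 - a)) (X n)) = L (((1 - a) * (1 - a)) (V n)))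
    {c ρ : ℝ} (hρ0 : 0 ≤ ρ) (hρ1 : ρ < 1) (hd : ∀ n : ℕ, ‖a ^ n * (1 - Q)‖ ≤ c * ρ ^ n) (n : ℕ) :
    L ((a ^ n * (1 - Q)) (X 0 - V 0)) = 0 := by
  set D := X 0 - V 0 with hD
  have hcomm : Commute ((1 - a) * (1 - a)) a := by
    have h1 : Commute (1 - a) a := (Commute.one_left a).sub_left (Commute.refl a)
    exact h1.mul_left h1
  -- X - V is driven by inputs in ran Q, which (1 - a)² annihilates, so only the initial difference
  -- D survives.
  have hdiff : ∀ n : ℕ, ((1 - a) * (1 - a)) (X n - V n) = (a ^ n * ((1 - a) * (1 - a))) D := by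
    intro n
    induction n with
    | zero => rw [pow_zero, one_mul]; rfl
    | succ n ih =>
      have e1 : X ((n + 1 : ℕ) : ℤ) - V ((n + 1 : ℕ) : ℤ) =
          a (X n - V n) + Q (J (e ((n + 1 : ℕ) : ℤ))) := by
        rw [hX _ (by positivity), hV _ (by positivity), Nat.cast_succ, add_sub_cancel_right,
          map_sub, sub_apply, one_apply_eq_self]
        abel
      have e2 : ((1 - a) * (1 - a)) (Q (J (e ((n + 1 : ℕ) : ℤ)))) = 0 :=
        congrArg (fun f : E →L[ℂ] E => f (J (e ((n + 1 : ℕ) : ℤ)))) h.sq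
      have e3 : ((1 - a) * (1 - a)) (a (X n - V n)) = a (((1 - a) * (1 - a)) (X n - V n)) :=
        congrArg (fun f : E →L[ℂ] E => f (X n - V n)) hcomm.eq
      rw [e1, map_add, e2, e3, add_zero, ih, pow_succ']
      rfl
  -- The second difference of aⁿ(1 - Q)D is aⁿ(1 - a)²D, whose image under L vanishes by `hdiff` and
  -- `hΔ`; the transient also tends to zero.
  refine eq_zero_of_second_difference (u := fun n => L ((a ^ n * (1 - Q)) D)) (fun n => ?_) ?_ n
  · have e1 : (a ^ (n + 2) * (1 - Q)) D - (2 : ℂ) • (a ^ (n + 1) * (1 - Q)) D +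
        (a ^ n * (1 - Q)) D = (a ^ n * ((1 - a) * (1 - a))) D := by
      have : a ^ (n + 2) * (1 - Q) - (2 : ℂ) • (a ^ (n + 1) * (1 - Q)) + a ^ n * (1 - Q) =
          a ^ n * ((1 - a) * (1 - a)) := by
        rw [← h.sq_mul_pow_mul, two_smul, pow_succ' a (n + 1), pow_succ' a n]
        noncomm_ring
      rw [← this]
      rfl
    have e2 := congrArg L e1
    rw [map_add, map_sub, map_smul] at e2
    rw [e2, ← hdiff, map_sub, map_sub, hΔ n, sub_self]
  · have hz : Tendsto (fun n : ℕ => a ^ n * (1 - Q)) atTop (𝓝 0) := by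
      refine squeeze_zero_norm hd ?_
      simpa using (tendsto_pow_atTop_nhds_zero_of_lt_one hρ0 hρ1).const_mul c
    have hc : Continuous fun f : E →L[ℂ] E => L (f D) :=
      L.continuous.comp (ContinuousLinearMap.apply ℂ E D).continuous
    have h1 := (hc.tendsto 0).comp hz
    rw [zero_apply, map_zero] at h1
    exact h1

theorem IsNilProj.sq_nilpotentPart (h : IsNilProj (1 - a) Q) (s t : ℤ) :
    ((1 - a) * (1 - a)) (nilpotentPart a Q J e s t) = 0 := by
  rw [nilpotentPart, map_sum]
  refine Finset.sum_eq_zero fun k _ => ?_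
  have hc : Commute ((1 - a) * (1 - a)) (a ^ k) := by
    have h1 : Commute (1 - a) a := (Commute.one_left a).sub_left (Commute.refl a)
    exact (h1.mul_left h1).pow_right k
  have : (1 - a) * (1 - a) * (a ^ k * Q) = 0 := by
    rw [← mul_assoc, hc.eq, mul_assoc, h.sq, mul_zero]
  exact congrArg (fun f : E →L[ℂ] E => f (J (e (t - k)))) this

theorem stationaryPart_add_nilpotentPart_recursion [CompleteSpace E]
    (hs : StationarySummable a Q J e) {s t : ℤ} (hst : s < t) :
    stationaryPart a Q J e t + nilpotentPart a Q J e s t =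
      a (stationaryPart a Q J e (t - 1) + nilpotentPart a Q J e s (t - 1)) + J (e t) := by
  rw [stationaryPart_recursion J hs, nilpotentPart_recursion J hst, map_add, sub_apply,
    one_apply_eq_self]
  abel

/-- The second difference of the solution of the companion recursion with trivial nilpotent part
up to time `s`. -/
theorem IsNilProj.second_difference_solution [CompleteSpace E] (h : IsNilProj (1 - a) Q)
    (hs : StationarySummable a Q J e) {s t : ℤ} (hst : s + 1 < t) {W : ℤ → E}
    (hW : ∀ t, W t = stationaryPart a Q J e t + nilpotentPart a Q J e s t) :
    W t - (2 : ℂ) • W (t - 1) + W (t - 2) = J (e t) + (a - 2) (J (e (t - 1))) +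
      ((1 - a) * (1 - a)) (stationaryPart a Q J e (t - 2)) := by
  have hrec : ∀ t, s < t → W t = a (W (t - 1)) + J (e t) := fun t ht => by
    rw [hW, hW, stationaryPart_add_nilpotentPart_recursion hs ht]
  have h2 := hrec (t - 1) (by omega)
  rw [sub_sub, one_add_one_eq_two] at h2
  rw [second_difference J (hrec t (by omega)) h2, hW (t - 2), map_add, h.sq_nilpotentPart, add_zero]

end SecondDifferences

/-! ### Properties of the filter coefficients under the spectral splitting. -/

section Companion

variable {B : Type*} [NormedAddCommGroup B] [NormedSpace ℂ B] {p : ℕ} [NeZero p]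
  {A : Fin p → B →L[ℂ] B} {Q : ProdSpace B p →L[ℂ] ProdSpace B p} {e : ℤ → B} {c ρ : ℝ}

theorem coordProj_coordEmb (x : B) : coordProj p (coordEmb p x) = x := by
  change (Pi.single (0 : Fin p) x : Fin p → B) 0 = x
  rw [Pi.single_eq_same]

theorem IsNilProj.summable_norm_diffImpulse (h : IsNilProj (1 - companion p A) Q) (hρ0 : 0 ≤ ρ)
    (hρ1 : ρ < 1) (hd : ∀ n : ℕ, ‖companion p A ^ n * (1 - Q)‖ ≤ c * ρ ^ n) :
    Summable fun k => ‖diffImpulse A k‖ := by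
  obtain ⟨K, hK⟩ := h.exists_diffImpulse_le hd
  exact (summable_nat_add_iff 2).mp (Summable.of_nonneg_of_le (fun k => norm_nonneg _) hK
    ((summable_geometric_of_lt_one hρ0 hρ1).mul_left K))

theorem IsNilProj.summable_mul_norm_sq_diffImpulse (h : IsNilProj (1 - companion p A) Q)
    (hρ0 : 0 ≤ ρ) (hρ1 : ρ < 1) (hd : ∀ n : ℕ, ‖companion p A ^ n * (1 - Q)‖ ≤ c * ρ ^ n) :
    Summable fun k : ℕ => (k : ℝ) * ‖diffImpulse A k‖ ^ 2 := by
  obtain ⟨K, hK⟩ := h.exists_diffImpulse_le hd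
  have hρ2 : ‖ρ ^ 2‖ < 1 := by
    rw [Real.norm_of_nonneg (pow_nonneg hρ0 2)]
    exact pow_lt_one₀ hρ0 hρ1 two_ne_zero
  have h1 : Summable fun n : ℕ => (n : ℝ) * (ρ ^ 2) ^ n := by
    simpa using summable_pow_mul_geometric_of_norm_lt_one 1 hρ2
  have h2 : Summable fun n : ℕ => 2 * (ρ ^ 2) ^ n :=
    (summable_geometric_of_norm_lt_one hρ2).mul_left 2
  refine (summable_nat_add_iff 2).mp (Summable.of_nonneg_of_le (fun k => by positivity)
    (fun n => ?_) ((h1.add h2).mul_left (K ^ 2)))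
  have h3 : ‖diffImpulse A (n + 2)‖ ^ 2 ≤ (K * ρ ^ n) ^ 2 :=
    pow_le_pow_left₀ (norm_nonneg _) (hK n) 2
  refine (mul_le_mul_of_nonneg_left h3 (Nat.cast_nonneg _)).trans_eq ?_
  push_cast
  ring

theorem IsNilProj.tendsto_sum_diffImpulse (h : IsNilProj (1 - companion p A) Q) (hρ0 : 0 ≤ ρ)
    (hρ1 : ρ < 1) (hd : ∀ n : ℕ, ‖companion p A ^ n * (1 - Q)‖ ≤ c * ρ ^ n) :
    Tendsto (fun n => ∑ k ∈ Finset.range n, diffImpulse A k) atTop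
      (𝓝 (-(coordProj p ∘L ((1 - companion p A) * Q) ∘L coordEmb p))) := by
  refine (tendsto_add_atTop_iff_nat 2).mp ?_
  simp only [sum_range_diffImpulse]
  have hc : Continuous fun f : ProdSpace B p →L[ℂ] ProdSpace B p =>
      -(coordProj p ∘L f ∘L coordEmb p) :=
    (continuous_const.clm_comp (continuous_id.clm_comp continuous_const)).neg
  exact (hc.tendsto _).comp (h.tendsto_pow_mul hρ0 hρ1 hd)

/-- N = (1 - a)Q is fixed by a from both sides, so a zero corner would give N = 0. But N undoes T^g
on 𝒦, which is nonzero. -/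
theorem IsNilProj.corner_ne_zero (h : IsNilProj (1 - companion p A) Q)
    {rC kC : Submodule ℂ (ProdSpace B p)}
    (hr : IsInternalDirectSum ⊤ (LinearMap.range (1 - companion p A).toLinearMap) rC)
    (hk : IsInternalDirectSum ⊤ (LinearMap.ker (1 - companion p A).toLinearMap) kC)
    (hI : I2Condition (1 - companion p A).toLinearMap hr hk) :
    coordProj p ∘L ((1 - companion p A) * Q) ∘L coordEmb p ≠ 0 := by
  intro h0
  refine hI.1 (eq_bot_iff.mpr fun x hx => ?_)
  have h1 : companion p A * ((1 - companion p A) * Q) = (1 - companion p A) * Q :=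
    ContinuousLinearMap.ext h.apply_mul
  have hc : Commute (companion p A) ((1 - companion p A) * Q) := by
    have h2 : Commute (1 - companion p A) ((1 - companion p A) * Q) :=
      (Commute.refl _).mul_right h.comm
    have := (Commute.one_left ((1 - companion p A) * Q)).sub_left h2
    rwa [sub_sub_cancel] at this
  have hN := eq_zero_of_corner_eq_zero A h1 (hc.eq ▸ h1) h0
  have hx' := h.mul_genInverse hr hk hx
  rw [hN] at hx'
  exact hx'.symm

/-- An autoregressive sequence whose second differences are those of the stationary solution has
no transient term. -/
theorem IsNilProj.autoregression_transient_eq_zero [CompleteSpace B]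
    (h : IsNilProj (1 - companion p A) Q) {x : ℤ → B}
    (hx : ∀ t : ℤ, 1 ≤ t → x t - ∑ j : Fin p, A j (x (t - ((j.val : ℤ) + 1))) = e t)
    (hs : StationarySummable (companion p A) Q (coordEmb p) e)
    (hΔ : ∀ t : ℤ, 1 ≤ t → x t - (2 : ℂ) • x (t - 1) + x (t - 2) =
      e t + coordProj p ((companion p A - 2) (coordEmb p (e (t - 1)))) +
        coordProj p (((1 - companion p A) * (1 - companion p A))
          (stationaryPart (companion p A) Q (coordEmb p) e (t - 2))))
    (hρ0 : 0 ≤ ρ) (hρ1 : ρ < 1) (hd : ∀ n : ℕ, ‖companion p A ^ n * (1 - Q)‖ ≤ c * ρ ^ n) (n : ℕ) :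
    coordProj p ((companion p A ^ n * (1 - Q)) (lagVec p x 0 -
      stationaryPart (companion p A) Q (coordEmb p) e 0)) = 0 := by
  refine IsNilProj.transient_eq_zero (E := ProdSpace B p) (a := companion p A) (Q := Q)
    (J := coordEmb p) (e := e) h (coordProj p) (X := lagVec p x)
    (V := stationaryPart (companion p A) Q (coordEmb p) e)
    (fun t ht => lagVec_eq A (hx t ht))
    (fun t _ => stationaryPart_recursion (E := ProdSpace B p) (a := companion p A) (Q := Q)
      (e := e) (coordEmb p) hs) (fun n => ?_) hρ0 hρ1 hd n
  -- Time n + 2 makes both recursions hold, at n + 2 and n + 1, and leaves (1 - a)² applied to the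
  -- lag vector at time n.
  have h1 := second_difference (E := ProdSpace B p) (a := companion p A) (coordEmb p) (e := e)
    (X := lagVec p x) (t := (n : ℤ) + 2) (lagVec_eq A (hx _ (by omega)))
    (by
      have := lagVec_eq A (hx ((n : ℤ) + 2 - 1) (by omega))
      rwa [sub_sub, one_add_one_eq_two] at this)
  have h2 := congrArg (coordProj p) h1
  rw [map_add, map_sub, map_smul, map_add, map_add, coordProj_lagVec, coordProj_lagVec,
    coordProj_lagVec, coordProj_coordEmb, hΔ _ (by omega), add_sub_cancel_right] at h2
  exact (add_left_cancel h2).symm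

end Companion

/-! ### Removal and decay of the transient; construction of I(2) solutions. -/

section Representation

variable {Ω : Type*} [MeasurableSpace Ω] {μ : Measure Ω}
  {B : Type*} [NormedAddCommGroup B] [NormedSpace ℂ B] [MeasurableSpace B]

theorem IsCenteredL2.add [IsFiniteMeasure μ] [BorelSpace B] [SecondCountableTopology B]
    {X Y : Ω → B} (hX : IsCenteredL2 μ X) (hY : IsCenteredL2 μ Y) :
    IsCenteredL2 μ (fun ω => X ω + Y ω) where
  measurable := hX.measurable.add hY.measurable
  memLp := hX.memLp.add hY.memLp
  mean_zero := by
    rw [integral_add (hX.memLp.integrable one_le_two) (hY.memLp.integrable one_le_two),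
      hX.mean_zero, hY.mean_zero, add_zero]

theorem IsCenteredL2.comp [IsFiniteMeasure μ] [BorelSpace B] [CompleteSpace B]
    {X : Ω → B} (hX : IsCenteredL2 μ X) (L : B →L[ℂ] B) : IsCenteredL2 μ (fun ω => L (X ω)) where
  measurable := L.continuous.measurable.comp hX.measurable
  memLp := L.comp_memLp' hX.memLp
  mean_zero := by
    rw [L.integral_comp_comm (hX.memLp.integrable one_le_two), hX.mean_zero, map_zero]

theorem IsCenteredL2.sum [IsFiniteMeasure μ] [BorelSpace B] [SecondCountableTopology B]
    {ι : Type*} {X : ι → Ω → B} (s : Finset ι) (hX : ∀ i ∈ s, IsCenteredL2 μ (X i)) :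
    IsCenteredL2 μ (fun ω => ∑ i ∈ s, X i ω) := by
  classical
  induction s using Finset.induction_on with
  | empty => exact ⟨by simp, by simp, by simp⟩
  | insert i s hi ih =>
    simp only [Finset.sum_insert hi]
    exact (hX i (Finset.mem_insert_self i s)).add
      (ih fun j hj => hX j (Finset.mem_insert_of_mem hj))

variable [IsProbabilityMeasure μ] [BorelSpace B] [CompleteSpace B]
  {p : ℕ} [NeZero p] {A : Fin p → B →L[ℂ] B} {ε X : ℤ → Ω → B}
  {Q : ProdSpace B p →L[ℂ] ProdSpace B p} {c ρ : ℝ}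

theorem ae_linProcess_diffImpulse (hε : IsInnovation μ ε) (h : IsNilProj (1 - companion p A) Q)
    (hc : 0 ≤ c) (hρ0 : 0 ≤ ρ) (hρ1 : ρ < 1)
    (hd : ∀ n : ℕ, ‖companion p A ^ n * (1 - Q)‖ ≤ c * ρ ^ n) :
    ∀ᵐ ω ∂μ, ∀ t : ℤ, linProcess (diffImpulse A) ε t ω =
      ε t ω + coordProj p ((companion p A - 2) (coordEmb p (ε (t - 1) ω))) +
        coordProj p (((1 - companion p A) * (1 - companion p A))
          (stationaryPart (companion p A) Q (coordEmb p) (fun s => ε s ω) (t - 2))) := by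
  filter_upwards [ae_linProcess_eq hε (h.summable_norm_diffImpulse hρ0 hρ1 hd),
    hε.ae_summable_stationaryPart hc hρ0 hρ1 hd (coordEmb p)] with ω h1 h2 t
  rw [h1]
  exact (IsNilProj.hasSum_secondDifference (E := ProdSpace B p) (a := companion p A) (Q := Q)
    (J := coordEmb p) (e := fun s => ε s ω) h h2 (coordProj p) (φ := diffImpulse A)
    (fun n => rfl) t).tsum_eq

/-- An I(2) process has no transient term. -/
theorem IsARSolution.ae_transient_eq_zero [SecondCountableTopology B] (hX : IsARSolution μ A ε X)
    (hI : IsI2 μ ε X) (hε : IsInnovation μ ε) (h : IsNilProj (1 - companion p A) Q)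
    (hc : 0 ≤ c) (hρ0 : 0 ≤ ρ) (hρ1 : ρ < 1)
    (hd : ∀ n : ℕ, ‖companion p A ^ n * (1 - Q)‖ ≤ c * ρ ^ n) :
    ∀ᵐ ω ∂μ, ∀ n : ℕ, coordProj p ((companion p A ^ n * (1 - Q)) (initialVec p X ω -
      stationaryPart (companion p A) Q (coordEmb p) (fun s => ε s ω) 0)) = 0 := by
  obtain ⟨C, -, -, hC⟩ := hI.exists_coeff
  have hCA := hX.coeff_eq hε hC
  rw [hCA] at hC
  -- With the coefficients known, the second differences equal a concrete linear process almost
  -- surely, so the remaining comparison is made path by path.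
  have hΔ : ∀ᵐ ω ∂μ, ∀ t : ℤ, 1 ≤ t →
      X t ω - (2 : ℂ) • X (t - 1) ω + X (t - 2) ω = linProcess (diffImpulse A) ε t ω := by
    rw [ae_all_iff]
    intro t
    refine eventually_imp_distrib_left.mpr fun ht => ?_
    exact IsLinearSum.ae_eq hε (memLp_secondDifference (hI.centered t (by omega)).memLp
      (hI.centered (t - 1) (by omega)).memLp (hI.centered (t - 2) (by omega)).memLp).1
      (measurable_linProcess hε _ t).aestronglyMeasurable (hC t ht)
      (isLinearSum_linProcess hε (h.summable_norm_diffImpulse hρ0 hρ1 hd) t)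
  filter_upwards [hX.ae_law, hΔ, ae_linProcess_diffImpulse hε h hc hρ0 hρ1 hd,
    hε.ae_summable_stationaryPart hc hρ0 hρ1 hd (coordEmb p)] with ω h1 h2 h3 h4 n
  rw [← lagVec_zero]
  exact h.autoregression_transient_eq_zero (x := fun s => X s ω) (e := fun s => ε s ω) h1 h4
    (fun t ht => (h2 t ht).trans (h3 t)) hρ0 hρ1 hd n

theorem isCenteredL2_linProcess [SecondCountableTopology B] (hε : IsInnovation μ ε)
    {φ : ℕ → B →L[ℂ] B} (hs : Summable fun k => ‖φ k‖) (t : ℤ) :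
    IsCenteredL2 μ (linProcess φ ε t) :=
  IsLinearSum.isCenteredL2 hε (measurable_linProcess hε φ t) (isLinearSum_linProcess hε hs t)

/-- The transient term decays geometrically. -/
theorem IsARSolution.exists_transient_le [SecondCountableTopology B] (hX : IsARSolution μ A ε X)
    (hε : IsInnovation μ ε) (hc : 0 ≤ c) (hρ0 : 0 ≤ ρ) (hρ1 : ρ < 1)
    (hd : ∀ n : ℕ, ‖companion p A ^ n * (1 - Q)‖ ≤ c * ρ ^ n) :
    ∃ R : Ω → ℝ, MemLp R 2 μ ∧ ∀ᵐ ω ∂μ, ∀ n : ℕ,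
      ‖coordProj p ((companion p A ^ n * (1 - Q)) (initialVec p X ω -
        stationaryPart (companion p A) Q (coordEmb p) (fun s => ε s ω) 0))‖ ≤ ρ ^ n * R ω := by
  set pr : Fin p → ProdSpace B p →L[ℂ] B := fun i => PiLp.proj 1 (fun _ : Fin p => B) i with hpr
  set Y : Fin p → Ω → B := fun i =>
    linProcess (fun k => pr i ∘L (companion p A ^ k * (1 - Q)) ∘L coordEmb p) ε 0 with hY
  have hYL : ∀ i, MemLp (Y i) 2 μ := fun i =>
    (isCenteredL2_linProcess hε (summable_norm_corner hρ0 hρ1 hd (coordEmb p) (pr i)) 0).memLp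
  have hXL : ∀ i : Fin p, MemLp (X (-(i.val : ℤ))) 2 μ := fun i =>
    (hX.centered _ (by have := i.isLt; omega)).memLp
  -- The coordinates of the stationary part at time 0 are linear processes, so this coordinatewise
  -- bound on the initial difference is square integrable.
  refine ⟨fun ω => ‖(coordProj p : ProdSpace B p →L[ℂ] B)‖ * c *
    ∑ i, (‖X (-(i.val : ℤ)) ω‖ + ‖Y i ω‖), ?_, ?_⟩
  · exact (memLp_finsetSum _ fun i _ => (hXL i).norm.add (hYL i).norm).const_mul _
  · filter_upwards [ae_all_iff.mpr fun i =>
      ae_linProcess_corner hε hc hρ0 hρ1 hd (coordEmb p) (pr i)] with ω hω n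
    set V := stationaryPart (companion p A) Q (coordEmb p) (fun s => ε s ω) 0 with hV
    have h1 : ‖initialVec p X ω - V‖ ≤ ∑ i, (‖X (-(i.val : ℤ)) ω‖ + ‖Y i ω‖) := by
      rw [PiLp.norm_eq_of_L1]
      refine Finset.sum_le_sum fun i _ => (norm_sub_le _ _).trans_eq ?_
      rw [hY]
      simp only
      rw [hω i 0]
      rfl
    have h2 : ‖(companion p A ^ n * (1 - Q)) (initialVec p X ω - V)‖ ≤
        c * ρ ^ n * ‖initialVec p X ω - V‖ :=
      ContinuousLinearMap.le_of_opNorm_le _ (hd n) _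
    calc _ ≤ ‖(coordProj p : ProdSpace B p →L[ℂ] B)‖ *
          ‖(companion p A ^ n * (1 - Q)) (initialVec p X ω - V)‖ :=
          ContinuousLinearMap.le_opNorm _ _
      _ ≤ ‖(coordProj p : ProdSpace B p →L[ℂ] B)‖ * (c * ρ ^ n *
          ∑ i, (‖X (-(i.val : ℤ)) ω‖ + ‖Y i ω‖)) := by
        refine mul_le_mul_of_nonneg_left (h2.trans ?_) (norm_nonneg _)
        exact mul_le_mul_of_nonneg_left h1 (mul_nonneg hc (pow_nonneg hρ0 n))
      _ = _ := by ring

/-- The autoregressive process with vanishing nilpotent part up to time `s`. -/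
def rootProcess (A : Fin p → B →L[ℂ] B) (Q : ProdSpace B p →L[ℂ] ProdSpace B p) (ε : ℤ → Ω → B)
    (s t : ℤ) (ω : Ω) : B :=
  linProcess (fun k => coordProj p ∘L (companion p A ^ k * (1 - Q)) ∘L coordEmb p) ε t ω +
    ∑ k ∈ Finset.range (t - s).toNat,
      (coordProj p ∘L (companion p A ^ k * Q) ∘L coordEmb p) (ε (t - k) ω)

theorem isCenteredL2_rootProcess [SecondCountableTopology B] (hε : IsInnovation μ ε)
    (hρ0 : 0 ≤ ρ) (hρ1 : ρ < 1) (hd : ∀ n : ℕ, ‖companion p A ^ n * (1 - Q)‖ ≤ c * ρ ^ n)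
    (s t : ℤ) : IsCenteredL2 μ (rootProcess A Q ε s t) :=
  (isCenteredL2_linProcess hε
      (summable_norm_corner hρ0 hρ1 hd (coordEmb p) (coordProj p)) t).add
    (IsCenteredL2.sum _ fun k _ => (hε.centered (t - k)).comp _)

theorem ae_rootProcess (hε : IsInnovation μ ε) (hc : 0 ≤ c) (hρ0 : 0 ≤ ρ) (hρ1 : ρ < 1)
    (hd : ∀ n : ℕ, ‖companion p A ^ n * (1 - Q)‖ ≤ c * ρ ^ n) (s : ℤ) :
    ∀ᵐ ω ∂μ, ∀ t : ℤ, rootProcess A Q ε s t ω =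
      coordProj p (stationaryPart (companion p A) Q (coordEmb p) (fun s => ε s ω) t +
        nilpotentPart (companion p A) Q (coordEmb p) (fun s => ε s ω) s t) := by
  filter_upwards [ae_linProcess_corner hε hc hρ0 hρ1 hd (coordEmb p) (coordProj p)] with ω hω t
  rw [rootProcess, hω t, map_add, nilpotentPart, map_sum]
  rfl

theorem isARSolution_rootProcess [SecondCountableTopology B] (hε : IsInnovation μ ε) (hc : 0 ≤ c)
    (hρ0 : 0 ≤ ρ) (hρ1 : ρ < 1) (hd : ∀ n : ℕ, ‖companion p A ^ n * (1 - Q)‖ ≤ c * ρ ^ n)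
    {s : ℤ} (hs : s + p ≤ 1) : IsARSolution μ A ε (rootProcess A Q ε s) where
  centered t _ := isCenteredL2_rootProcess hε hρ0 hρ1 hd s t
  law t ht := by
    filter_upwards [ae_rootProcess hε hc hρ0 hρ1 hd s,
      hε.ae_summable_stationaryPart hc hρ0 hρ1 hd (coordEmb p)] with ω h1 h2
    simp only [h1]
    exact law_of_companion_recursion A (s := s) (e := fun s => ε s ω)
      (V := fun t => stationaryPart (companion p A) Q (coordEmb p) (fun s => ε s ω) t +
        nilpotentPart (companion p A) Q (coordEmb p) (fun s => ε s ω) s t)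
      (fun t ht => stationaryPart_add_nilpotentPart_recursion (E := ProdSpace B p)
        (a := companion p A) (Q := Q) (J := coordEmb p) (e := fun s => ε s ω) h2 ht) t (by omega)

/-- The nilpotent part is killed by (1 - a)², so from s + 2 on the second differences are those of
the stationary part together with the two leading innovation terms. With s < 0 this covers all t ≥
1. -/
theorem isI2_rootProcess [SecondCountableTopology B] (hε : IsInnovation μ ε)
    (h : IsNilProj (1 - companion p A) Q) (hc : 0 ≤ c)
    (hρ0 : 0 ≤ ρ) (hρ1 : ρ < 1) (hd : ∀ n : ℕ, ‖companion p A ^ n * (1 - Q)‖ ≤ c * ρ ^ n)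
    (h0 : coordProj p ∘L ((1 - companion p A) * Q) ∘L coordEmb p ≠ 0)
    {s : ℤ} (hs : s < 0) : IsI2 μ ε (rootProcess A Q ε s) where
  centered t _ := isCenteredL2_rootProcess hε hρ0 hρ1 hd s t
  exists_coeff := by
    refine ⟨diffImpulse A, h.summable_mul_norm_sq_diffImpulse hρ0 hρ1 hd,
      ⟨_, neg_ne_zero.mpr h0, h.tendsto_sum_diffImpulse hρ0 hρ1 hd⟩, fun t ht => ?_⟩
    refine (isLinearSum_linProcess hε (h.summable_norm_diffImpulse hρ0 hρ1 hd) t).congr_ae ?_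
    filter_upwards [ae_rootProcess hε hc hρ0 hρ1 hd s,
      hε.ae_summable_stationaryPart hc hρ0 hρ1 hd (coordEmb p),
      ae_linProcess_diffImpulse hε h hc hρ0 hρ1 hd] with ω h1 h2 h3
    rw [h1, h1, h1, h3, ← map_smul, ← map_sub, ← map_add]
    have h4 := IsNilProj.second_difference_solution (E := ProdSpace B p) (a := companion p A)
      (Q := Q) (J := coordEmb p) (e := fun s => ε s ω) h h2 (s := s) (t := t) (by omega)
      (W := fun t => stationaryPart (companion p A) Q (coordEmb p) (fun s => ε s ω) t +
        nilpotentPart (companion p A) Q (coordEmb p) (fun s => ε s ω) s t) (fun t => rfl)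
    refine Eq.trans ?_ (congrArg (coordProj p) h4).symm
    rw [map_add, map_add, coordProj_coordEmb]

end Representation

end

/-! ### The main theorem. -/

theorem mainTheorem4
    {B : Type*} [NormedAddCommGroup B] [NormedSpace ℂ B] [CompleteSpace B]
    [TopologicalSpace.SeparableSpace B] [MeasurableSpace B] [BorelSpace B]
    {Ω : Type*} [MeasurableSpace Ω] (μ : Measure Ω) [IsProbabilityMeasure μ]
    (p : ℕ) [NeZero p] (A : Fin p → B →L[ℂ] B) (ε : ℤ → Ω → B) (hε : IsInnovation μ ε)
    (𝒜 : ProdSpace B p →L[ℂ] ProdSpace B p) (h𝒜 : 𝒜 = companion p A)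
    (T : ProdSpace B p →ₗ[ℂ] ProdSpace B p) (hT : T = LinearMap.id - 𝒜.toLinearMap)
    (η : ℝ) (hη : 0 < η) (hunit : pencilSpectrum 𝒜 ∩ Metric.ball 0 (1 + η) = {1})
    (rC kC : Submodule ℂ (ProdSpace B p))
    (hr : IsInternalDirectSum ⊤ (LinearMap.range T) rC)
    (hk : IsInternalDirectSum ⊤ (LinearMap.ker T) kC)
    (r : ℝ) (hr0 : 0 < r) (hrη : r < η)
    (N P : ProdSpace B p →L[ℂ] ProdSpace B p)
    (hN : N = laurentN 𝒜 r (-2)) (hP : P = rieszP 𝒜 r) :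
    (I2Condition T hr hk →
      -- complementary subspaces of `𝒦` in `ker T` and of `𝒲` in `rC` exist
      (∃ KC WC : Submodule ℂ (ProdSpace B p),
        IsInternalDirectSum (LinearMap.ker T) (kSpace T) KC ∧
        IsInternalDirectSum rC (wSpace T hr) WC) ∧
      -- for any choice of them, the closed-form expressions of `N` and `P` hold
      (∀ (KC WC : Submodule ℂ (ProdSpace B p))
        (_ : IsInternalDirectSum (LinearMap.ker T) (kSpace T) KC)
        (hW : IsInternalDirectSum rC (wSpace T hr) WC),
        ∃ (e : kSpace T ≃ₗ[ℂ] WC) (q : KC ≃ₗ[ℂ] wSpace T hr),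
          (∀ x : kSpace T, e x =
            WC.projectionOnto _ (hr.isCompl_sup_left hW.symm) (genInverse T hr hk x)) ∧
          (∀ x : KC, (q x : ProdSpace B p) = x - rangeProj T hr x) ∧
          (∀ x, N x = e.symm (WC.projectionOnto _ (hr.isCompl_sup_left hW.symm) x)) ∧
          (∀ ΓL ΓR Qg : ProdSpace B p →ₗ[ℂ] ProdSpace B p,
            ΓL = genInverse T hr hk ∘ₗ N.toLinearMap →
            ΓR = N.toLinearMap ∘ₗ genInverse T hr hk →
            Qg = KC.subtype ∘ₗ q.symm.toLinearMap ∘ₗ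
              (wSpace T hr).projectionOnto _ (hr.isCompl_sup_left hW) →
            P.toLinearMap = ΓR + (LinearMap.id - ΓR) ∘ₗ
              (ΓL + Qg ∘ₗ (LinearMap.id - rangeProj T hr) ∘ₗ (LinearMap.id - ΓL)))) ∧
      -- the representation
      (∃ (L₀ L₁ : ProdSpace B p →L[ℂ] B) (ν : ℕ → Ω → B),
        IsStationaryProc μ ν ∧
        (∀ t : ℕ, IsCenteredL2 μ (ν t) ∧
          IsLinearSum μ ε
            (fun j => coordProj p ∘L (𝒜 ^ j * (1 - P)) ∘L coordEmb p) (t : ℤ) (ν t)) ∧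
        (∀ X : ℤ → Ω → B, IsARSolution μ A ε X → IsI2 μ ε X →
          ∀ t : ℕ, ∀ᵐ ω ∂μ, X t ω =
            i2Representation (fun ω => L₀ (initialVec p X ω)) (fun ω => L₁ (initialVec p X ω))
              (coordProj p ∘L N ∘L coordEmb p) (coordProj p ∘L (N + P) ∘L coordEmb p) ε ν t ω) ∧
        (∃ a : ℝ, 0 ≤ a ∧ a < 1 ∧
          ∀ X : ℤ → Ω → B, IsARSolution μ A ε X →
            ∃ R : Ω → ℝ, MemLp R 2 μ ∧ ∀ t : ℕ, ∀ᵐ ω ∂μ,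
              ‖X t ω -
                i2Representation (fun ω => L₀ (initialVec p X ω))
                  (fun ω => L₁ (initialVec p X ω))
                  (coordProj p ∘L N ∘L coordEmb p) (coordProj p ∘L (N + P) ∘L coordEmb p)
                  ε ν t ω‖ ≤ a ^ t * R ω)) ∧
      -- such solutions exist
      (∃ X : ℤ → Ω → B, IsARSolution μ A ε X ∧ IsI2 μ ε X)) ∧
    (¬ I2Condition T hr hk → ∀ X : ℤ → Ω → B, IsARSolution μ A ε X → ¬ IsI2 μ ε X) := by
  subst h𝒜
  obtain rfl : T = (1 - companion p A).toLinearMap := hT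
  have : SecondCountableTopology B := UniformSpace.secondCountable_of_separable B
  refine ⟨fun hI => ?_, fun hI X hX hX2 => hI (I2Condition_of_isI2 hε hX hX2 hr hk)⟩
  obtain ⟨Q, h⟩ := IsNilProj.exists_of_I2Condition hr hk hI
  obtain ⟨c, ρ, hc, hρ0, hρ1, hd⟩ := h.exists_decay hη hunit
  -- The contour integrals are now identified with the abstract splitting and play no further role.
  obtain rfl : N = (1 - companion p A) * Q := hN.trans (h.laurentN_eq hunit hr0 hrη).2
  obtain rfl : P = Q := hP.trans (h.rieszP_eq hunit hr0 hrη)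
  refine ⟨h.exists_complements hr hk hI, h.closed_forms hr hk hI,
    ⟨coordProj p ∘L P, -(coordProj p ∘L ((1 - companion p A) * P)),
      fun t : ℕ => linProcess
        (fun k => coordProj p ∘L (companion p A ^ k * (1 - P)) ∘L coordEmb p) ε t,
      isStationaryProc_linProcess hε _, fun t => ?_, fun X hX hX2 t => ?_,
      ρ, hρ0, hρ1, fun X hX => ?_⟩,
    -- The starting time -p meets both requirements: s + p ≤ 1 for the autoregressive law from t =
    -- 1, and s < 0 for the second differences.
    rootProcess A P ε (-(p : ℤ)), isARSolution_rootProcess hε hc hρ0 hρ1 hd (by omega),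
    isI2_rootProcess hε h hc hρ0 hρ1 hd (h.corner_ne_zero hr hk hI)
      (neg_neg_of_pos (Nat.cast_pos.mpr (NeZero.pos p)))⟩
  · have hs := summable_norm_corner hρ0 hρ1 hd (coordEmb p) (coordProj p)
    exact ⟨isCenteredL2_linProcess hε hs t, isLinearSum_linProcess hε hs t⟩
  · filter_upwards [hX.ae_eq_representation hε h hc hρ0 hρ1 hd,
      hX.ae_transient_eq_zero hX2 hε h hc hρ0 hρ1 hd] with ω h1 h2
    rw [h1 t, h2 t, add_zero]
  · obtain ⟨R, hR, hle⟩ := hX.exists_transient_le hε hc hρ0 hρ1 hd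
    refine ⟨R, hR, fun t => ?_⟩
    filter_upwards [hX.ae_eq_representation hε h hc hρ0 hρ1 hd, hle] with ω h1 h2
    rw [h1 t, add_sub_cancel_left]
    exact h2 t
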